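/- Let $0<a<1$, let $y_-$ be the negative root and $y_+$ the smallest positive root of $a-3y^2+2y^3=0$, and put $$w(y)=\frac{2(a-y^2)}{1-y},\quad r(y)=\frac{a-3y^2+2y^3}{a-y^2},\quad h(y)=\frac{a-2y+y^2}{6(a-y^2)},\quad \rho(y)=\frac{1-y}{18}.$$ Let $p,q$ be coprime positive integers with $q<2p$ such that $$\frac{h(y_+)-h(y_-)}{2h(y_+)}=\frac pq ,$$ and set $\tau=-2h(y_+)/q$ and $\sigma=\operatorname{lcm}\{2,pq,2p-q\}$. For $m,l\in\mathbb Z$ and $\Lambda\ge 0$ consider $$S_{ml}(\Lambda)=\frac1{\rho}\frac{d}{dy}\,\rho\, w\, r\,\frac{d}{dy}-\frac1{w}\Big(\frac{\sigma l}{\tau}\Big)^2-\frac9{r}\Big(2m-h\,\frac{\sigma l}{\tau}\Big)^2-\frac{6\Lambda}{1-y}$$ on the interval $(y_-,y_+)$. Let $\mathrm{AC}((y_-,y_+))$ be the set of continuously differentiable functions $f:(y_-,y_+)\to\mathbb C$ whose derivative is absolutely continuous on every compact subset. Then $S_{ml}(\Lambda)$, with domain the set of all $f\in \mathrm{AC}((y_-,y_+))\cap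 L^2((y_-,y_+),\rho\,dy)$ such that $S_{ml}(\Lambda)f\in L^2((y_-,y_+),\rho\,dy)$ and $$\lim_{y\searrow y_-}(y-y_-)f'(y)=0\ \text{ if } m=\tfrac{(2p-q)\sigma l}4,\qquad \lim_{y\nearrow y_+}(y-y_+)f'(y)=0\ \text{ if } m=-\tfrac{q\sigma l}4,$$ is a densely defined self-adjoint operator in the complex Hilbert space $L^2((y_-,y_+),\rho\,dy)$, and $-S_{ml}(\Lambda)$ is nonnegative. Its spectrum consists of a strictly decreasing sequence of eigenvalues $(-\ell_{mlk}(\Lambda))_{k\in\mathbb N}$ of multiplicity one that tends to $-\infty$, and every associated eigenfunction is $\mathcal O\big((y_+-y)^{\nu_+}\big)$ as $y\nearrow y_+$ and $\mathcal O\big((y-y_-)^{\nu_-}\big)$ as $y\searrow y_-$, where $\nu_+=|m+q\sigma l/4|$ and $\nu_-=|m+(q-2p)\sigma l/4|$. -/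

import Mathlib

open Set Filter Topology MeasureTheory Asymptotics

noncomputable section

namespace Ypq

/-! ### Coefficient functions and constants of the `Y^{p,q}` metric -/

/-- The cubic polynomial `a - 3y² + 2y³`. -/
def cubic (a y : ℝ) : ℝ := a - 3 * y ^ 2 + 2 * y ^ 3

/-- `w(y) = 2(a - y²)/(1 - y)`. -/
def w (a y : ℝ) : ℝ := 2 * (a - y ^ 2) / (1 - y)

/-- `r(y) = (a - 3y² + 2y³)/(a - y²)`. -/
def r (a y : ℝ) : ℝ := (a - 3 * y ^ 2 + 2 * y ^ 3) / (a - y ^ 2)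

/-- `h(y) = (a - 2y + y²)/(6(a - y²))`. -/
def h (a y : ℝ) : ℝ := (a - 2 * y + y ^ 2) / (6 * (a - y ^ 2))

/-- `ρ(y) = (1 - y)/18`. -/
def rho (y : ℝ) : ℝ := (1 - y) / 18

/-- `τ = -2 h(y₊)/q`. -/
def tau (a yp : ℝ) (q : ℕ) : ℝ := -2 * h a yp / q

/-- `σ = lcm {2, pq, 2p - q}` (used for `q < 2p`, so the subtraction does not truncate). -/
def sigma (p q : ℕ) : ℕ := Nat.lcm 2 (Nat.lcm (p * q) (2 * p - q))

/-- The frequency `σ l / τ`. -/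
def freq (a yp : ℝ) (p q : ℕ) (l : ℤ) : ℝ := (sigma p q : ℝ) * (l : ℝ) / tau a yp q

/-- The exponent `ν₊ = |m + q σ l / 4|` at `y₊`. -/
def nuPlus (p q : ℕ) (m l : ℤ) : ℝ :=
  |(m : ℝ) + (q : ℝ) * (sigma p q : ℝ) * (l : ℝ) / 4|

/-- The exponent `ν₋ = |m + (q - 2p) σ l / 4|` at `y₋`. -/
def nuMinus (p q : ℕ) (m l : ℤ) : ℝ :=
  |(m : ℝ) + ((q : ℝ) - 2 * (p : ℝ)) * (sigma p q : ℝ) * (l : ℝ) / 4|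

/-! ### The Hilbert space `L²((y₋, y₊), ρ dy)` and the differential operator -/

/-- The measure `ρ(y) dy` on the interval `(y₋, y₊)`. -/
def rhoMeasure (ym yp : ℝ) : Measure ℝ :=
  (volume.restrict (Ioo ym yp)).withDensity (fun y => ENNReal.ofReal (rho y))

/-- The complex Hilbert space `L²((y₋, y₊), ρ dy)`. -/
abbrev H (ym yp : ℝ) : Type := Lp ℂ 2 (rhoMeasure ym yp)

/-- The class `AC(I)`, `I = (y₋, y₊)`: continuously differentiable functions on `I` whose
derivative is absolutely continuous on every compact subinterval of `I`. -/
def IsAC (ym yp : ℝ) (f : ℝ → ℂ) : Prop :=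
  ContDiffOn ℝ 1 f (Ioo ym yp) ∧
    ∀ c d : ℝ, c ≤ d → Icc c d ⊆ Ioo ym yp → AbsolutelyContinuousOnInterval (deriv f) c d

/-- The differential expression
`(1/ρ) d/dy (ρ w r df/dy) - (1/w)(σl/τ)² f - (9/r)(2m - h σl/τ)² f - (6Λ/(1-y)) f`,
evaluated at `y`. For `f` of class `AC` the outer derivative exists at almost every `y`. -/
def S (a yp : ℝ) (p q : ℕ) (m l : ℤ) (Λ : ℝ) (f : ℝ → ℂ) (y : ℝ) : ℂ :=
  ((1 / rho y : ℝ) : ℂ) *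
      deriv (fun x : ℝ => ((rho x * w a x * r a x : ℝ) : ℂ) * deriv f x) y
    - ((1 / w a y * freq a yp p q l ^ 2 : ℝ) : ℂ) * f y
    - ((9 / r a y * (2 * (m : ℝ) - h a y * freq a yp p q l) ^ 2 : ℝ) : ℂ) * f y
    - ((6 * Λ / (1 - y) : ℝ) : ℂ) * f y

/-- The boundary conditions: `(y - y₋) f'(y) → 0` as `y ↘ y₋` if `m = (2p - q)σl/4`, and
`(y - y₊) f'(y) → 0` as `y ↗ y₊` if `m = -qσl/4`. -/
def BoundaryCond (ym yp : ℝ) (p q : ℕ) (m l : ℤ) (f : ℝ → ℂ) : Prop :=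
  ((m : ℝ) = (2 * (p : ℝ) - (q : ℝ)) * (sigma p q : ℝ) * (l : ℝ) / 4 →
      Tendsto (fun y : ℝ => ((y - ym : ℝ) : ℂ) * deriv f y) (𝓝[>] ym) (𝓝 0)) ∧
    ((m : ℝ) = -((q : ℝ) * (sigma p q : ℝ) * (l : ℝ) / 4) →
      Tendsto (fun y : ℝ => ((y - yp : ℝ) : ℂ) * deriv f y) (𝓝[<] yp) (𝓝 0))

/-- `A` is the operator in `L²((y₋, y₊), ρ dy)` defined by the differential expression `S`: its
domain consists of the (classes of) functions `f` of class `AC` in `L²` with `S f` in `L²` that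
satisfy the boundary conditions, and `A f = S f` there. Since the graph is prescribed, at most one
`A` has this property. -/
def IsRealization (a ym yp : ℝ) (p q : ℕ) (m l : ℤ) (Λ : ℝ)
    (A : H ym yp →ₗ.[ℂ] H ym yp) : Prop :=
  ∀ u v : H ym yp, (u, v) ∈ A.graph ↔
    ∃ f : ℝ → ℂ, IsAC ym yp f ∧ BoundaryCond ym yp p q m l f ∧
      (u : ℝ → ℂ) =ᵐ[rhoMeasure ym yp] f ∧
      (v : ℝ → ℂ) =ᵐ[rhoMeasure ym yp] S a yp p q m l Λ f

/-! ### Spectral notions for unbounded operators -/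

section Spectral

variable {E : Type*} [NormedAddCommGroup E] [InnerProductSpace ℂ E]

/-- The resolvent set of an unbounded operator `A`: those `z` for which `A - z : dom A → E` has a
two-sided inverse that is a bounded operator on `E`. -/
def resolventSet (A : E →ₗ.[ℂ] E) : Set ℂ :=
  {z | ∃ R : E →L[ℂ] E, (∀ v : E, ∃ u : A.domain, (u : E) = R v ∧ A u - z • (u : E) = v) ∧
    ∀ u : A.domain, R (A u - z • (u : E)) = u}

/-- The spectrum of an unbounded operator. -/
def spectrum (A : E →ₗ.[ℂ] E) : Set ℂ := (resolventSet A)ᶜ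

/-- The eigenspace `{u ∈ dom A : A u = z u}`. -/
def eigenspace (A : E →ₗ.[ℂ] E) (z : ℂ) : Submodule ℂ E where
  carrier := {u | (u, z • u) ∈ A.graph}
  zero_mem' := by
    change ((0 : E), z • (0 : E)) ∈ A.graph
    rw [smul_zero]
    exact A.graph.zero_mem
  add_mem' := by
    intro u v hu hv
    have := A.graph.add_mem hu hv
    simpa [smul_add] using this
  smul_mem' := by
    intro c u hu
    have := A.graph.smul_mem c hu
    simpa [smul_comm z c u] using this

end Spectral

end Ypq

end

/-! Multiplied by `ρ`, the operator `-S` becomes the Sturm–Liouville expression `-(P f')' + q f`.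
Here `P = ρ w r` is one ninth of the cubic, so it has simple zeros at both end points, and `q ≥ 0`
has at most simple poles there (`potential_eq`). The characteristic exponents are `±ν₋` and `±ν₊`
(`singularCoeff_left`, `singularCoeff_right`). Because `σ` is even, each `ν` is half an integer,
hence zero or at least `1/2` (`nuMinus_dichotomy`, `nuPlus_dichotomy`). For `ν ≥ 1/2` the singular
solution is not square integrable and no boundary condition is needed; for `ν = 0` it is logarithmic
and the boundary condition excludes it.

Instead of solving the equation itself, the proof uses an explicit positive function `E = (y -
lo)^nl φ(hi - y)`, regular at `lo` and singular at `hi`. It solves `(P f')' = (dQ / E) f` exactly,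
and the potential `dQ / E` has the same poles as `q`, so the two differ by a bounded function
(`exists_rem_le`). Reduction of order yields the second solution `E V`, regular at `hi`, and from
both a Green operator `sol`. Size estimates for `E` and `E V` together with Cauchy–Schwarz show that
`sol` maps `L²` into bounded functions (`exists_sol_le`), is symmetric (`integral_sol_mul`),
respects the boundary conditions, and gives the only square integrable solution that does
(`eq_sol`). Uniformly bounded point evaluations make it a Carleman operator, hence compact
(`exists_compact_of_inner_kernel`).

Thus `-A = R₀⁻¹ + B` with `R₀` compact, symmetric, injective and `B` a bounded multiplication. The
quadratic form is nonnegative by a growth argument that needs only boundedness of `f`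
(`integral_re_nonneg`). Hence the Fredholm alternative produces a compact symmetric inverse of `1 -
A` (`exists_resolvent_of_perturbation`), from which self-adjointness and discreteness of the
spectrum follow abstractly (`isSelfAdjoint_ofResolvent`, `discrete_spectrum_ofResolvent`).

Eigenvalues are simple because the Wronskian of two eigenfunctions vanishes at `lo`
(`exists_eq_const_mul_sol`). For the decay, an eigenfunction satisfies `f = sol (β f)` with bounded
`β`, and each use of this identity improves the decay by half a power until the exponent `ν` is
reached (`exists_le_rpow_of_gain`, `isBigO_sol`). -/

noncomputable section

namespace Ypq

/-! ### Unbounded operators prescribed by their resolvent at `1`. -/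

section Resolvent

variable {E : Type*} [NormedAddCommGroup E] [InnerProductSpace ℂ E]

/-- The unbounded operator `A` with `(1 - A)⁻¹ = R`. -/
def ofResolvent (R : E →L[ℂ] E) (hR : Function.Injective R) : E →ₗ.[ℂ] E where
  domain := LinearMap.range R.toLinearMap
  toFun := (LinearMap.range R.toLinearMap).subtype -
    ((LinearEquiv.ofInjective R.toLinearMap hR).symm : _ →ₗ[ℂ] E)

theorem mem_graph_ofResolvent (R : E →L[ℂ] E) (hR : Function.Injective R) (u v : E) :
    (u, v) ∈ (ofResolvent R hR).graph ↔ u = R (u - v) := by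
  rw [LinearPMap.mem_graph_iff]
  constructor
  · rintro ⟨⟨y, g, rfl⟩, rfl, rfl⟩
    have : (LinearEquiv.ofInjective R.toLinearMap hR).symm ⟨R.toLinearMap g, g, rfl⟩ = g := by
      rw [LinearEquiv.symm_apply_eq]; rfl
    change R g = R (R g - (R g - (LinearEquiv.ofInjective R.toLinearMap hR).symm
      ⟨R.toLinearMap g, g, rfl⟩))
    rw [this]; congr 1; abel
  · intro h
    refine ⟨⟨u, u - v, h.symm⟩, rfl, ?_⟩
    have : (LinearEquiv.ofInjective R.toLinearMap hR).symm ⟨u, u - v, h.symm⟩ = u - v := by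
      rw [LinearEquiv.symm_apply_eq]; exact Subtype.ext h
    change u - (LinearEquiv.ofInjective R.toLinearMap hR).symm ⟨u, u - v, h.symm⟩ = v
    rw [this]; abel

theorem mem_eigenspace_ofResolvent {R : E →L[ℂ] E} (hR : Function.Injective R) (z : ℂ) (u : E) :
    u ∈ eigenspace (ofResolvent R hR) z ↔ u = (1 - z) • R u := by
  change (u, z • u) ∈ (ofResolvent R hR).graph ↔ _
  rw [mem_graph_ofResolvent, ← R.map_smul, sub_smul, one_smul]

variable [CompleteSpace E] {R : E →L[ℂ] E}

/-- The orthogonal complement of the range of a symmetric operator is its kernel, which injectivity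
makes trivial. -/
theorem dense_domain_ofResolvent (hR : Function.Injective R)
    (hs : R.toLinearMap.IsSymmetric) : Dense ((ofResolvent R hR).domain : Set E) := by
  change Dense ((LinearMap.range R.toLinearMap : Submodule ℂ E) : Set E)
  rw [Submodule.dense_iff_topologicalClosure_eq_top,
    Submodule.topologicalClosure_eq_top_iff, Submodule.eq_bot_iff]
  intro x hx
  rw [Submodule.mem_orthogonal] at hx
  have h1 : R x = 0 := by
    rw [← inner_self_eq_zero (𝕜 := ℂ)]
    have := hx (R (R x)) ⟨R x, rfl⟩
    rw [← this]
    exact (hs (R x) x).symm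
  exact hR (by rw [h1, map_zero])

/-- The graph consists of the pairs `(R g, R g - g)`. So `(x, y)` lies in the adjoint graph exactly
when `⟪R g - g, x⟫ = ⟪R g, y⟫` for all `g`, and symmetry of `R` turns this into `x = R (x - y)`,
which is membership in the graph itself. -/
theorem isSelfAdjoint_ofResolvent (hR : Function.Injective R)
    (hs : R.toLinearMap.IsSymmetric) : IsSelfAdjoint (ofResolvent R hR) := by
  rw [LinearPMap.isSelfAdjoint_def]
  apply LinearPMap.eq_of_eq_graph
  rw [LinearPMap.adjoint_graph_eq_graph_adjoint (dense_domain_ofResolvent hR hs)]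
  ext ⟨x, y⟩
  rw [Submodule.mem_adjoint_iff, mem_graph_ofResolvent]
  have hs' : ∀ a b, inner ℂ (R a) b = inner ℂ a (R b) := fun a b => hs a b
  constructor
  · intro h
    refine ext_inner_left ℂ fun g => ?_
    have := h (R g) (R g - g) ((mem_graph_ofResolvent R hR _ _).2 (by simp))
    rw [← hs', inner_sub_right]
    rw [inner_sub_left, sub_eq_zero] at this
    linear_combination -this
  · intro h a b hab
    rw [mem_graph_ofResolvent] at hab
    have h1 := hs' (a - b) (x - y)
    rw [← h, ← hab, inner_sub_left, inner_sub_right] at h1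
    simp only
    linear_combination h1

/-- On the domain, `A - z = -(1 - (1 - z) R) R⁻¹`. By the Fredholm alternative for the compact `R`,
the bracket has a bounded inverse `T` as soon as it is injective, and then `-R T` inverts `A - z`.
-/
theorem mem_resolventSet_ofResolvent (hR : Function.Injective R) (hc : IsCompactOperator R)
    (z : ℂ) : z ∈ resolventSet (ofResolvent R hR) ↔
      eigenspace (ofResolvent R hR) z = ⊥ := by
  constructor
  · rintro ⟨S, -, hS⟩
    rw [Submodule.eq_bot_iff]
    intro u hu
    have hu' : (u, z • u) ∈ (ofResolvent R hR).graph := hu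
    rw [LinearPMap.mem_graph_iff] at hu'
    obtain ⟨y, hy1, hy2⟩ := hu'
    have := hS y
    simp only at hy1 hy2
    rw [hy2, hy1, sub_self, map_zero] at this
    exact this.symm
  · intro h
    have hunit : ∃ T : E →L[ℂ] E, (∀ x, (T x) - (1 - z) • R (T x) = x) ∧
        ∀ x, T (x - (1 - z) • R x) = x := by
      -- For `z = 1` the bracket is the identity. Otherwise it is `1 - z` times `(1 - z)⁻¹ - R`, to
      -- which the alternative for `R` applies.
      by_cases hz : 1 - z = 0
      · exact ⟨1, by simp [hz], by simp [hz]⟩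
      · have hne : (1 - z)⁻¹ ≠ 0 := inv_ne_zero hz
        rcases hc.hasEigenvalue_or_mem_resolventSet hne with he | he
        · exfalso
          obtain ⟨u, hu⟩ := he.exists_hasEigenvector
          have h1 : R u = (1 - z)⁻¹ • u := hu.apply_eq_smul
          have : u ∈ eigenspace (ofResolvent R hR) z := by
            rw [mem_eigenspace_ofResolvent, h1, smul_smul, mul_inv_cancel₀ hz, one_smul]
          rw [h] at this
          exact hu.2 this
        · rw [_root_.spectrum.mem_resolventSet_iff] at he
          obtain ⟨W, hW⟩ := he
          have hW1 : ∀ x, W.1 x = (1 - z)⁻¹ • x - R x := fun x => by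
            rw [hW]; simp [Algebra.algebraMap_eq_smul_one]
          have hW2 : ∀ x, W.1 ((↑W⁻¹ : E →L[ℂ] E) x) = x := fun x => by
            rw [← mul_apply_eq_comp, W.mul_inv]; rfl
          have hW3 : ∀ x, (↑W⁻¹ : E →L[ℂ] E) (W.1 x) = x := fun x => by
            rw [← mul_apply_eq_comp, W.inv_mul]; rfl
          have key : ∀ x, x - (1 - z) • R x = (1 - z) • W.1 x := fun x => by
            rw [hW1, smul_sub, smul_smul, mul_inv_cancel₀ hz, one_smul]
          refine ⟨(1 - z)⁻¹ • (↑W⁻¹ : E →L[ℂ] E), fun x => ?_, fun x => ?_⟩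
          · rw [key]
            simp [hW2, smul_smul, mul_inv_cancel₀ hz]
          · rw [key]
            simp [hW3, smul_smul, mul_inv_cancel₀ hz]
    obtain ⟨T, hT1, hT2⟩ := hunit
    have hTR : ∀ x, T (R x) = R (T x) := fun x => by
      have h1 := hT1 x
      calc T (R x) = T (R (T x - (1 - z) • R (T x))) := by rw [h1]
        _ = T (R (T x) - (1 - z) • R (R (T x))) := by simp
        _ = R (T x) := hT2 _
    refine ⟨-(R * T), fun v => ?_, fun u => ?_⟩
    · have hg : (R (-(T v)), R (-(T v)) - (-(T v))) ∈ (ofResolvent R hR).graph :=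
        (mem_graph_ofResolvent R hR _ _).2 (by simp)
      rw [LinearPMap.mem_graph_iff] at hg
      obtain ⟨y, hy1, hy2⟩ := hg
      simp only at hy1 hy2
      refine ⟨y, by rw [hy1]; simp, ?_⟩
      rw [hy2, hy1]
      simp only [map_neg]
      calc _ = T v - (1 - z) • R (T v) := by module
        _ = v := hT1 v
    · have hg := LinearPMap.mem_graph _ u
      rw [mem_graph_ofResolvent] at hg
      set w := ofResolvent R hR u
      have h2 := hT2 ((u : E) - w)
      rw [← hg] at h2
      change -(R (T (w - z • (u : E)))) = u
      have h3 : w - z • (u : E) = -((u : E) - w - (1 - z) • (u : E)) := by module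
      rw [h3, map_neg, map_neg, neg_neg, h2, ← hg]

end Resolvent

/-- Local finiteness gives a least element and, above every bound, a next element. Iterating the
successor map from the least element cannot accumulate, so it exhausts the set. -/
theorem exists_strictMono_range_eq {s : Set ℝ} (hs : s.Infinite)
    (hfin : ∀ M : ℝ, (s ∩ Iic M).Finite) :
    ∃ f : ℕ → ℝ, StrictMono f ∧ Tendsto f atTop atTop ∧ range f = s := by
  have hnext : ∀ M : ℝ, ∃ x ∈ s, M < x ∧ ∀ y ∈ s, M < y → x ≤ y := by
    intro M
    obtain ⟨y0, hy0, hy0M⟩ : ∃ y ∈ s, M < y := by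
      by_contra! hcon
      exact hs ((hfin M).subset fun y hy => ⟨hy, hcon y hy⟩)
    obtain ⟨x, hx, hmin⟩ := ((hfin y0).subset
      (fun y hy => ⟨hy.1, hy.2.2⟩ : s ∩ Ioc M y0 ⊆ s ∩ Iic y0)).exists_minimal
        ⟨y0, hy0, hy0M, le_rfl⟩
    refine ⟨x, hx.1, hx.2.1, fun y hy hMy => ?_⟩
    rcases le_total y y0 with h | h
    · rcases le_total x y with h' | h'
      · exact h'
      · exact hmin ⟨hy, hMy, h⟩ h'
    · exact hx.2.2.trans h
  choose nx hnx1 hnx2 hnx3 using hnext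
  obtain ⟨x0, hx0⟩ := hs.nonempty
  obtain ⟨b, hb, hbmin⟩ := (hfin x0).exists_minimal ⟨x0, hx0, mem_Iic.2 le_rfl⟩
  have hb' : ∀ y ∈ s, b ≤ y := fun y hy => by
    rcases le_total b y with h | h
    · exact h
    · exact hbmin ⟨hy, h.trans hb.2⟩ h
  let f : ℕ → ℝ := fun n => nx^[n] b
  have hf1 : ∀ n, f (n + 1) = nx (f n) := fun n => Function.iterate_succ_apply' nx n b
  have hmono : StrictMono f := strictMono_nat_of_lt_succ fun n => by rw [hf1]; exact hnx2 _
  have hmem : ∀ n, f n ∈ s := fun n => by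
    cases n with
    | zero => exact hb.1
    | succ n => rw [hf1]; exact hnx1 _
  have htend : Tendsto f atTop atTop := by
    refine tendsto_atTop.2 fun M => ?_
    by_contra hcon
    have hall : ∀ n, f n ≤ M := by
      intro n
      by_contra! hn
      exact hcon (eventually_atTop.2 ⟨n, fun m hm => hn.le.trans (hmono.monotone hm)⟩)
    exact (infinite_range_of_injective hmono.injective)
      ((hfin M).subset (by rintro _ ⟨n, rfl⟩; exact ⟨hmem n, hall n⟩))
  refine ⟨f, hmono, htend, subset_antisymm (by rintro _ ⟨n, rfl⟩; exact hmem n) fun y hy => ?_⟩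
  by_contra hny
  have : ∀ n, f n < y := by
    intro n
    induction n with
    | zero => exact lt_of_le_of_ne (hb' y hy) fun h => hny ⟨0, h⟩
    | succ n ih =>
      refine lt_of_le_of_ne ?_ fun h => hny ⟨n + 1, h⟩
      rw [hf1]
      exact hnx3 _ y hy ih
  obtain ⟨n, hn⟩ := (tendsto_atTop.1 htend y).exists
  exact absurd hn (not_le.2 (this n))

/-! ### Discrete spectrum from a compact symmetric resolvent. -/

section Discrete

variable {E : Type*} [NormedAddCommGroup E] [InnerProductSpace ℂ E] [CompleteSpace E]
  {R : E →L[ℂ] E}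

omit [CompleteSpace E] in
theorem resolvent_apply_of_mem_eigenspace (hR : Function.Injective R) {z : ℂ} {u : E}
    (hu : u ∈ eigenspace (ofResolvent R hR) z) (hu0 : u ≠ 0) :
    1 - z ≠ 0 ∧ R u = (1 - z)⁻¹ • u := by
  rw [mem_eigenspace_ofResolvent] at hu
  have hz : 1 - z ≠ 0 := by
    intro h
    rw [h, zero_smul] at hu
    exact hu0 hu
  refine ⟨hz, ?_⟩
  nth_rewrite 2 [hu]
  rw [smul_smul, inv_mul_cancel₀ hz, one_smul]

-- Symmetry of `R` makes its eigenvalue `(1 - z)⁻¹` real. With `g = (1 - z) u` one has `R g = u`,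
-- and `hpos` then reads `-z ‖u‖² ≥ 0`.
omit [CompleteSpace E] in
theorem eigenvalue_ofResolvent_eq (hR : Function.Injective R)
    (hs : R.toLinearMap.IsSymmetric) (hpos : ∀ g : E, 0 ≤ (inner ℂ (R g) (g - R g)).re)
    {z : ℂ} (hz : eigenspace (ofResolvent R hR) z ≠ ⊥) :
    ∃ ℓ : ℝ, 0 ≤ ℓ ∧ z = ((-ℓ : ℝ) : ℂ) := by
  obtain ⟨u, hu, hu0⟩ := Submodule.exists_mem_ne_zero_of_ne_bot hz
  obtain ⟨h1, h2⟩ := resolvent_apply_of_mem_eigenspace hR hu hu0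
  have hev : Module.End.HasEigenvalue (R.toLinearMap : Module.End ℂ E) (1 - z)⁻¹ :=
    Module.End.hasEigenvalue_of_hasEigenvector (x := u)
      ⟨Module.End.mem_eigenspace_iff.2 h2, hu0⟩
  have hconj := hs.conj_eigenvalue_eq_self hev
  rw [map_inv₀, inv_inj, map_sub, map_one, sub_right_inj, Complex.conj_eq_iff_real] at hconj
  obtain ⟨t, rfl⟩ := hconj
  refine ⟨-t, ?_, by simp⟩
  have h3 := hpos (u - (t : ℂ) • u)
  have h4 : R (u - (t : ℂ) • u) = u := by
    rw [map_sub, map_smul, h2, smul_smul, ← sub_smul, ← one_sub_mul, mul_inv_cancel₀ h1, one_smul]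
  rw [h4, sub_sub_cancel_left, inner_neg_right, inner_smul_right, inner_self_eq_norm_sq_to_K] at h3
  have h5 : (-((t : ℂ) * ((‖u‖ : ℂ)) ^ 2)).re = -(t * ‖u‖ ^ 2) := by
    rw [← Complex.ofReal_pow, ← Complex.ofReal_mul, Complex.neg_re, Complex.ofReal_re]
  have h3' : 0 ≤ -(t * ‖u‖ ^ 2) := by rw [← h5]; exact h3
  have : 0 < ‖u‖ ^ 2 := by positivity
  nlinarith

-- Unit eigenvectors for distinct eigenvalues are orthogonal, and for `ℓ ≤ M` their images under `R`
-- are at least `(1 + M)⁻¹` apart. Infinitely many of them would contradict compactness.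
omit [CompleteSpace E] in
theorem finite_eigenvalues_le (hR : Function.Injective R) (hc : IsCompactOperator R)
    (hs : R.toLinearMap.IsSymmetric) (hpos : ∀ g : E, 0 ≤ (inner ℂ (R g) (g - R g)).re)
    (M : ℝ) :
    ({ℓ : ℝ | eigenspace (ofResolvent R hR) ((-ℓ : ℝ) : ℂ) ≠ ⊥} ∩ Iic M).Finite := by
  by_contra hinf
  rw [← Set.Infinite] at hinf
  let e := hinf.natEmbedding
  have hev : ∀ n, ∃ u : E, ‖u‖ = 1 ∧ u ∈ eigenspace (ofResolvent R hR) ((-(e n).1 : ℝ) : ℂ) := by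
    intro n
    obtain ⟨u, hu, hu0⟩ := Submodule.exists_mem_ne_zero_of_ne_bot (e n).2.1
    refine ⟨((‖u‖⁻¹ : ℝ) : ℂ) • u, ?_, Submodule.smul_mem _ _ hu⟩
    rw [norm_smul, Complex.norm_real, norm_inv, norm_norm, inv_mul_cancel₀ (norm_ne_zero_iff.2 hu0)]
  choose u hu1 hu2 using hev
  have hnn : ∀ n, 0 ≤ (e n).1 := fun n => by
    obtain ⟨ℓ, h0, h1⟩ := eigenvalue_ofResolvent_eq hR hs hpos (e n).2.1
    rw [Complex.ofReal_inj, neg_inj] at h1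
    rwa [h1]
  have hun : ∀ n, u n ≠ 0 := fun n h => by simpa [h] using hu1 n
  have hRu : ∀ n, R (u n) = (((1 + (e n).1)⁻¹ : ℝ) : ℂ) • u n := fun n => by
    rw [(resolvent_apply_of_mem_eigenspace hR (hu2 n) (hun n)).2]
    push_cast
    rw [sub_neg_eq_add]
  have horth : ∀ n m, n ≠ m → inner ℂ (u n) (u m) = 0 := fun n m hnm => by
    have h1 : inner ℂ (R (u n)) (u m) = inner ℂ (u n) (R (u m)) := hs (u n) (u m)
    rw [hRu, hRu, inner_smul_left, inner_smul_right, Complex.conj_ofReal] at h1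
    have h2 : (((1 + (e n).1)⁻¹ : ℝ) : ℂ) ≠ (((1 + (e m).1)⁻¹ : ℝ) : ℂ) := by
      rw [Ne, Complex.ofReal_inj, inv_inj, add_right_inj]
      exact fun h => hnm (e.injective (Subtype.ext h))
    have h3 := sub_eq_zero.2 h1
    rw [← sub_mul] at h3
    exact (mul_eq_zero.1 h3).resolve_left (sub_ne_zero.2 h2)
  have hlow : ∀ n m, n ≠ m → (1 + M)⁻¹ ≤ ‖R (u n) - R (u m)‖ := fun n m hnm => by
    have h1 : ‖R (u n) - R (u m)‖ ^ 2 = ‖R (u n)‖ ^ 2 + ‖R (u m)‖ ^ 2 := by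
      rw [norm_sub_sq (𝕜 := ℂ), hRu, hRu, inner_smul_left, inner_smul_right, horth n m hnm,
        mul_zero, mul_zero, map_zero, mul_zero, sub_zero]
    have h2 : (1 + M)⁻¹ ≤ ‖R (u n)‖ := by
      rw [hRu, norm_smul, hu1, mul_one, Complex.norm_real, Real.norm_of_nonneg
        (inv_nonneg.2 (by linarith [hnn n]))]
      exact inv_anti₀ (by linarith [hnn n]) (by linarith [(e n).2.2.out])
    exact h2.trans (le_of_sq_le_sq (by rw [h1]; nlinarith [sq_nonneg ‖R (u m)‖]) (norm_nonneg _))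
  have hM : 0 < (1 + M)⁻¹ := inv_pos.2 (by linarith [hnn 0, (e 0).2.2.out])
  obtain ⟨x, -, φ, hφ, hx⟩ := (hc.isCompact_closure_image_closedBall (𝕜₁ := ℂ) 1).tendsto_subseq
    (x := fun n => R (u n)) fun n => subset_closure ⟨u n, by simp [hu1], rfl⟩
  obtain ⟨N, hN⟩ := Metric.cauchySeq_iff.1 hx.cauchySeq _ hM
  have h1 := hN N le_rfl (N + 1) (by simp)
  rw [dist_eq_norm] at h1
  exact absurd h1 (not_lt.2 (hlow _ _ fun h => by have := hφ.injective h; omega))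

/-- The eigenspaces of a compact symmetric operator have trivial common orthogonal complement.
Injectivity excludes the eigenvalue zero of `R`, and the other eigenspaces are finite dimensional,
so finitely many of them would make `E` finite dimensional. -/
theorem infinite_eigenvalues (hR : Function.Injective R) (hc : IsCompactOperator R)
    (hs : R.toLinearMap.IsSymmetric) (hpos : ∀ g : E, 0 ≤ (inner ℂ (R g) (g - R g)).re)
    (hE : ¬ FiniteDimensional ℂ E) :
    {ℓ : ℝ | eigenspace (ofResolvent R hR) ((-ℓ : ℝ) : ℂ) ≠ ⊥}.Infinite := by
  intro hfin
  apply hE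
  have hfd : ∀ ℓ : ℝ, eigenspace (ofResolvent R hR) ((-ℓ : ℝ) : ℂ) ≠ ⊥ →
      FiniteDimensional ℂ (eigenspace (ofResolvent R hR) ((-ℓ : ℝ) : ℂ)) := by
    intro ℓ hℓ
    obtain ⟨u, hu, hu0⟩ := Submodule.exists_mem_ne_zero_of_ne_bot hℓ
    obtain ⟨h1, -⟩ := resolvent_apply_of_mem_eigenspace hR hu hu0
    have := ContinuousLinearMap.finite_dimensional_eigenspace hc _ (inv_ne_zero h1)
    refine Submodule.finiteDimensional_of_le
      (S₂ := Module.End.eigenspace (R : E →ₗ[ℂ] E) (1 - ((-ℓ : ℝ) : ℂ))⁻¹) ?_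
    intro v hv
    rw [Module.End.mem_eigenspace_iff]
    by_cases hv0 : v = 0
    · simp [hv0]
    · exact (resolvent_apply_of_mem_eigenspace hR hv hv0).2
  have := hfin.to_subtype
  let S : Submodule ℂ E :=
    ⨆ ℓ : {ℓ : ℝ | eigenspace (ofResolvent R hR) ((-ℓ : ℝ) : ℂ) ≠ ⊥},
      eigenspace (ofResolvent R hR) ((-ℓ.1 : ℝ) : ℂ)
  have hfdS : FiniteDimensional ℂ S := by
    have := fun ℓ : {ℓ : ℝ | eigenspace (ofResolvent R hR) ((-ℓ : ℝ) : ℂ) ≠ ⊥} => hfd ℓ.1 ℓ.2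
    exact Submodule.finiteDimensional_iSup _
  have hle : (⨆ μ, Module.End.eigenspace (R : Module.End ℂ E) μ) ≤ S := by
    refine iSup_le fun μ v hv => ?_
    by_cases hv0 : v = 0
    · rw [hv0]; exact S.zero_mem
    rw [Module.End.mem_eigenspace_iff] at hv
    have hv : R v = μ • v := hv
    have hμ : μ ≠ 0 := by
      rintro rfl
      rw [zero_smul] at hv
      exact hv0 (hR (by rw [hv, map_zero]))
    have hmem : v ∈ eigenspace (ofResolvent R hR) (1 - μ⁻¹) := by
      rw [mem_eigenspace_ofResolvent, hv, smul_smul, sub_sub_cancel, inv_mul_cancel₀ hμ, one_smul]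
    have hne : eigenspace (ofResolvent R hR) (1 - μ⁻¹) ≠ ⊥ :=
      fun h => hv0 (by rwa [h] at hmem)
    obtain ⟨ℓ, -, hℓ⟩ := eigenvalue_ofResolvent_eq hR hs hpos hne
    rw [hℓ] at hmem hne
    exact Submodule.mem_iSup_of_mem (p := fun ℓ : {ℓ : ℝ | eigenspace (ofResolvent R hR)
      ((-ℓ : ℝ) : ℂ) ≠ ⊥} => eigenspace (ofResolvent R hR) ((-ℓ.1 : ℝ) : ℂ)) ⟨ℓ, hne⟩ hmem
  have hbot : Sᗮ = ⊥ := by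
    rw [eq_bot_iff, ← ContinuousLinearMap.orthogonalComplement_iSup_eigenspaces_eq_bot hc hs]
    exact Submodule.orthogonal_le hle
  -- A finite-dimensional `S` is complete, so a trivial complement forces it to be the whole space
  -- and not merely dense.
  have htop : S = ⊤ := by
    rw [Submodule.orthogonal_eq_bot_iff] at hbot
    exact hbot
  rw [htop] at hfdS
  exact Module.Finite.equiv Submodule.topEquiv

theorem discrete_spectrum_ofResolvent (hR : Function.Injective R) (hc : IsCompactOperator R)
    (hs : R.toLinearMap.IsSymmetric) (hpos : ∀ g : E, 0 ≤ (inner ℂ (R g) (g - R g)).re)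
    (hE : ¬ FiniteDimensional ℂ E)
    (hsimple : ∀ ℓ : ℝ, ∀ u ∈ eigenspace (ofResolvent R hR) ((-ℓ : ℝ) : ℂ), u ≠ 0 →
      ∀ v ∈ eigenspace (ofResolvent R hR) ((-ℓ : ℝ) : ℂ), ∃ c : ℂ, c • u = v) :
    ∃ ℓ : ℕ → ℝ, StrictMono ℓ ∧ Tendsto ℓ atTop atTop ∧
      spectrum (ofResolvent R hR) = range (fun k : ℕ => ((-(ℓ k) : ℝ) : ℂ)) ∧
      ∀ k : ℕ, Module.finrank ℂ (eigenspace (ofResolvent R hR) ((-(ℓ k) : ℝ) : ℂ)) = 1 := by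
  obtain ⟨ℓ, h1, h2, h3⟩ := exists_strictMono_range_eq (infinite_eigenvalues hR hc hs hpos hE)
    (finite_eigenvalues_le hR hc hs hpos)
  refine ⟨ℓ, h1, h2, ?_, fun k => ?_⟩
  · ext z
    rw [spectrum, mem_compl_iff, mem_resolventSet_ofResolvent hR hc]
    constructor
    · intro hz
      obtain ⟨t, -, rfl⟩ := eigenvalue_ofResolvent_eq hR hs hpos hz
      have : t ∈ range ℓ := by rw [h3]; exact hz
      obtain ⟨k, rfl⟩ := this
      exact ⟨k, rfl⟩
    · rintro ⟨k, rfl⟩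
      have : ℓ k ∈ range ℓ := ⟨k, rfl⟩
      rw [h3] at this
      exact this
  · have : ℓ k ∈ range ℓ := ⟨k, rfl⟩
    rw [h3] at this
    obtain ⟨u, hu, hu0⟩ := Submodule.exists_mem_ne_zero_of_ne_bot this
    refine finrank_eq_one (⟨u, hu⟩ : eigenspace (ofResolvent R hR) ((-(ℓ k) : ℝ) : ℂ))
      (fun h => hu0 (congrArg Subtype.val h)) fun v => ?_
    obtain ⟨c, hc⟩ := hsimple (ℓ k) u hu hu0 v.1 v.2
    exact ⟨c, Subtype.ext hc⟩

end Discrete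

/-! ### Bounded perturbations of the inverse of a compact operator. -/

section Perturbation

variable {E : Type*} [NormedAddCommGroup E] [InnerProductSpace ℂ E] [CompleteSpace E]

/-- If `-A = R₀⁻¹ + B` is a nonnegative operator, with `R₀` compact, symmetric and injective and `B`
bounded and symmetric, then `1 - A` has a compact, symmetric and injective inverse. -/
theorem exists_resolvent_of_perturbation {R₀ B : E →L[ℂ] E} (hc : IsCompactOperator R₀)
    (hs : R₀.toLinearMap.IsSymmetric) (hB : B.toLinearMap.IsSymmetric)
    (hinj : Function.Injective R₀) {Γ : E → E → Prop}
    (hΓ : ∀ u v, Γ u v ↔ u = R₀ (-v - B u))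
    (hnn : ∀ u v, Γ u v → 0 ≤ (inner ℂ u (-v)).re) :
    ∃ R : E →L[ℂ] E, Function.Injective R ∧ IsCompactOperator R ∧ R.toLinearMap.IsSymmetric ∧
      (∀ g : E, 0 ≤ (inner ℂ (R g) (g - R g)).re) ∧ ∀ u v, u = R (u - v) ↔ Γ u v := by
  -- From `1 - A = R₀⁻¹ (1 + R₀ (1 + B))`, inverting `1 - A` means inverting a compact perturbation
  -- of the identity.
  have hTc : IsCompactOperator (R₀ * (1 + B) : E →L[ℂ] E) := hc.comp_clm (1 + B)
  -- An eigenvector for `-1` would satisfy `A u = u`, against the nonnegativity of `-A`.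
  have hnev : ¬ Module.End.HasEigenvalue ((R₀ * (1 + B) : E →L[ℂ] E) : Module.End ℂ E) (-1) := by
    intro he
    obtain ⟨u, hu⟩ := he.exists_hasEigenvector
    have h1 : R₀ (u + B u) = -u := by simpa using hu.apply_eq_smul
    have h2 := hnn u u ((hΓ u u).2 (by rw [← neg_add', map_neg, h1, neg_neg]))
    rw [inner_neg_right, Complex.neg_re] at h2
    have h3 : (inner ℂ u u).re = ‖u‖ ^ 2 := inner_self_eq_norm_sq (𝕜 := ℂ) u
    rw [h3] at h2
    have : ‖u‖ ^ 2 = 0 := le_antisymm (by linarith) (sq_nonneg _)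
    exact hu.2 (by simpa using this)
  have hres := (hTc.hasEigenvalue_or_mem_resolventSet (by simp : (-1 : ℂ) ≠ 0)).resolve_left hnev
  rw [_root_.spectrum.mem_resolventSet_iff] at hres
  obtain ⟨W, hW⟩ := hres
  have hW1 : ∀ x, W.1 x = -(x + R₀ (x + B x)) := fun x => by
    rw [hW]; simp [Algebra.algebraMap_eq_smul_one]; abel
  have hW2 : ∀ x, W.1 ((↑W⁻¹ : E →L[ℂ] E) x) = x := fun x => by
    rw [← mul_apply_eq_comp, W.mul_inv]; rfl
  have hW3 : ∀ x, (↑W⁻¹ : E →L[ℂ] E) (W.1 x) = x := fun x => by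
    rw [← mul_apply_eq_comp, W.inv_mul]; rfl
  -- Since `W = -(1 + R₀ (1 + B))`, the sign makes this `(1 + R₀ (1 + B))⁻¹ R₀`.
  let R : E →L[ℂ] E := -((↑W⁻¹ : E →L[ℂ] E) * R₀)
  have hRapp : ∀ g, R g = -((↑W⁻¹ : E →L[ℂ] E) (R₀ g)) := fun g => rfl
  have hRiff : ∀ u g, u = R g ↔ u + R₀ (u + B u) = R₀ g := fun u g => by
    rw [hRapp, eq_neg_iff_add_eq_zero, ← neg_inj, neg_zero]
    constructor
    · intro h
      have h1 : (↑W⁻¹ : E →L[ℂ] E) (R₀ g) = -u := by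
        rw [eq_neg_iff_add_eq_zero, add_comm]; simpa using congrArg Neg.neg h
      rw [← hW2 (R₀ g), h1, map_neg, hW1, neg_neg]
    · intro h
      rw [← h, ← neg_neg (u + R₀ (u + B u)), ← hW1, map_neg, hW3]; simp
  have hRΓ : ∀ u v, u = R (u - v) ↔ Γ u v := fun u v => by
    rw [hRiff, hΓ, map_add, map_sub, map_sub, map_neg]
    constructor
    · intro h
      have : u = (u + (R₀ u + R₀ (B u))) - R₀ u - R₀ (B u) := by abel
      rw [h] at this
      exact this.trans (by abel)
    · intro h
      nth_rewrite 1 [h]; abel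
  have hRg : ∀ g, Γ (R g) (R g - g) := fun g => (hRΓ _ _).1 (by simp)
  refine ⟨R, ?_, ?_, ?_, ?_, hRΓ⟩
  · intro x y hxy
    rw [hRapp, hRapp, neg_inj] at hxy
    have := congrArg W.1 hxy
    rw [hW2, hW2] at this
    exact hinj this
  · exact (hc.clm_comp (↑W⁻¹ : E →L[ℂ] E)).neg
  -- Insert `R g = R₀ (g - R g - B (R g))`, and the same for `g'`, into the symmetry of `R₀`. The
  -- terms containing `R` or `B` on both sides cancel.
  · intro g g'
    have h1 := (hΓ _ _).1 (hRg g)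
    have h2 := (hΓ _ _).1 (hRg g')
    have h3 : inner ℂ (R₀ (-(R g - g) - B (R g))) (-(R g' - g') - B (R g')) =
      inner ℂ (-(R g - g) - B (R g)) (R₀ (-(R g' - g') - B (R g'))) := hs _ _
    have h4 : inner ℂ (B (R g)) (R g') = inner ℂ (R g) (B (R g')) := hB _ _
    rw [← h1, ← h2] at h3
    simp only [inner_sub_left, inner_sub_right, neg_sub, h4] at h3
    change inner ℂ (R g) g' = inner ℂ g (R g')
    linear_combination h3
  · intro g
    have := hnn _ _ (hRg g)
    rwa [neg_sub] at this

/-- This isolates the functional analysis: what remains for a differential operator is a Green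
operator `R₀`, a bounded correction `B`, nonnegativity, and simplicity of eigenvalues. -/
theorem isSelfAdjoint_discrete_of_perturbation {R₀ B : E →L[ℂ] E} (hc : IsCompactOperator R₀)
    (hs : R₀.toLinearMap.IsSymmetric) (hB : B.toLinearMap.IsSymmetric)
    (hinj : Function.Injective R₀) {Γ : E → E → Prop}
    (hΓ : ∀ u v, Γ u v ↔ u = R₀ (-v - B u))
    (hnn : ∀ u v, Γ u v → 0 ≤ (inner ℂ u (-v)).re)
    (hE : ¬ FiniteDimensional ℂ E)
    (hsimple : ∀ ℓ : ℝ, ∀ u, Γ u (((-ℓ : ℝ) : ℂ) • u) → u ≠ 0 →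
      ∀ v, Γ v (((-ℓ : ℝ) : ℂ) • v) → ∃ c : ℂ, c • u = v) :
    ∃ A : E →ₗ.[ℂ] E, (∀ u v, (u, v) ∈ A.graph ↔ Γ u v) ∧ Dense (A.domain : Set E) ∧
      IsSelfAdjoint A ∧ (∀ u : A.domain, 0 ≤ (inner ℂ (u : E) (-(A u))).re) ∧
      ∃ ℓ : ℕ → ℝ, StrictMono ℓ ∧ Tendsto ℓ atTop atTop ∧
        spectrum A = range (fun k : ℕ => ((-(ℓ k) : ℝ) : ℂ)) ∧
        ∀ k : ℕ, Module.finrank ℂ (eigenspace A ((-(ℓ k) : ℝ) : ℂ)) = 1 := by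
  obtain ⟨R, hRinj, hRc, hRs, hRp, hRΓ⟩ := exists_resolvent_of_perturbation hc hs hB hinj hΓ hnn
  have hgr : ∀ u v, (u, v) ∈ (ofResolvent R hRinj).graph ↔ Γ u v := fun u v => by
    rw [mem_graph_ofResolvent, hRΓ]
  refine ⟨ofResolvent R hRinj, hgr, dense_domain_ofResolvent hRinj hRs,
    isSelfAdjoint_ofResolvent hRinj hRs,
    fun u => hnn _ _ ((hgr _ _).1 (LinearPMap.mem_graph _ u)),
    discrete_spectrum_ofResolvent hRinj hRc hRs hRp hE fun ℓ u hu hu0 v hv =>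
      hsimple ℓ u ((hgr _ _).1 hu) hu0 v ((hgr _ _).1 hv)⟩

end Perturbation

/-! ### Compactness of Carleman integral operators. -/

section Compactness

variable {X : Type*} [MeasurableSpace X] {μ : Measure X}
  {E : Type*} [NormedAddCommGroup E] [InnerProductSpace ℂ E] [CompleteSpace E]

-- Sequential Banach–Alaoglu in the dual of a separable space, carried back by the Riesz
-- isomorphism.
omit [MeasurableSpace X] in
theorem exists_weakly_convergent_subseq [TopologicalSpace.SeparableSpace E] {g : ℕ → E}
    {C : ℝ} (hg : ∀ n, ‖g n‖ ≤ C) :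
    ∃ x : E, ‖x‖ ≤ C ∧ ∃ φ : ℕ → ℕ, StrictMono φ ∧
      ∀ y, Tendsto (fun n => inner ℂ y (g (φ n))) atTop (𝓝 (inner ℂ y x)) := by
  have hseq := WeakDual.isSeqCompact_closedBall (𝕜 := ℂ) (E := E) 0 C
  obtain ⟨w, hw, φ, hφ, hlim⟩ := hseq (x := fun n => StrongDual.toWeakDual
    (InnerProductSpace.toDual ℂ E (g n))) (fun n => by
      simp [hg n])
  refine ⟨(InnerProductSpace.toDual ℂ E).symm (WeakDual.toStrongDual w),
    by simpa using hw, φ, hφ, fun y => ?_⟩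
  have h1 : Tendsto (fun n => inner ℂ (g (φ n)) y) atTop (𝓝 (w y)) :=
    ((WeakDual.eval_continuous (𝕜 := ℂ) y).tendsto w).comp hlim
  have h2 : w y = inner ℂ ((InnerProductSpace.toDual ℂ E).symm (WeakDual.toStrongDual w)) y := by
    rw [InnerProductSpace.toDual_symm_apply]; rfl
  rw [h2] at h1
  have h3 := (Complex.continuous_conj.tendsto _).comp h1
  rw [inner_conj_symm] at h3
  refine h3.congr fun n => ?_
  exact inner_conj_symm _ _

theorem norm_sq_eq_integral (f : Lp ℂ 2 μ) : ‖f‖ ^ 2 = ∫ x, ‖f x‖ ^ 2 ∂μ := by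
  have h := L2.inner_def (𝕜 := ℂ) f f
  rw [inner_self_eq_norm_sq_to_K] at h
  have h2 : (∫ x, inner ℂ (f x) (f x) ∂μ) = ((∫ x, ‖f x‖ ^ 2 ∂μ : ℝ) : ℂ) := by
    rw [← integral_complex_ofReal]
    refine integral_congr_ae (Eventually.of_forall fun x => ?_)
    simp only [inner_self_eq_norm_sq_to_K]
    push_cast
    rfl
  rw [h2] at h
  exact Complex.ofReal_injective ((Complex.ofReal_pow _ _).trans h)

/-- A Carleman operator `g ↦ (x ↦ ⟪k x, g⟫)` with square-integrable `‖k x‖` is compact. -/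
theorem exists_compact_of_inner_kernel [TopologicalSpace.SeparableSpace E] (k : X → E)
    (hk : ∀ g, AEStronglyMeasurable (fun x => inner ℂ (k x) g) μ) {Γ : X → ℝ}
    (hΓ : MemLp Γ 2 μ) (hkΓ : ∀ᵐ x ∂μ, ‖k x‖ ≤ Γ x) :
    ∃ T : E →L[ℂ] Lp ℂ 2 μ, IsCompactOperator T ∧
      ∀ g, (T g : X → ℂ) =ᵐ[μ] fun x => inner ℂ (k x) g := by
  have hbd : ∀ g, ∀ᵐ x ∂μ, ‖(inner ℂ (k x) g : ℂ)‖ ≤ ‖Γ x * ‖g‖‖ := fun g => by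
    filter_upwards [hkΓ] with x hx
    refine (norm_inner_le_norm _ _).trans ((mul_le_mul_of_nonneg_right hx (norm_nonneg _)).trans
      (le_abs_self _))
  have hmem : ∀ g, MemLp (fun x => (inner ℂ (k x) g : ℂ)) 2 μ := fun g =>
    (hΓ.mul_const ‖g‖).of_le (hk g) (hbd g)
  let T₀ : E →ₗ[ℂ] Lp ℂ 2 μ :=
    { toFun := fun g => (hmem g).toLp _
      map_add' := fun g g' => by
        rw [← MemLp.toLp_add]
        exact MemLp.toLp_congr _ _ (by filter_upwards with x; simp)
      map_smul' := fun c g => by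
        rw [RingHom.id_apply, ← MemLp.toLp_const_smul]
        exact MemLp.toLp_congr _ _ (by filter_upwards with x; simp) }
  have hT₀ : ∀ g, (T₀ g : X → ℂ) =ᵐ[μ] fun x => inner ℂ (k x) g := fun g => (hmem g).coeFn_toLp
  have hTbd : ∀ g, ‖T₀ g‖ ≤ (eLpNorm Γ 2 μ).toReal * ‖g‖ := fun g => by
    refine (Lp.norm_le_mul_norm_of_ae_le_mul (g := hΓ.toLp Γ) (c := ‖g‖) ?_).trans_eq ?_
    · filter_upwards [hT₀ g, hbd g, hΓ.coeFn_toLp] with x h1 h2 h3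
      rw [h1, h3]
      refine h2.trans_eq ?_
      rw [norm_mul, norm_norm, mul_comm]
    · rw [Lp.norm_toLp, mul_comm]
  let T : E →L[ℂ] Lp ℂ 2 μ := T₀.mkContinuous _ hTbd
  have hT : ∀ g, (T g : X → ℂ) =ᵐ[μ] fun x => inner ℂ (k x) g := hT₀
  refine ⟨T, ?_, hT⟩
  -- The image of the closed unit ball is itself sequentially compact: weak convergence of the
  -- arguments is pointwise convergence of their images, and `2 Γ` dominates the differences.
  rw [isCompactOperator_iff_exists_mem_nhds_image_subset_compact]
  refine ⟨Metric.closedBall 0 1, Metric.closedBall_mem_nhds _ one_pos,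
    T '' Metric.closedBall 0 1, IsSeqCompact.isCompact fun y hy => ?_, subset_rfl⟩
  choose g hg hgy using hy
  obtain ⟨x, hx, φ, hφ, hlim⟩ := exists_weakly_convergent_subseq (g := g) (C := 1)
    fun n => by simpa using hg n
  refine ⟨T x, ⟨x, by simpa using hx, rfl⟩, φ, hφ, ?_⟩
  rw [tendsto_iff_norm_sub_tendsto_zero]
  have hsq : Tendsto (fun n => ∫ t, ‖(inner ℂ (k t) (g (φ n) - x) : ℂ)‖ ^ 2 ∂μ) atTop (𝓝 0) := by
    have h0 : (0 : ℝ) = ∫ _, (0 : ℝ) ∂μ := by simp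
    rw [h0]
    refine tendsto_integral_of_dominated_convergence (fun t => ‖Γ t * 2‖ ^ 2)
      (fun n => ((hmem (g (φ n) - x)).aestronglyMeasurable.norm.pow 2)) ?_ (fun n => ?_) ?_
    · exact (hΓ.mul_const 2).norm.integrable_sq
    · filter_upwards [hkΓ] with t ht
      rw [norm_pow, norm_norm]
      refine pow_le_pow_left₀ (norm_nonneg _) ?_ 2
      refine (norm_inner_le_norm _ _).trans (le_trans ?_ (le_abs_self _))
      refine mul_le_mul ht ?_ (norm_nonneg _) ((norm_nonneg _).trans ht)
      have h1 := norm_sub_le (g (φ n)) x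
      have h2 : ‖g (φ n)‖ ≤ 1 := by simpa using hg (φ n)
      linarith
    · refine Eventually.of_forall fun t => ?_
      have h1 := (hlim (k t)).sub_const (inner ℂ (k t) x)
      rw [sub_self] at h1
      have h2 := h1.norm.pow 2
      simpa [inner_sub_right] using h2
  have hn : ∀ n, ‖T (g (φ n)) - T x‖ = √(∫ t, ‖(inner ℂ (k t) (g (φ n) - x) : ℂ)‖ ^ 2 ∂μ) := by
    intro n
    rw [eq_comm, Real.sqrt_eq_iff_mul_self_eq (integral_nonneg fun _ => sq_nonneg _)
      (norm_nonneg _), ← sq, ← map_sub, norm_sq_eq_integral]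
    refine integral_congr_ae ?_
    filter_upwards [hT (g (φ n) - x)] with t ht
    rw [ht]
  have := (Real.continuous_sqrt.tendsto 0).comp hsq
  rw [Real.sqrt_zero] at this
  refine this.congr fun n => ?_
  rw [Function.comp_apply, ← hn, Function.comp_apply, ← hgy]

end Compactness

/-! ### Locally absolutely continuous complex functions on an open interval. -/

section AC

/-- The open interval is the union of its countably many compact subintervals with rational end
points. -/
theorem ae_restrict_Ioo_of_forall_Icc {α β : ℝ} {p : ℝ → Prop}
    (h : ∀ c d : ℝ, c ≤ d → Icc c d ⊆ Ioo α β → ∀ᵐ x : ℝ, x ∈ Icc c d → p x) :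
    ∀ᵐ x ∂(volume.restrict (Ioo α β)), p x := by
  rw [ae_restrict_iff' measurableSet_Ioo]
  have h1 : ∀ q : ℚ × ℚ, ∀ᵐ x : ℝ, (α < q.1 ∧ (q.1 : ℝ) ≤ q.2 ∧ (q.2 : ℝ) < β) →
      x ∈ Icc (q.1 : ℝ) q.2 → p x := by
    intro q
    by_cases hq : α < q.1 ∧ (q.1 : ℝ) ≤ q.2 ∧ (q.2 : ℝ) < β
    · filter_upwards [h q.1 q.2 hq.2.1 (Icc_subset_Ioo hq.1 hq.2.2)] with x hx _ using hx
    · exact Eventually.of_forall fun x h => absurd h hq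
  filter_upwards [ae_all_iff.2 h1] with x hx hxI
  obtain ⟨c, hc1, hc2⟩ := exists_rat_btwn hxI.1
  obtain ⟨d, hd1, hd2⟩ := exists_rat_btwn hxI.2
  exact hx (c, d) ⟨hc1, (hc2.trans hd1).le, hd2⟩ ⟨hc2.le, hd1.le⟩

theorem AbsolutelyContinuousOnInterval.of_dist_le {X Y : Type*} [PseudoMetricSpace X]
    [PseudoMetricSpace Y] {f : ℝ → X} {g : ℝ → Y} {a b : ℝ}
    (hf : AbsolutelyContinuousOnInterval f a b) (h : ∀ x y, dist (g x) (g y) ≤ dist (f x) (f y)) :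
    AbsolutelyContinuousOnInterval g a b :=
  squeeze_zero (fun _ => Finset.sum_nonneg fun _ _ => dist_nonneg)
    (fun _ => Finset.sum_le_sum fun _ _ => h _ _) hf

theorem AbsolutelyContinuousOnInterval.of_eqOn {X : Type*} [PseudoMetricSpace X] {f g : ℝ → X}
    {a b : ℝ} (hf : AbsolutelyContinuousOnInterval f a b) (h : EqOn g f (uIcc a b)) :
    AbsolutelyContinuousOnInterval g a b := by
  unfold AbsolutelyContinuousOnInterval at hf ⊢
  refine hf.congr' ?_
  rw [EventuallyEq, eventually_inf_principal]
  refine Eventually.of_forall fun E hE => Finset.sum_congr rfl fun i hi => ?_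
  rw [h (hE.1 i hi).1, h (hE.1 i hi).2]

theorem AbsolutelyContinuousOnInterval.ae_differentiableAt_complex {f : ℝ → ℂ} {a b : ℝ}
    (hf : AbsolutelyContinuousOnInterval f a b) :
    ∀ᵐ x : ℝ, x ∈ uIcc a b → DifferentiableAt ℝ f x := by
  have hre : AbsolutelyContinuousOnInterval (fun x => (f x).re) a b :=
    AbsolutelyContinuousOnInterval.of_dist_le hf fun x y => by
      rw [Real.dist_eq, Complex.dist_eq, ← Complex.sub_re]; exact Complex.abs_re_le_norm _
  have him : AbsolutelyContinuousOnInterval (fun x => (f x).im) a b :=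
    AbsolutelyContinuousOnInterval.of_dist_le hf fun x y => by
      rw [Real.dist_eq, Complex.dist_eq, ← Complex.sub_im]; exact Complex.abs_im_le_norm _
  filter_upwards [hre.ae_differentiableAt, him.ae_differentiableAt] with x h1 h2 hx
  have h3 := (h1 hx).hasDerivAt.ofReal_comp.add
    ((h2 hx).hasDerivAt.ofReal_comp.mul_const Complex.I)
  refine (h3.congr_of_eventuallyEq (Eventually.of_forall fun y => ?_)).differentiableAt
  exact (Complex.re_add_im (f y)).symm

theorem IntervalIntegrable.absolutelyContinuousOnInterval_complex {f : ℝ → ℂ} {a b : ℝ}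
    (hf : IntervalIntegrable f volume a b) :
    AbsolutelyContinuousOnInterval (fun x => ∫ t in a..x, f t) a b := by
  have hre : IntervalIntegrable (fun x => (f x).re) volume a b :=
    ⟨hf.1.re, hf.2.re⟩
  have him : IntervalIntegrable (fun x => (f x).im) volume a b :=
    ⟨hf.1.im, hf.2.im⟩
  have h1 := hre.absolutelyContinuousOnInterval_intervalIntegral left_mem_uIcc
  have h2 := him.absolutelyContinuousOnInterval_intervalIntegral left_mem_uIcc
  have h3 : AbsolutelyContinuousOnInterval (fun x => ((∫ t in a..x, (f t).re : ℝ) : ℂ)) a b :=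
    AbsolutelyContinuousOnInterval.of_dist_le h1 fun x y => by
      rw [Complex.dist_eq, ← Complex.ofReal_sub, Complex.norm_real, Real.dist_eq]; rfl
  have h4 : AbsolutelyContinuousOnInterval (fun x => ((∫ t in a..x, (f t).im : ℝ) : ℂ)) a b :=
    AbsolutelyContinuousOnInterval.of_dist_le h2 fun x y => by
      rw [Complex.dist_eq, ← Complex.ofReal_sub, Complex.norm_real, Real.dist_eq]; rfl
  have h5 := h3.add (h4.const_smul Complex.I)
  have hint : ∀ x ∈ uIcc a b, ∫ t in a..x, f t =
      ((∫ t in a..x, (f t).re : ℝ) : ℂ) + Complex.I • ((∫ t in a..x, (f t).im : ℝ) : ℂ) := by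
    intro x hx
    have hsub : uIcc a x ⊆ uIcc a b := uIcc_subset_uIcc left_mem_uIcc hx
    rw [← intervalIntegral.integral_ofReal, ← intervalIntegral.integral_ofReal,
      ← intervalIntegral.integral_smul, ← intervalIntegral.integral_add]
    · refine intervalIntegral.integral_congr fun t _ => ?_
      simp only [smul_eq_mul]
      rw [mul_comm]
      exact (Complex.re_add_im _).symm
    · exact ⟨(hre.mono_set hsub).1.ofReal, (hre.mono_set hsub).2.ofReal⟩
    · have := him.mono_set hsub
      exact IntervalIntegrable.const_mul ⟨this.1.ofReal, this.2.ofReal⟩ _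
  exact AbsolutelyContinuousOnInterval.of_eqOn h5 hint

/-- Absolute continuity on every compact subinterval of `(α, β)`. -/
def LocAC (α β : ℝ) (f : ℝ → ℂ) : Prop :=
  ∀ c d : ℝ, c ≤ d → Icc c d ⊆ Ioo α β → AbsolutelyContinuousOnInterval f c d

variable {α β : ℝ} {f g : ℝ → ℂ}

theorem LocAC.congr (hf : LocAC α β f) (h : ∀ x ∈ Ioo α β, g x = f x) : LocAC α β g := by
  intro c d hcd hsub
  refine AbsolutelyContinuousOnInterval.of_eqOn (hf c d hcd hsub) ?_
  rw [uIcc_of_le hcd]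
  exact fun x hx => h x (hsub hx)

theorem LocAC.add (hf : LocAC α β f) (hg : LocAC α β g) : LocAC α β fun x => f x + g x :=
  fun c d h1 h2 => (hf c d h1 h2).add (hg c d h1 h2)

theorem LocAC.sub (hf : LocAC α β f) (hg : LocAC α β g) : LocAC α β fun x => f x - g x :=
  fun c d h1 h2 => (hf c d h1 h2).sub (hg c d h1 h2)

theorem LocAC.mul (hf : LocAC α β f) (hg : LocAC α β g) : LocAC α β fun x => f x * g x :=
  fun c d h1 h2 =>
    AbsolutelyContinuousOnInterval.of_eqOn (f := f • g) ((hf c d h1 h2).smul (hg c d h1 h2))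
      fun _ _ => rfl

theorem LocAC.conj (hf : LocAC α β f) : LocAC α β fun x => (starRingEnd ℂ) (f x) :=
  fun c d h1 h2 => AbsolutelyContinuousOnInterval.of_dist_le (hf c d h1 h2) fun x y => by
    rw [Complex.dist_conj_conj]

theorem contDiffOn_of_hasDerivAt {F : Type*} [NormedAddCommGroup F] [NormedSpace ℝ F]
    {u u' : ℝ → F} (hu : ∀ x ∈ Ioo α β, HasDerivAt u (u' x) x)
    (hu' : ContinuousOn u' (Ioo α β)) : ContDiffOn ℝ 1 u (Ioo α β) := by
  have := (contDiffOn_succ_iff_deriv_of_isOpen (𝕜 := ℝ) (f := u) (n := 0)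
    (isOpen_Ioo (a := α) (b := β))).2
    ⟨fun x hx => (hu x hx).differentiableAt.differentiableWithinAt, by simp,
      contDiffOn_zero.2 (hu'.congr fun x hx => (hu x hx).deriv)⟩
  simpa using this

theorem LocAC.of_contDiffOn (hf : ContDiffOn ℝ 1 f (Ioo α β)) : LocAC α β f :=
  fun c d h1 h2 => (hf.mono (by rwa [uIcc_of_le h1])).absolutelyContinuousOnInterval

theorem LocAC.of_hasDerivAt {f' : ℝ → ℂ} (hf : ∀ x ∈ Ioo α β, HasDerivAt f (f' x) x)
    (hf' : ContinuousOn f' (Ioo α β)) : LocAC α β f :=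
  LocAC.of_contDiffOn (contDiffOn_of_hasDerivAt hf hf')

theorem LocAC.ofReal_of_hasDerivAt {u u' : ℝ → ℝ} (hu : ∀ x ∈ Ioo α β, HasDerivAt u (u' x) x)
    (hu' : ContinuousOn u' (Ioo α β)) : LocAC α β fun x => (u x : ℂ) :=
  LocAC.of_hasDerivAt (fun x hx => (hu x hx).ofReal_comp)
    (Complex.continuous_ofReal.comp_continuousOn hu')

theorem LocAC.continuousOn (hf : LocAC α β f) : ContinuousOn f (Ioo α β) := by
  intro x hx
  obtain ⟨c, hc1, hc2⟩ := exists_between hx.1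
  obtain ⟨d, hd1, hd2⟩ := exists_between hx.2
  have h1 := (hf c d (hc2.trans hd1).le (Icc_subset_Ioo hc1 hd2)).continuousOn
  rw [uIcc_of_le (hc2.trans hd1).le] at h1
  exact (h1.continuousAt (Icc_mem_nhds hc2 hd1)).continuousWithinAt

theorem LocAC.ae_differentiableAt (hf : LocAC α β f) :
    ∀ᵐ x ∂(volume.restrict (Ioo α β)), DifferentiableAt ℝ f x :=
  ae_restrict_Ioo_of_forall_Icc fun c d h1 h2 => by
    have := AbsolutelyContinuousOnInterval.ae_differentiableAt_complex (hf c d h1 h2)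
    rwa [uIcc_of_le h1] at this

/-- Any two points lie in a common compact subinterval, and absolute continuity there excludes
Cantor-type functions. Through this lemma, Wronskian identities known only almost everywhere can be
integrated. -/
theorem LocAC.eq_const (hf : LocAC α β f)
    (h : ∀ᵐ x ∂(volume.restrict (Ioo α β)), HasDerivAt f 0 x) :
    ∃ C, ∀ x ∈ Ioo α β, f x = C := by
  rcases (Ioo α β).eq_empty_or_nonempty with he | ⟨x₀, hx₀⟩
  · exact ⟨0, fun x hx => by rw [he] at hx; exact absurd hx (notMem_empty x)⟩
  refine ⟨f x₀, fun x hx => ?_⟩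
  have hsub : Icc (min x₀ x) (max x₀ x) ⊆ Ioo α β :=
    Icc_subset_Ioo (lt_min hx₀.1 hx.1) (max_lt hx₀.2 hx.2)
  rw [ae_restrict_iff' measurableSet_Ioo] at h
  obtain ⟨C, hC⟩ := (hf _ _ min_le_max hsub).const_of_ae_hasDerivAt_zero (by
    rw [uIcc_of_le min_le_max]
    filter_upwards [h] with y hy hyI using hy (hsub hyI))
  rw [uIcc_of_le min_le_max] at hC
  rw [hC x ⟨min_le_right _ _, le_max_right _ _⟩, hC x₀ ⟨min_le_left _ _, le_max_left _ _⟩]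

theorem LocAC.integral {φ : ℝ → ℂ} {a : ℝ}
    (hφ : ∀ x ∈ Ioo α β, IntervalIntegrable φ volume a x) :
    LocAC α β (fun x => ∫ t in a..x, φ t) := by
  intro c d hcd hsub
  have hc := hφ c (hsub (left_mem_Icc.2 hcd))
  have hd := hφ d (hsub (right_mem_Icc.2 hcd))
  have h1 := (IntervalIntegrable.absolutelyContinuousOnInterval_complex (hc.symm.trans hd)).add
    (LipschitzOnWith.absolutelyContinuousOnInterval
      (LipschitzWith.const (∫ t in a..c, φ t)).lipschitzOnWith)
  refine AbsolutelyContinuousOnInterval.of_eqOn h1 fun x hx => ?_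
  rw [uIcc_of_le hcd] at hx
  simp only [Pi.add_apply]
  rw [add_comm, intervalIntegral.integral_add_adjacent_intervals hc
    (hc.symm.trans (hφ x (hsub hx)))]

/-- The base point `a` may be a singular end point, so the derivative is computed from rational base
points inside the interval; countably many of them leave a single null set. -/
theorem ae_hasDerivAt_integral_Ioo {φ : ℝ → ℂ} {a : ℝ}
    (hφ : ∀ x ∈ Ioo α β, IntervalIntegrable φ volume a x) :
    ∀ᵐ x ∂(volume.restrict (Ioo α β)), HasDerivAt (fun x => ∫ t in a..x, φ t) (φ x) x := by
  have hae : ∀ᵐ x ∂(volume.restrict (Ioo α β)), ∀ c d : ℚ, (c : ℝ) ∈ Ioo α β → (d : ℝ) ∈ Ioo α β →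
      x ∈ uIcc (c : ℝ) d → HasDerivAt (fun x => ∫ t in (c : ℝ)..x, φ t) (φ x) x := by
    refine ae_restrict_of_ae (ae_all_iff.2 fun c => ae_all_iff.2 fun d => ?_)
    by_cases h : (c : ℝ) ∈ Ioo α β ∧ (d : ℝ) ∈ Ioo α β
    · filter_upwards [((hφ c h.1).symm.trans (hφ d h.2)).ae_hasDerivAt_integral] with x hx _ _ hxI
      exact hx hxI _ left_mem_uIcc
    · exact Eventually.of_forall fun x h1 h2 => absurd ⟨h1, h2⟩ h
  filter_upwards [hae, ae_restrict_mem measurableSet_Ioo] with x hx hxI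
  obtain ⟨c, hc1, hc2⟩ := exists_rat_btwn hxI.1
  obtain ⟨d, hd1, hd2⟩ := exists_rat_btwn hxI.2
  have hcI : (c : ℝ) ∈ Ioo α β := ⟨hc1, hc2.trans hxI.2⟩
  have h1 := (hx c d hcI ⟨hxI.1.trans hd1, hd2⟩ (by
    rw [uIcc_of_le (hc2.trans hd1).le]; exact ⟨hc2.le, hd1.le⟩)).const_add (∫ t in a..(c : ℝ), φ t)
  refine h1.congr_of_eventuallyEq ?_
  filter_upwards [isOpen_Ioo.mem_nhds hxI] with y hy
  rw [intervalIntegral.integral_add_adjacent_intervals (hφ c hcI) ((hφ c hcI).symm.trans (hφ y hy))]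

/-- A locally absolutely continuous function whose derivative is almost everywhere equal to a
continuous function is continuously differentiable. -/
theorem LocAC.hasDerivAt_of_ae {F φ : ℝ → ℂ} (hF : LocAC α β F)
    (hφ : ContinuousOn φ (Ioo α β))
    (h : ∀ᵐ x ∂(volume.restrict (Ioo α β)), HasDerivAt F (φ x) x) {x : ℝ} (hx : x ∈ Ioo α β) :
    HasDerivAt F (φ x) x := by
  have hint : ∀ y ∈ Ioo α β, IntervalIntegrable φ volume x y := fun y hy =>
    (hφ.mono (by
      rw [uIcc]; exact Icc_subset_Ioo (lt_min hx.1 hy.1) (max_lt hx.2 hy.2))).intervalIntegrable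
  obtain ⟨C, hC⟩ := (hF.sub (LocAC.integral hint)).eq_const (by
    filter_upwards [h, ae_hasDerivAt_integral_Ioo hint] with y h1 h2
    have h3 := h1.sub h2
    rw [sub_self] at h3
    exact h3)
  have h1 : HasDerivAt (fun y => ∫ t in x..y, φ t) (φ x) x := by
    refine intervalIntegral.integral_hasDerivAt_right (by simp)
      (hφ.stronglyMeasurableAtFilter isOpen_Ioo x hx) (hφ.continuousAt (isOpen_Ioo.mem_nhds hx))
  refine (h1.const_add C).congr_of_eventuallyEq ?_
  filter_upwards [isOpen_Ioo.mem_nhds hx] with y hy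
  rw [← hC y hy]; ring

end AC

/-! ### Improper integrals bounded by antiderivatives. -/

section Comparison

/-- From `k ≤ -M'` and `M ≥ 0`, the integrals of `k` over `[x, d]` are at most `M x` uniformly in `d
< β`. Both integrability up to `β` and the bound follow in the limit. -/
theorem integral_le_of_antideriv_right {k m M : ℝ → ℝ} {x β : ℝ} (hxβ : x < β)
    (hk : ContinuousOn k (Ico x β)) (hk0 : ∀ y ∈ Ico x β, 0 ≤ k y)
    (hM : ∀ y ∈ Ico x β, HasDerivAt M (-(m y)) y) (hkm : ∀ y ∈ Ico x β, k y ≤ m y)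
    (hM0 : ∀ y ∈ Ico x β, 0 ≤ M y) :
    IntervalIntegrable k volume x β ∧ ∫ y in x..β, k y ≤ M x := by
  have hfin : ∀ d ∈ Ico x β, ∫ y in x..d, k y ≤ M x := by
    intro d hd
    have hsub : Icc x d ⊆ Ico x β := fun y hy => ⟨hy.1, hy.2.trans_lt hd.2⟩
    have h1 := intervalIntegral.integral_le_sub_of_hasDeriv_right_of_le (g := fun y => -M y)
      (g' := m) (φ := k) hd.1
      (fun y hy => (hM y (hsub hy)).continuousAt.neg.continuousWithinAt)
      (fun y hy => by
        have h := (hM y (hsub (Ioo_subset_Icc_self hy))).neg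
        rw [neg_neg] at h
        exact h.hasDerivWithinAt)
      ((hk.mono hsub).integrableOn_Icc) (fun y hy => hkm y (hsub (Ioo_subset_Icc_self hy)))
    have h2 := hM0 d hd
    linarith
  have hev : ∀ᶠ d in 𝓝[<] β, d ∈ Ico x β := by
    filter_upwards [Ioo_mem_nhdsLT hxβ] with d hd using Ioo_subset_Ico_self hd
  have hint : IntegrableOn k (Ioc x β) := by
    let b : ℕ → ℝ := fun n => β - (β - x) / (n + 1)
    have hb : Tendsto b atTop (𝓝 β) := by
      have := (tendsto_const_div_atTop_nhds_zero_nat (β - x)).comp (tendsto_add_atTop_nat 1)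
      have h2 := tendsto_const_nhds (x := β) (f := (atTop : Filter ℕ)) |>.sub this
      simpa [b, Function.comp_def] using h2
    have hbI : ∀ n, b n ∈ Ico x β := fun n => by
      have h1 : 0 < β - x := sub_pos.2 hxβ
      have h2 : (1 : ℝ) ≤ n + 1 := by linarith [n.cast_nonneg (α := ℝ)]
      have h3 : (β - x) / (n + 1) ≤ β - x := div_le_self h1.le h2
      have h4 : 0 < (β - x) / (n + 1) := by positivity
      exact ⟨by simp only [b]; linarith, by simp only [b]; linarith⟩
    refine integrableOn_Ioc_of_intervalIntegral_norm_bounded (a := fun _ => x) (b := b)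
      (l := atTop) (I := M x) (fun n => ?_) tendsto_const_nhds hb (Eventually.of_forall fun n => ?_)
    · exact ((hk.mono fun y hy => ⟨hy.1, hy.2.trans_lt (hbI n).2⟩).integrableOn_Icc).mono_set
        Ioc_subset_Icc_self
    · rw [← intervalIntegral.integral_of_le (hbI n).1]
      refine le_trans (le_of_eq ?_) (hfin _ (hbI n))
      refine intervalIntegral.integral_congr fun y hy => ?_
      rw [uIcc_of_le (hbI n).1] at hy
      exact Real.norm_of_nonneg (hk0 y ⟨hy.1, hy.2.trans_lt (hbI n).2⟩)
  have hii : IntervalIntegrable k volume x β := (intervalIntegrable_iff_integrableOn_Ioc_of_le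
    hxβ.le).2 hint
  refine ⟨hii, ?_⟩
  have hc := intervalIntegral.continuousOn_primitive_interval' hii left_mem_uIcc
  rw [uIcc_of_le hxβ.le] at hc
  have h1 : Tendsto (fun b => ∫ y in x..b, k y) (𝓝[<] β) (𝓝 (∫ y in x..β, k y)) := by
    refine (hc β (right_mem_Icc.2 hxβ.le)).tendsto.mono_left ?_
    rw [← nhdsWithin_Ioo_eq_nhdsLT hxβ]
    exact nhdsWithin_mono _ Ioo_subset_Icc_self
  exact le_of_tendsto h1 (hev.mono hfin)

theorem integral_le_of_antideriv_left {k m M : ℝ → ℝ} {α x : ℝ} (hαx : α < x)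
    (hk : ContinuousOn k (Ioc α x)) (hk0 : ∀ y ∈ Ioc α x, 0 ≤ k y)
    (hM : ∀ y ∈ Ioc α x, HasDerivAt M (m y) y) (hkm : ∀ y ∈ Ioc α x, k y ≤ m y)
    (hM0 : ∀ y ∈ Ioc α x, 0 ≤ M y) :
    IntervalIntegrable k volume α x ∧ ∫ y in α..x, k y ≤ M x := by
  have hmem : ∀ y ∈ Ico (-x) (-α), -y ∈ Ioc α x := fun y hy =>
    ⟨by linarith [hy.2], by linarith [hy.1]⟩
  have h := integral_le_of_antideriv_right (k := fun y => k (-y)) (m := fun y => m (-y))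
    (M := fun y => M (-y)) (x := -x) (β := -α) (by linarith)
    (hk.comp continuousOn_neg hmem) (fun y hy => hk0 _ (hmem y hy))
    (fun y hy => by
      have := (hM _ (hmem y hy)).comp y (hasDerivAt_neg y)
      simpa [Function.comp_def] using this)
    (fun y hy => hkm _ (hmem y hy)) (fun y hy => hM0 _ (hmem y hy))
  rw [neg_neg, intervalIntegral.integral_comp_neg, neg_neg, neg_neg] at h
  refine ⟨?_, h.2⟩
  exact ((IntervalIntegrable.iff_comp_neg (by finiteness)).2 h.1.symm)

end Comparison

/-! ### Model functions at the right end point. -/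

/-- The parameters of a Sturm–Liouville problem on `(lo, hi)` with leading coefficient
`P(y) = (2/9)(y - lo)(hi - y)(y3 - y)` and characteristic exponents `±nl` at `lo`, `±nr` at `hi`. -/
structure SLData where
  (lo hi y3 nl nr : ℝ)
  lo_lt_hi : lo < hi
  hi_lt_one : hi < 1
  hi_lt_y3 : hi < y3
  hnl : nl = 0 ∨ 1 / 2 ≤ nl
  hnr : nr = 0 ∨ 1 / 2 ≤ nr

namespace SLData

variable (d : SLData)

/-- The interval of definition. -/
abbrev I : Set ℝ := Ioo d.lo d.hi

theorem len_pos : 0 < d.hi - d.lo := sub_pos.2 d.lo_lt_hi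

theorem nl_nonneg : 0 ≤ d.nl := by rcases d.hnl with h | h <;> linarith

theorem nr_nonneg : 0 ≤ d.nr := by rcases d.hnr with h | h <;> linarith

/-- The leading coefficient. -/
def P (y : ℝ) : ℝ := 2 / 9 * ((y - d.lo) * (d.hi - y) * (d.y3 - y))

/-- The singular solution at distance `X` from `hi`. -/
def phi (X : ℝ) : ℝ := if d.nr = 0 then 1 + Real.log ((d.hi - d.lo) / X) else X ^ (-d.nr)

/-- The function `X φ'(X)`. -/
def phi1 (X : ℝ) : ℝ := if d.nr = 0 then -1 else -d.nr * X ^ (-d.nr)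

/-- An antiderivative of `1 / (X φ²)`. -/
def psi (X : ℝ) : ℝ := if d.nr = 0 then (d.phi X)⁻¹ else X ^ (2 * d.nr) / (2 * d.nr)

theorem log_ratio_nonneg {X : ℝ} (hX : 0 < X) (hXD : X ≤ d.hi - d.lo) :
    0 ≤ Real.log ((d.hi - d.lo) / X) := Real.log_nonneg ((one_le_div hX).2 hXD)

theorem phi_pos {X : ℝ} (hX : 0 < X) (hXD : X ≤ d.hi - d.lo) : 0 < d.phi X := by
  rw [phi]
  split_ifs
  · linarith [d.log_ratio_nonneg hX hXD]
  · positivity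

theorem phi_anti {X Y : ℝ} (hX : 0 < X) (hXY : X ≤ Y) : d.phi Y ≤ d.phi X := by
  have hD := d.len_pos
  rw [phi, phi]
  split_ifs
  · have : (d.hi - d.lo) / Y ≤ (d.hi - d.lo) / X := by gcongr
    have := Real.log_le_log (by have := hX.trans_le hXY; positivity) this
    linarith
  · exact Real.rpow_le_rpow_of_nonpos hX hXY (by linarith [d.nr_nonneg])

theorem hasDerivAt_log_ratio {D X : ℝ} (hD : 0 < D) (hX : 0 < X) :
    HasDerivAt (fun X => Real.log (D / X)) (-1 / X) X := by
  have h1 : HasDerivAt (fun X => Real.log D - Real.log X) (0 - X⁻¹) X :=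
    (hasDerivAt_const X _).sub (Real.hasDerivAt_log hX.ne')
  have h2 : (0 : ℝ) - X⁻¹ = -1 / X := by rw [zero_sub, neg_div, one_div]
  rw [h2] at h1
  refine h1.congr_of_eventuallyEq ?_
  filter_upwards [isOpen_Ioi.mem_nhds hX] with Y hY
  rw [Real.log_div hD.ne' (ne_of_gt hY)]

theorem hasDerivAt_phi {X : ℝ} (hX : 0 < X) : HasDerivAt d.phi (d.phi1 X / X) X := by
  unfold phi phi1
  split_ifs with h
  · exact (hasDerivAt_log_ratio d.len_pos hX).const_add 1
  · have := Real.hasDerivAt_rpow_const (x := X) (p := -d.nr) (Or.inl hX.ne')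
    rwa [Real.rpow_sub_one hX.ne', ← mul_div_assoc] at this

theorem hasDerivAt_phi1 {X : ℝ} (hX : 0 < X) :
    HasDerivAt d.phi1 (d.nr ^ 2 * d.phi X / X) X := by
  unfold phi phi1
  split_ifs with h
  · rw [h]; simpa using hasDerivAt_const X (-1 : ℝ)
  · have := (Real.hasDerivAt_rpow_const (x := X) (p := -d.nr) (Or.inl hX.ne')).const_mul (-d.nr)
    rw [Real.rpow_sub_one hX.ne'] at this
    convert! this using 1
    ring

theorem phi1_nonpos {X : ℝ} (hX : 0 < X) : d.phi1 X ≤ 0 := by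
  rw [phi1]
  split_ifs
  · norm_num
  · have := Real.rpow_pos_of_pos hX (-d.nr)
    nlinarith [d.nr_nonneg]

theorem neg_phi1_le {X : ℝ} (hX : 0 < X) (hXD : X ≤ d.hi - d.lo) :
    -d.phi1 X ≤ (d.nr + 1) * d.phi X := by
  rw [phi1, phi]
  split_ifs with h
  · rw [h]; linarith [d.log_ratio_nonneg hX hXD]
  · have := Real.rpow_pos_of_pos hX (-d.nr)
    linarith

theorem psi_nonneg {X : ℝ} (hX : 0 < X) (hXD : X ≤ d.hi - d.lo) : 0 ≤ d.psi X := by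
  rw [psi]
  split_ifs
  · exact (inv_pos.2 (d.phi_pos hX hXD)).le
  · have := d.nr_nonneg
    positivity

theorem hasDerivAt_psi {X : ℝ} (hX : 0 < X) (hXD : X ≤ d.hi - d.lo) :
    HasDerivAt d.psi (1 / (X * d.phi X ^ 2)) X := by
  have hp := d.phi_pos hX hXD
  by_cases h : d.nr = 0
  · have h1 := (d.hasDerivAt_phi hX).inv hp.ne'
    have h2 : d.psi = d.phi⁻¹ := by ext Y; simp [psi, h]
    rw [h2]
    convert! h1 using 1
    rw [phi1, if_pos h]
    field_simp
  · have h1 := (Real.hasDerivAt_rpow_const (x := X) (p := 2 * d.nr) (Or.inl hX.ne')).div_const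
      (2 * d.nr)
    have h2 : d.psi = fun X => X ^ (2 * d.nr) / (2 * d.nr) := by ext Y; simp [psi, h]
    rw [h2]
    convert! h1 using 1
    rw [phi, if_neg h, Real.rpow_sub_one hX.ne', Real.rpow_neg hX.le, two_mul d.nr,
      Real.rpow_add hX]
    have := (Real.rpow_pos_of_pos hX d.nr).ne'
    field_simp

/-- From `log t ≤ 4 t^(1/4)` and `1 ≤ t^(1/4)`, whence the factor `5`. The logarithm belonging to
exponent zero is traded for a quarter power, a loss that the square root gained from Cauchy–Schwarz
later outweighs. -/
theorem log_ratio_le {X : ℝ} (hX : 0 < X) (hXD : X ≤ d.hi - d.lo) :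
    1 + Real.log ((d.hi - d.lo) / X) ≤ 5 * (d.hi - d.lo) ^ (1 / 4 : ℝ) * X ^ (-(1 / 4) : ℝ) := by
  have hD := d.len_pos
  have h1 := Real.log_le_rpow_div (x := (d.hi - d.lo) / X) (ε := 1 / 4) (by positivity) (by norm_num)
  have h2 : ((d.hi - d.lo) / X) ^ (1 / 4 : ℝ) =
      (d.hi - d.lo) ^ (1 / 4 : ℝ) * X ^ (-(1 / 4) : ℝ) := by
    rw [Real.div_rpow hD.le hX.le, Real.rpow_neg hX.le]; rfl
  have h3 : (1 : ℝ) ≤ ((d.hi - d.lo) / X) ^ (1 / 4 : ℝ) :=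
    Real.one_le_rpow ((one_le_div hX).2 hXD) (by norm_num)
  rw [mul_assoc, ← h2]
  linarith

/-- For a nonzero exponent the additional quarter power is superfluous; it is kept so that both
cases share one bound. -/
theorem exists_phi_le : ∃ C, 0 < C ∧ ∀ X, 0 < X → X ≤ d.hi - d.lo →
    d.phi X ≤ C * X ^ (-d.nr - 1 / 4) := by
  have hD := d.len_pos
  by_cases h : d.nr = 0
  · refine ⟨5 * (d.hi - d.lo) ^ (1 / 4 : ℝ), by positivity, fun X hX hXD => ?_⟩
    rw [phi, if_pos h, h, neg_zero, zero_sub]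
    exact d.log_ratio_le hX hXD
  · refine ⟨(d.hi - d.lo) ^ (1 / 4 : ℝ), by positivity, fun X hX hXD => ?_⟩
    have h1 : X ^ (-d.nr) = X ^ (1 / 4 : ℝ) * X ^ (-d.nr - 1 / 4) := by
      rw [← Real.rpow_add hX]; congr 1; ring
    rw [phi, if_neg h, h1]
    gcongr

/-- The two quantities are the factors that govern `E V` at `hi`. The product `φ ψ` is `X^nr / (2
nr)`, or `1` in the logarithmic case, so it has the size of the regular solution. -/
theorem exists_chi_le : ∃ C, 0 < C ∧ ∀ X, 0 < X → X ≤ d.hi - d.lo →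
    (d.phi X)⁻¹ ≤ C * X ^ d.nr ∧ d.phi X * d.psi X ≤ C * X ^ d.nr := by
  have hn := d.nr_nonneg
  by_cases h : d.nr = 0
  · refine ⟨1, one_pos, fun X hX hXD => ?_⟩
    have hp := d.phi_pos hX hXD
    rw [psi, if_pos h, mul_inv_cancel₀ hp.ne', h, Real.rpow_zero, mul_one]
    refine ⟨inv_le_one_of_one_le₀ ?_, le_rfl⟩
    rw [phi, if_pos h]
    linarith [d.log_ratio_nonneg hX hXD]
  · have hn' : 0 < d.nr := lt_of_le_of_ne hn (Ne.symm h)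
    refine ⟨1 + 1 / (2 * d.nr), by positivity, fun X hX hXD => ?_⟩
    have hp := Real.rpow_pos_of_pos hX d.nr
    rw [psi, if_neg h, phi, if_neg h, Real.rpow_neg hX.le, inv_inv, two_mul d.nr,
      Real.rpow_add hX, ← two_mul]
    have h1 : (X ^ d.nr)⁻¹ * (X ^ d.nr * X ^ d.nr / (2 * d.nr)) =
      1 / (2 * d.nr) * X ^ d.nr := by
      field_simp
    rw [h1, add_mul, one_mul]
    have : 0 < 1 / (2 * d.nr) * X ^ d.nr := by positivity
    constructor <;> linarith

end SLData

/-! ### The comparison solutions `E` and `E V` and their size at the end points. -/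

namespace SLData

variable (d : SLData)

/-- A positive increasing function, regular at `lo` and singular at `hi`. -/
def E (y : ℝ) : ℝ := (y - d.lo) ^ d.nl * d.phi (d.hi - y)

/-- The companion of `E` in the formula for its derivative. -/
def E1 (y : ℝ) : ℝ := (y - d.lo) ^ d.nl * -d.phi1 (d.hi - y)

/-- The derivative of `E`. -/
def dE (y : ℝ) : ℝ := d.nl * d.E y / (y - d.lo) + d.E1 y / (d.hi - y)

/-- The function `P E'`. -/
def Q (y : ℝ) : ℝ :=
  2 / 9 * (d.y3 - y) * (d.nl * (d.hi - y) * d.E y + (y - d.lo) * d.E1 y)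

/-- The derivative of `P E'`. -/
def dQ (y : ℝ) : ℝ :=
  -(2 / 9) * (d.nl * (d.hi - y) * d.E y + (y - d.lo) * d.E1 y) +
  2 / 9 * (d.y3 - y) * (-d.nl * d.E y + d.nl * (d.hi - y) * d.dE y + d.E1 y +
    (y - d.lo) * (d.nl * d.E1 y / (y - d.lo) + d.nr ^ 2 * d.E y / (d.hi - y)))

variable {d} {y : ℝ}

theorem left_pos (hy : y ∈ d.I) : 0 < y - d.lo := sub_pos.2 hy.1

theorem right_pos (hy : y ∈ d.I) : 0 < d.hi - y := sub_pos.2 hy.2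

theorem left_le (hy : y ∈ d.I) : y - d.lo ≤ d.hi - d.lo := by linarith [hy.2]

theorem right_le (hy : y ∈ d.I) : d.hi - y ≤ d.hi - d.lo := by linarith [hy.1]

theorem P_pos (hy : y ∈ d.I) : 0 < d.P y := by
  have h1 := left_pos hy
  have h2 := right_pos hy
  have h3 : 0 < d.y3 - y := by linarith [hy.2, d.hi_lt_y3]
  rw [P]
  positivity

theorem continuous_P : Continuous d.P := by unfold P; fun_prop

theorem E_pos (hy : y ∈ d.I) : 0 < d.E y :=
  mul_pos (Real.rpow_pos_of_pos (left_pos hy) _) (d.phi_pos (right_pos hy) (right_le hy))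

theorem E1_nonneg (hy : y ∈ d.I) : 0 ≤ d.E1 y :=
  mul_nonneg (Real.rpow_pos_of_pos (left_pos hy) _).le
    (neg_nonneg.2 (d.phi1_nonpos (right_pos hy)))

/-- Boundedness of `E1 / E` keeps the pole-free part of `dQ / E` bounded even where `E` blows up. -/
theorem E1_le (hy : y ∈ d.I) : d.E1 y ≤ (d.nr + 1) * d.E y := by
  have h1 := d.neg_phi1_le (right_pos hy) (right_le hy)
  have h2 := Real.rpow_pos_of_pos (left_pos hy) d.nl
  calc d.E1 y ≤ (y - d.lo) ^ d.nl * ((d.nr + 1) * d.phi (d.hi - y)) :=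
        mul_le_mul_of_nonneg_left h1 h2.le
    _ = _ := by rw [E]; ring

theorem hasDerivAt_left_rpow (hy : y ∈ d.I) :
    HasDerivAt (fun y => (y - d.lo) ^ d.nl) (d.nl * (y - d.lo) ^ d.nl / (y - d.lo)) y := by
  have h := (Real.hasDerivAt_rpow_const (p := d.nl) (Or.inl (left_pos hy).ne')).comp y
    ((hasDerivAt_id y).sub_const d.lo)
  rw [Real.rpow_sub_one (left_pos hy).ne', mul_one, ← mul_div_assoc] at h
  exact h

theorem hasDerivAt_E (hy : y ∈ d.I) : HasDerivAt d.E (d.dE y) y := by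
  have h1 := (d.hasDerivAt_phi (right_pos hy)).comp y ((hasDerivAt_id y).const_sub d.hi)
  have h2 := (hasDerivAt_left_rpow hy).mul h1
  refine h2.congr_deriv ?_
  simp only [dE, E, E1, Function.comp_apply]
  ring

theorem hasDerivAt_E1 (hy : y ∈ d.I) : HasDerivAt d.E1
    (d.nl * d.E1 y / (y - d.lo) + d.nr ^ 2 * d.E y / (d.hi - y)) y := by
  have h1 := ((d.hasDerivAt_phi1 (right_pos hy)).comp y ((hasDerivAt_id y).const_sub d.hi)).neg
  have h2 := (hasDerivAt_left_rpow hy).mul h1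
  refine h2.congr_deriv ?_
  simp only [E, E1, Function.comp_apply, Pi.neg_apply]
  ring

theorem hasDerivAt_Q (hy : y ∈ d.I) : HasDerivAt d.Q (d.dQ y) y := by
  have h1 := ((((hasDerivAt_id y).const_sub d.hi).const_mul d.nl).mul (hasDerivAt_E hy)).add
    (((hasDerivAt_id y).sub_const d.lo).mul (hasDerivAt_E1 hy))
  have h2 := (((hasDerivAt_id y).const_sub d.y3).const_mul (2 / 9 : ℝ)).mul h1
  refine h2.congr_deriv ?_
  simp only [dQ, id, Pi.mul_apply, Pi.add_apply]
  ring

theorem P_mul_dE (hy : y ∈ d.I) : d.P y * d.dE y = d.Q y := by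
  have h1 := (left_pos hy).ne'
  have h2 := (right_pos hy).ne'
  rw [P, dE, Q]
  field_simp

theorem continuousOn_E : ContinuousOn d.E d.I := fun _ hy =>
  (hasDerivAt_E hy).continuousAt.continuousWithinAt

theorem continuousOn_E1 : ContinuousOn d.E1 d.I := fun _ hy =>
  (hasDerivAt_E1 hy).continuousAt.continuousWithinAt

theorem continuousOn_dE : ContinuousOn d.dE d.I := by
  unfold dE
  refine ((continuousOn_E.const_mul d.nl).div (by fun_prop) fun y hy => (left_pos hy).ne').add
    (continuousOn_E1.div (by fun_prop) fun y hy => (right_pos hy).ne')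

theorem continuousOn_dQ : ContinuousOn d.dQ d.I := by
  have h1 := continuousOn_E (d := d)
  have h2 := continuousOn_E1 (d := d)
  have h3 := continuousOn_dE (d := d)
  have h4 : ContinuousOn (fun y => d.nl * d.E1 y / (y - d.lo) + d.nr ^ 2 * d.E y / (d.hi - y))
      d.I := by
    refine ((h2.const_mul d.nl).div (by fun_prop) fun y hy => (left_pos hy).ne').add
      ((h1.const_mul _).div (by fun_prop) fun y hy => (right_pos hy).ne')
  unfold dQ
  fun_prop

theorem exists_E_le (d : SLData) : ∃ C, 0 < C ∧ ∀ y ∈ d.I,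
    d.E y ≤ C * ((y - d.lo) ^ d.nl * (d.hi - y) ^ (-d.nr - 1 / 4)) := by
  obtain ⟨C, hC, h⟩ := d.exists_phi_le
  refine ⟨C, hC, fun y hy => ?_⟩
  have h1 := Real.rpow_pos_of_pos (left_pos hy) d.nl
  calc d.E y ≤ (y - d.lo) ^ d.nl * (C * (d.hi - y) ^ (-d.nr - 1 / 4)) :=
        mul_le_mul_of_nonneg_left (h _ (right_pos hy) (right_le hy)) h1.le
    _ = _ := by ring

variable (d) in
/-- The coefficient `1 / (P E²)`. -/
def K (y : ℝ) : ℝ := 1 / (d.P y * d.E y ^ 2)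

theorem K_pos (hy : y ∈ d.I) : 0 < d.K y := by
  have h1 := P_pos hy
  have h2 := E_pos hy
  rw [K]; positivity

theorem continuousOn_K : ContinuousOn d.K d.I := by
  unfold K
  exact continuousOn_const.div (continuous_P.continuousOn.mul (continuousOn_E.pow 2))
    fun y hy => (mul_pos (P_pos hy) (pow_pos (E_pos hy) 2)).ne'

variable (d) in
/-- The integral `∫_x^hi 1 / (P E²)`. -/
def V (x : ℝ) : ℝ := ∫ y in x..d.hi, d.K y

/-- With `y3 - y` bounded below by `y3 - hi`, this is a partial fraction decomposition. -/
theorem exists_P_inv_le (d : SLData) : ∃ C, 0 < C ∧ ∀ y ∈ d.I,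
    1 / d.P y ≤ C * (1 / (y - d.lo) + 1 / (d.hi - y)) := by
  have hD := d.len_pos
  have hk : 0 < d.y3 - d.hi := sub_pos.2 d.hi_lt_y3
  refine ⟨9 / (2 * (d.y3 - d.hi) * (d.hi - d.lo)), by positivity, fun y hy => ?_⟩
  have h1 := left_pos hy
  have h2 := right_pos hy
  have h3 : d.y3 - d.hi ≤ d.y3 - y := by linarith [hy.2]
  have h4 : 1 / d.P y ≤ 1 / (2 / 9 * ((y - d.lo) * (d.hi - y) * (d.y3 - d.hi))) := by
    rw [P]; gcongr
  refine h4.trans_eq ?_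
  field_simp
  ring

/-- Both `(y - lo)^nl` and `φ(hi - y)` increase with `y`. The power can therefore be frozen at `y =
x` throughout, and `φ` can be frozen in the term with the pole at `lo`; in the term with the pole at
`hi`, `φ` is kept and `psi` provides the antiderivative. -/
theorem K_le_aux {x : ℝ} (hx : x ∈ d.I) {C : ℝ} (hC : 0 < C) (hP : ∀ y ∈ d.I,
    1 / d.P y ≤ C * (1 / (y - d.lo) + 1 / (d.hi - y))) :
    IntervalIntegrable d.K volume x d.hi ∧ d.V x ≤ C * (((x - d.lo) ^ d.nl) ^ 2)⁻¹ *
      (((d.phi (d.hi - x)) ^ 2)⁻¹ * Real.log ((d.hi - d.lo) / (x - d.lo)) + d.psi (d.hi - x)) := by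
  have hD := d.len_pos
  have hsub : Ico x d.hi ⊆ d.I := fun y hy => ⟨hx.1.trans_le hy.1, hy.2⟩
  have hxl := Real.rpow_pos_of_pos (left_pos hx) d.nl
  have hpx := d.phi_pos (right_pos hx) (right_le hx)
  refine integral_le_of_antideriv_right (m := fun y => C * (((x - d.lo) ^ d.nl) ^ 2)⁻¹ *
      (((d.phi (d.hi - x)) ^ 2)⁻¹ * (1 / (y - d.lo)) + 1 / ((d.hi - y) * d.phi (d.hi - y) ^ 2)))
    (M := fun y => C * (((x - d.lo) ^ d.nl) ^ 2)⁻¹ *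
      (((d.phi (d.hi - x)) ^ 2)⁻¹ * Real.log ((d.hi - d.lo) / (y - d.lo)) + d.psi (d.hi - y)))
    hx.2 (continuousOn_K.mono hsub) (fun y hy => (K_pos (hsub hy)).le) (fun y hy => ?_)
    (fun y hy => ?_) (fun y hy => ?_)
  · have hy' := hsub hy
    have h1 := (hasDerivAt_log_ratio hD (left_pos hy')).comp y
      ((hasDerivAt_id y).sub_const d.lo)
    have h2 := (d.hasDerivAt_psi (right_pos hy') (right_le hy')).comp y
      ((hasDerivAt_id y).const_sub d.hi)
    have h3 := ((h1.const_mul (((d.phi (d.hi - x)) ^ 2)⁻¹)).add h2).const_mul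
      (C * (((x - d.lo) ^ d.nl) ^ 2)⁻¹)
    refine h3.congr_deriv ?_
    ring
  · have hy' := hsub hy
    have h1 := left_pos hy'
    have h2 := right_pos hy'
    have hpy := d.phi_pos (right_pos hy') (right_le hy')
    have hyl : (x - d.lo) ^ d.nl ≤ (y - d.lo) ^ d.nl :=
      Real.rpow_le_rpow (left_pos hx).le (by linarith [hy.1]) d.nl_nonneg
    have hph : d.phi (d.hi - x) ≤ d.phi (d.hi - y) := d.phi_anti h2 (by linarith [hy.1])
    have h3 : d.K y = (1 / d.P y) * (((y - d.lo) ^ d.nl) ^ 2)⁻¹ * ((d.phi (d.hi - y)) ^ 2)⁻¹ := by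
      rw [K, E]
      have := hxl.trans_le hyl
      field_simp
    have hPy := hP y hy'
    have hPp := P_pos hy'
    calc d.K y ≤ (C * (1 / (y - d.lo) + 1 / (d.hi - y))) * (((x - d.lo) ^ d.nl) ^ 2)⁻¹ *
          ((d.phi (d.hi - y)) ^ 2)⁻¹ := by
          rw [h3]; gcongr
      _ = C * (((x - d.lo) ^ d.nl) ^ 2)⁻¹ * (((d.phi (d.hi - y)) ^ 2)⁻¹ * (1 / (y - d.lo)) +
          1 / ((d.hi - y) * d.phi (d.hi - y) ^ 2)) := by
          field_simp
      _ ≤ _ := by gcongr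
  · have hy' := hsub hy
    have h1 := d.log_ratio_nonneg (left_pos hy') (left_le hy')
    have h2 := d.psi_nonneg (right_pos hy') (right_le hy')
    have h3 := sq_nonneg (d.phi (d.hi - x))
    positivity

theorem intervalIntegrable_K {x : ℝ} (hx : x ∈ d.I) : IntervalIntegrable d.K volume x d.hi := by
  obtain ⟨C, hC, hP⟩ := d.exists_P_inv_le
  exact (K_le_aux hx hC hP).1

theorem V_nonneg {x : ℝ} (hx : x ∈ d.I) : 0 ≤ d.V x :=
  intervalIntegral.integral_nonneg_of_ae_restrict hx.2.le (by
    rw [EventuallyLE, ae_restrict_iff' measurableSet_Icc]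
    have : ∀ᵐ y : ℝ, y ≠ d.hi := by simp [ae_iff, measure_singleton]
    filter_upwards [this] with y hy hyI
    exact (K_pos ⟨hx.1.trans_le hyI.1, lt_of_le_of_ne hyI.2 hy⟩).le)

theorem hasDerivAt_V {x : ℝ} (hx : x ∈ d.I) : HasDerivAt d.V (-d.K x) x :=
  intervalIntegral.integral_hasDerivAt_left (intervalIntegrable_K hx)
    (continuousOn_K.stronglyMeasurableAtFilter isOpen_Ioo x hx)
    (continuousOn_K.continuousAt (isOpen_Ioo.mem_nhds hx))

theorem continuousOn_V : ContinuousOn d.V d.I := fun _ hy =>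
  (hasDerivAt_V hy).continuousAt.continuousWithinAt

/-- Multiplying the bound for `V` by `E` leaves `φ⁻¹ log + φ ψ`. At `hi` both summands are
controlled by the regular solution, and the logarithm at `lo` costs a quarter power. -/
theorem exists_E_mul_V_le (d : SLData) : ∃ C, 0 < C ∧ ∀ y ∈ d.I,
    d.E y * d.V y ≤ C * ((y - d.lo) ^ (-d.nl - 1 / 4) * (d.hi - y) ^ d.nr) := by
  have hD := d.len_pos
  obtain ⟨C₁, hC₁, hP⟩ := d.exists_P_inv_le
  obtain ⟨C₂, hC₂, hχ⟩ := d.exists_chi_le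
  refine ⟨C₁ * C₂ * (5 * (d.hi - d.lo) ^ (1 / 4 : ℝ)), by positivity, fun y hy => ?_⟩
  have h1 := left_pos hy
  have h2 := right_pos hy
  have hp := d.phi_pos h2 (right_le hy)
  have hl := Real.rpow_pos_of_pos h1 d.nl
  have hr := Real.rpow_pos_of_pos h2 d.nr
  obtain ⟨hχ1, hχ2⟩ := hχ _ h2 (right_le hy)
  have hlog := d.log_ratio_nonneg h1 (left_le hy)
  have hsplit : (y - d.lo) ^ (-d.nl - 1 / 4) =
      ((y - d.lo) ^ d.nl)⁻¹ * (y - d.lo) ^ (-(1 / 4) : ℝ) := by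
    rw [sub_eq_add_neg (-d.nl), Real.rpow_add h1, Real.rpow_neg h1.le]
  calc d.E y * d.V y ≤ d.E y * (C₁ * (((y - d.lo) ^ d.nl) ^ 2)⁻¹ *
      (((d.phi (d.hi - y)) ^ 2)⁻¹ * Real.log ((d.hi - d.lo) / (y - d.lo)) + d.psi (d.hi - y))) :=
        mul_le_mul_of_nonneg_left (K_le_aux hy hC₁ hP).2 (E_pos hy).le
    _ = C₁ * ((y - d.lo) ^ d.nl)⁻¹ * ((d.phi (d.hi - y))⁻¹ *
        Real.log ((d.hi - d.lo) / (y - d.lo)) + d.phi (d.hi - y) * d.psi (d.hi - y)) := by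
        rw [E]; field_simp
    _ ≤ C₁ * ((y - d.lo) ^ d.nl)⁻¹ * (C₂ * (d.hi - y) ^ d.nr *
        Real.log ((d.hi - d.lo) / (y - d.lo)) + C₂ * (d.hi - y) ^ d.nr) := by gcongr
    _ = C₁ * C₂ * ((y - d.lo) ^ d.nl)⁻¹ * (d.hi - y) ^ d.nr *
        (1 + Real.log ((d.hi - d.lo) / (y - d.lo))) := by ring
    _ ≤ C₁ * C₂ * ((y - d.lo) ^ d.nl)⁻¹ * (d.hi - y) ^ d.nr *
        (5 * (d.hi - d.lo) ^ (1 / 4 : ℝ) * (y - d.lo) ^ (-(1 / 4) : ℝ)) := by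
        gcongr
        exact d.log_ratio_le h1 (left_le hy)
    _ = _ := by rw [hsplit]; ring

end SLData

/-! ### Integration up to singular end points and moments of square integrable sources. -/

theorem tendsto_integral_left {α β : ℝ} {ψ : ℝ → ℂ} (hαβ : α < β)
    (hψ : IntervalIntegrable ψ volume α β) :
    Tendsto (fun x => ∫ t in α..x, ψ t) (𝓝[>] α) (𝓝 0) ∧
    Tendsto (fun x => ∫ t in α..x, ψ t) (𝓝[<] β) (𝓝 (∫ t in α..β, ψ t)) := by
  have hc := intervalIntegral.continuousOn_primitive_interval' hψ left_mem_uIcc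
  rw [uIcc_of_le hαβ.le] at hc
  constructor
  · have h := (hc α (left_mem_Icc.2 hαβ.le)).tendsto
    rw [intervalIntegral.integral_same] at h
    refine h.mono_left ?_
    rw [← nhdsWithin_Ioo_eq_nhdsGT hαβ]
    exact nhdsWithin_mono _ Ioo_subset_Icc_self
  · refine (hc β (right_mem_Icc.2 hαβ.le)).tendsto.mono_left ?_
    rw [← nhdsWithin_Ioo_eq_nhdsLT hαβ]
    exact nhdsWithin_mono _ Ioo_subset_Icc_self

/-- `F` minus the primitive of `ψ` is constant inside the interval, and one-sided limits identify
that constant at both ends. Absolute continuity of `F` on the closed interval is not required. -/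
theorem LocAC.integral_eq_sub {α β : ℝ} {F ψ : ℝ → ℂ} {A B : ℂ} (hαβ : α < β)
    (hF : LocAC α β F) (hψ : IntervalIntegrable ψ volume α β)
    (h : ∀ᵐ x ∂(volume.restrict (Ioo α β)), HasDerivAt F (ψ x) x)
    (hA : Tendsto F (𝓝[>] α) (𝓝 A)) (hB : Tendsto F (𝓝[<] β) (𝓝 B)) :
    ∫ t in α..β, ψ t = B - A := by
  have hint : ∀ x ∈ Ioo α β, IntervalIntegrable ψ volume α x := fun x hx =>
    hψ.mono_set (uIcc_subset_uIcc left_mem_uIcc (by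
      rw [uIcc_of_le hαβ.le]; exact Ioo_subset_Icc_self hx))
  obtain ⟨C, hC⟩ := (hF.sub (LocAC.integral hint)).eq_const (by
    filter_upwards [h, ae_hasDerivAt_integral_Ioo hint] with x h1 h2
    have h3 := h1.sub h2
    rw [sub_self] at h3
    exact h3)
  obtain ⟨h1, h2⟩ := tendsto_integral_left hαβ hψ
  have hCA : C = A - 0 := by
    refine tendsto_nhds_unique (tendsto_const_nhds.congr' ?_) (hA.sub h1)
    filter_upwards [Ioo_mem_nhdsGT hαβ] with x hx using (hC x hx).symm
  have hCB : C = B - ∫ t in α..β, ψ t := by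
    refine tendsto_nhds_unique (tendsto_const_nhds.congr' ?_) (hB.sub h2)
    filter_upwards [Ioo_mem_nhdsLT hαβ] with x hx using (hC x hx).symm
  rw [hCA] at hCB
  linear_combination hCB

theorem sq_rpow_neg_quarter {X : ℝ} (hX : 0 < X) : (X ^ (-(1 / 4) : ℝ)) ^ 2 = 1 / √X := by
  rw [Real.sqrt_eq_rpow, ← Real.rpow_natCast, ← Real.rpow_mul hX.le, one_div (X ^ _),
    ← Real.rpow_neg hX.le]
  norm_num

namespace SLData

variable {d : SLData} {φ χ : ℝ → ℂ}

/-- The `L²(lo, hi)` norm. -/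
def N2 (d : SLData) (φ : ℝ → ℂ) : ℝ := √(∫ y in d.I, ‖φ y‖ ^ 2)

theorem N2_nonneg : 0 ≤ d.N2 φ := Real.sqrt_nonneg _

theorem integral_mul_le_N2 {k : ℝ → ℝ} {a b : ℝ} (hab : a ≤ b) (hI : Ioo a b ⊆ d.I)
    (hk : ContinuousOn k (Ioo a b)) (hk2 : IntervalIntegrable (fun t => k t ^ 2) volume a b)
    (hφ : MemLp φ 2 (volume.restrict d.I)) :
    IntervalIntegrable (fun t => (k t : ℂ) * φ t) volume a b ∧
      ‖∫ t in a..b, (k t : ℂ) * φ t‖ ≤ √(∫ t in a..b, k t ^ 2) * d.N2 φ := by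
  have hkm : MemLp k 2 (volume.restrict (Ioo a b)) :=
    (memLp_two_iff_integrable_sq (hk.aestronglyMeasurable measurableSet_Ioo)).2
      ((intervalIntegrable_iff_integrableOn_Ioo_of_le hab).1 hk2)
  have hφm : MemLp φ 2 (volume.restrict (Ioo a b)) :=
    hφ.mono_measure (Measure.restrict_mono hI le_rfl)
  have hint : IntegrableOn (fun t => (k t : ℂ) * φ t) (Ioo a b) :=
    MemLp.integrable_mul hkm.ofReal hφm
  refine ⟨(intervalIntegrable_iff_integrableOn_Ioo_of_le hab).2 hint, ?_⟩
  rw [intervalIntegral.integral_of_le hab, intervalIntegral.integral_of_le hab,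
    integral_Ioc_eq_integral_Ioo, integral_Ioc_eq_integral_Ioo]
  have h22 : (2 : ℝ).HolderConjugate 2 := Real.HolderConjugate.two_two
  have h1 := integral_mul_le_Lp_mul_Lq_of_nonneg (μ := volume.restrict (Ioo a b))
    (f := fun t => |k t|) (g := fun t => ‖φ t‖) h22
    (Eventually.of_forall fun t => abs_nonneg _) (Eventually.of_forall fun t => norm_nonneg _)
    (by simpa using hkm.norm) (by simpa using hφm.norm)
  have h2 : ‖∫ t in Ioo a b, (k t : ℂ) * φ t‖ ≤ ∫ t in Ioo a b, |k t| * ‖φ t‖ := by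
    refine (norm_integral_le_integral_norm _).trans_eq ?_
    refine integral_congr_ae (Eventually.of_forall fun t => ?_)
    simp [Complex.norm_real]
  refine (h2.trans h1).trans ?_
  simp only [Real.rpow_two, sq_abs, ← Real.sqrt_eq_rpow]
  refine mul_le_mul_of_nonneg_left (Real.sqrt_le_sqrt ?_) (Real.sqrt_nonneg _)
  exact setIntegral_mono_set hφ.norm.integrable_sq
    (Eventually.of_forall fun t => sq_nonneg _) (LE.le.eventuallyLE hI)

/-- After freezing the main powers at `x`, the squared quarter power is `1 / √(hi - t)`, whose
primitive is a difference of square roots. That difference is at most `(x - lo) / √(hi - lo)`, the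
source of the gain `√(x - lo)`. -/
theorem exists_integral_E_sq_le (d : SLData) : ∃ C, 0 < C ∧ ∀ x ∈ d.I,
    IntervalIntegrable (fun t => d.E t ^ 2) volume d.lo x ∧
      √(∫ t in d.lo..x, d.E t ^ 2) ≤
        C * ((x - d.lo) ^ d.nl * (d.hi - x) ^ (-d.nr) * √(x - d.lo)) := by
  obtain ⟨C, hC, hE⟩ := d.exists_E_le
  have hD := d.len_pos
  refine ⟨√(2 * C ^ 2 / √(d.hi - d.lo)), by positivity, fun x hx => ?_⟩
  have hsub : Ioc d.lo x ⊆ d.I := fun y hy => ⟨hy.1, hy.2.trans_lt hx.2⟩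
  have hl := left_pos hx
  have hr := right_pos hx
  have hl' := Real.rpow_pos_of_pos hl d.nl
  have hr' := Real.rpow_pos_of_pos hr (-d.nr)
  set c := C ^ 2 * ((x - d.lo) ^ d.nl * (d.hi - x) ^ (-d.nr)) ^ 2 with hc
  have hc0 : 0 ≤ c := by positivity
  obtain ⟨h1, h2⟩ := integral_le_of_antideriv_left (k := fun t => d.E t ^ 2)
    (m := fun t => c * (1 / √(d.hi - t)))
    (M := fun t => c * (2 * (√(d.hi - d.lo) - √(d.hi - t)))) hx.1
    ((continuousOn_E.mono hsub).pow 2) (fun y _ => sq_nonneg _) (fun y hy => by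
      have h1 := (((hasDerivAt_id y).const_sub d.hi).sqrt (right_pos (hsub hy)).ne')
      have h2 := ((h1.const_sub (√(d.hi - d.lo))).const_mul 2).const_mul c
      refine h2.congr_deriv ?_
      simp only [id]
      ring) (fun y hy => by
      have hy' := hsub hy
      have h3 : (y - d.lo) ^ d.nl ≤ (x - d.lo) ^ d.nl :=
        Real.rpow_le_rpow (left_pos hy').le (by linarith [hy.2]) d.nl_nonneg
      have h4 : (d.hi - y) ^ (-d.nr) ≤ (d.hi - x) ^ (-d.nr) :=
        Real.rpow_le_rpow_of_nonpos hr (by linarith [hy.2]) (by linarith [d.nr_nonneg])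
      have h5 : (d.hi - y) ^ (-d.nr - 1 / 4) = (d.hi - y) ^ (-d.nr) * (d.hi - y) ^ (-(1 / 4) : ℝ) := by
        rw [sub_eq_add_neg (-d.nr), Real.rpow_add (right_pos hy')]
      have h6 : ((d.hi - y) ^ (-(1 / 4) : ℝ)) ^ 2 = 1 / √(d.hi - y) :=
        sq_rpow_neg_quarter (right_pos hy')
      have h7 := Real.rpow_pos_of_pos (left_pos hy') d.nl
      have h8 := Real.rpow_pos_of_pos (right_pos hy') (-d.nr)
      have h9 := Real.rpow_pos_of_pos (right_pos hy') (-(1 / 4) : ℝ)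
      calc d.E y ^ 2 ≤ (C * ((y - d.lo) ^ d.nl * (d.hi - y) ^ (-d.nr - 1 / 4))) ^ 2 :=
            pow_le_pow_left₀ (E_pos hy').le (hE y hy') 2
        _ ≤ (C * ((x - d.lo) ^ d.nl * ((d.hi - x) ^ (-d.nr) * (d.hi - y) ^ (-(1 / 4) : ℝ)))) ^ 2 := by
            rw [h5]; gcongr
        _ = c * ((d.hi - y) ^ (-(1 / 4) : ℝ)) ^ 2 := by rw [hc]; ring
        _ = _ := by rw [h6])
    (fun y hy => by
      have : √(d.hi - y) ≤ √(d.hi - d.lo) := Real.sqrt_le_sqrt (right_le (hsub hy))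
      exact mul_nonneg hc0 (by linarith))
  refine ⟨h1, ?_⟩
  have h3 : c * (2 * (√(d.hi - d.lo) - √(d.hi - x))) ≤
      2 * C ^ 2 / √(d.hi - d.lo) * ((x - d.lo) ^ d.nl * (d.hi - x) ^ (-d.nr) * √(x - d.lo)) ^ 2 := by
    have hs := Real.sqrt_pos.2 hD
    have h4 : √(d.hi - d.lo) - √(d.hi - x) ≤ (x - d.lo) / √(d.hi - d.lo) := by
      rw [le_div_iff₀ hs, sub_mul, Real.mul_self_sqrt hD.le]
      have h5 : √(d.hi - x) * √(d.hi - x) ≤ √(d.hi - x) * √(d.hi - d.lo) :=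
        mul_le_mul_of_nonneg_left (Real.sqrt_le_sqrt (right_le hx)) (Real.sqrt_nonneg _)
      rw [Real.mul_self_sqrt hr.le] at h5
      linarith
    calc _ ≤ c * (2 * ((x - d.lo) / √(d.hi - d.lo))) := by gcongr
      _ = _ := by rw [mul_pow, Real.sq_sqrt hl.le, hc]; ring
  calc _ ≤ √(2 * C ^ 2 / √(d.hi - d.lo) *
        ((x - d.lo) ^ d.nl * (d.hi - x) ^ (-d.nr) * √(x - d.lo)) ^ 2) :=
        Real.sqrt_le_sqrt (h2.trans h3)
    _ = _ := by
        rw [Real.sqrt_mul (by positivity), Real.sqrt_sq (by positivity)]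

theorem exists_integral_EV_sq_le (d : SLData) : ∃ C, 0 < C ∧ ∀ x ∈ d.I,
    IntervalIntegrable (fun t => (d.E t * d.V t) ^ 2) volume x d.hi ∧
      √(∫ t in x..d.hi, (d.E t * d.V t) ^ 2) ≤
        C * ((x - d.lo) ^ (-d.nl) * (d.hi - x) ^ d.nr * √(d.hi - x)) := by
  obtain ⟨C, hC, hE⟩ := d.exists_E_mul_V_le
  have hD := d.len_pos
  refine ⟨√(2 * C ^ 2 / √(d.hi - d.lo)), by positivity, fun x hx => ?_⟩
  have hsub : Ico x d.hi ⊆ d.I := fun y hy => ⟨hx.1.trans_le hy.1, hy.2⟩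
  have hl := left_pos hx
  have hr := right_pos hx
  have hl' := Real.rpow_pos_of_pos hl (-d.nl)
  have hr' := Real.rpow_pos_of_pos hr d.nr
  set c := C ^ 2 * ((x - d.lo) ^ (-d.nl) * (d.hi - x) ^ d.nr) ^ 2 with hc
  have hc0 : 0 ≤ c := by positivity
  obtain ⟨h1, h2⟩ := integral_le_of_antideriv_right (k := fun t => (d.E t * d.V t) ^ 2)
    (m := fun t => c * (1 / √(t - d.lo)))
    (M := fun t => c * (2 * (√(d.hi - d.lo) - √(t - d.lo)))) hx.2
    (((continuousOn_E.mul continuousOn_V).mono hsub).pow 2) (fun y _ => sq_nonneg _) (fun y hy => by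
      have h1 := (((hasDerivAt_id y).sub_const d.lo).sqrt (left_pos (hsub hy)).ne')
      have h2 := ((h1.const_sub (√(d.hi - d.lo))).const_mul 2).const_mul c
      refine h2.congr_deriv ?_
      simp only [id]
      ring) (fun y hy => by
      have hy' := hsub hy
      have h3 : (y - d.lo) ^ (-d.nl) ≤ (x - d.lo) ^ (-d.nl) :=
        Real.rpow_le_rpow_of_nonpos hl (by linarith [hy.1]) (by linarith [d.nl_nonneg])
      have h4 : (d.hi - y) ^ d.nr ≤ (d.hi - x) ^ d.nr :=
        Real.rpow_le_rpow (right_pos hy').le (by linarith [hy.1]) d.nr_nonneg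
      have h5 : (y - d.lo) ^ (-d.nl - 1 / 4) = (y - d.lo) ^ (-d.nl) * (y - d.lo) ^ (-(1 / 4) : ℝ) := by
        rw [sub_eq_add_neg (-d.nl), Real.rpow_add (left_pos hy')]
      have h6 : ((y - d.lo) ^ (-(1 / 4) : ℝ)) ^ 2 = 1 / √(y - d.lo) :=
        sq_rpow_neg_quarter (left_pos hy')
      have h7 := Real.rpow_pos_of_pos (left_pos hy') (-d.nl)
      have h8 := Real.rpow_pos_of_pos (right_pos hy') d.nr
      have h9 := Real.rpow_pos_of_pos (left_pos hy') (-(1 / 4) : ℝ)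
      calc (d.E y * d.V y) ^ 2 ≤ (C * ((y - d.lo) ^ (-d.nl - 1 / 4) * (d.hi - y) ^ d.nr)) ^ 2 :=
            pow_le_pow_left₀ (mul_nonneg (E_pos hy').le (V_nonneg hy')) (hE y hy') 2
        _ ≤ (C * (((x - d.lo) ^ (-d.nl) * (y - d.lo) ^ (-(1 / 4) : ℝ)) * (d.hi - x) ^ d.nr)) ^ 2 := by
            rw [h5]; gcongr
        _ = c * ((y - d.lo) ^ (-(1 / 4) : ℝ)) ^ 2 := by rw [hc]; ring
        _ = _ := by rw [h6])
    (fun y hy => by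
      have : √(y - d.lo) ≤ √(d.hi - d.lo) := Real.sqrt_le_sqrt (left_le (hsub hy))
      exact mul_nonneg hc0 (by linarith))
  refine ⟨h1, ?_⟩
  have h3 : c * (2 * (√(d.hi - d.lo) - √(x - d.lo))) ≤
      2 * C ^ 2 / √(d.hi - d.lo) * ((x - d.lo) ^ (-d.nl) * (d.hi - x) ^ d.nr * √(d.hi - x)) ^ 2 := by
    have hs := Real.sqrt_pos.2 hD
    have h4 : √(d.hi - d.lo) - √(x - d.lo) ≤ (d.hi - x) / √(d.hi - d.lo) := by
      rw [le_div_iff₀ hs, sub_mul, Real.mul_self_sqrt hD.le]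
      have h5 : √(x - d.lo) * √(x - d.lo) ≤ √(x - d.lo) * √(d.hi - d.lo) :=
        mul_le_mul_of_nonneg_left (Real.sqrt_le_sqrt (left_le hx)) (Real.sqrt_nonneg _)
      rw [Real.mul_self_sqrt hl.le] at h5
      linarith
    calc _ ≤ c * (2 * ((d.hi - x) / √(d.hi - d.lo))) := by gcongr
      _ = _ := by rw [mul_pow, Real.sq_sqrt hr.le, hc]; ring
  calc _ ≤ √(2 * C ^ 2 / √(d.hi - d.lo) *
        ((x - d.lo) ^ (-d.nl) * (d.hi - x) ^ d.nr * √(d.hi - x)) ^ 2) :=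
        Real.sqrt_le_sqrt (h2.trans h3)
    _ = _ := by
        rw [Real.sqrt_mul (by positivity), Real.sqrt_sq (by positivity)]

/-- The moment `∫_lo^x E φ`. -/
def mI (d : SLData) (φ : ℝ → ℂ) (x : ℝ) : ℂ := ∫ t in d.lo..x, (d.E t : ℂ) * φ t

/-- The moment `∫_x^hi E V φ`. -/
def mJ (d : SLData) (φ : ℝ → ℂ) (x : ℝ) : ℂ := ∫ t in x..d.hi, ((d.E t * d.V t : ℝ) : ℂ) * φ t

theorem intervalIntegrable_mI (hφ : MemLp φ 2 (volume.restrict d.I)) {x : ℝ} (hx : x ∈ d.I) :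
    IntervalIntegrable (fun t => (d.E t : ℂ) * φ t) volume d.lo x := by
  obtain ⟨C, hC, h⟩ := d.exists_integral_E_sq_le
  have hsub : Ioo d.lo x ⊆ d.I := Ioo_subset_Ioo_right hx.2.le
  exact (integral_mul_le_N2 hx.1.le hsub (continuousOn_E.mono hsub) (h x hx).1 hφ).1

theorem intervalIntegrable_mJ (hφ : MemLp φ 2 (volume.restrict d.I)) {x : ℝ} (hx : x ∈ d.I) :
    IntervalIntegrable (fun t => ((d.E t * d.V t : ℝ) : ℂ) * φ t) volume x d.hi := by
  obtain ⟨C, hC, h⟩ := d.exists_integral_EV_sq_le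
  have hsub : Ioo x d.hi ⊆ d.I := Ioo_subset_Ioo_left hx.1.le
  exact (integral_mul_le_N2 hx.2.le hsub ((continuousOn_E.mul continuousOn_V).mono hsub)
    (h x hx).1 hφ).1

theorem exists_mI_le (d : SLData) : ∃ C, 0 < C ∧ ∀ φ, MemLp φ 2 (volume.restrict d.I) → ∀ x ∈ d.I,
    ‖d.mI φ x‖ ≤ C * ((x - d.lo) ^ d.nl * (d.hi - x) ^ (-d.nr) * √(x - d.lo)) * d.N2 φ := by
  obtain ⟨C, hC, h⟩ := d.exists_integral_E_sq_le
  refine ⟨C, hC, fun φ hφ x hx => ?_⟩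
  have hsub : Ioo d.lo x ⊆ d.I := Ioo_subset_Ioo_right hx.2.le
  exact (integral_mul_le_N2 hx.1.le hsub (continuousOn_E.mono hsub) (h x hx).1 hφ).2.trans
    (mul_le_mul_of_nonneg_right (h x hx).2 N2_nonneg)

theorem exists_mJ_le (d : SLData) : ∃ C, 0 < C ∧ ∀ φ, MemLp φ 2 (volume.restrict d.I) → ∀ x ∈ d.I,
    ‖d.mJ φ x‖ ≤ C * ((x - d.lo) ^ (-d.nl) * (d.hi - x) ^ d.nr * √(d.hi - x)) * d.N2 φ := by
  obtain ⟨C, hC, h⟩ := d.exists_integral_EV_sq_le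
  refine ⟨C, hC, fun φ hφ x hx => ?_⟩
  have hsub : Ioo x d.hi ⊆ d.I := Ioo_subset_Ioo_left hx.1.le
  exact (integral_mul_le_N2 hx.2.le hsub ((continuousOn_E.mul continuousOn_V).mono hsub)
    (h x hx).1 hφ).2.trans (mul_le_mul_of_nonneg_right (h x hx).2 N2_nonneg)

end SLData

/-! ### The Green operator: differential equation, bounds and symmetry. -/

namespace SLData

variable {d : SLData} {φ χ : ℝ → ℂ} {x : ℝ}

/-- The quotient by `E` of the solution. -/
def quo (d : SLData) (φ : ℝ → ℂ) (x : ℝ) : ℂ := (d.V x : ℂ) * d.mI φ x + d.mJ φ x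

/-- The solution `f` of `-(P E² (f/E)')' = E φ` that is regular at both end points. -/
def sol (d : SLData) (φ : ℝ → ℂ) (x : ℝ) : ℂ := (d.E x : ℂ) * d.quo φ x

theorem locAC_mI (hφ : MemLp φ 2 (volume.restrict d.I)) : LocAC d.lo d.hi (d.mI φ) :=
  LocAC.integral fun _ hx => intervalIntegrable_mI hφ hx

theorem mJ_eq (d : SLData) (φ : ℝ → ℂ) (x : ℝ) :
    d.mJ φ x = ∫ t in d.hi..x, -(((d.E t * d.V t : ℝ) : ℂ) * φ t) := by
  rw [mJ, intervalIntegral.integral_neg, intervalIntegral.integral_symm]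

theorem locAC_mJ (hφ : MemLp φ 2 (volume.restrict d.I)) : LocAC d.lo d.hi (d.mJ φ) :=
  (LocAC.integral fun _ hx => (intervalIntegrable_mJ hφ hx).symm.neg).congr fun x _ => mJ_eq d φ x

theorem ae_hasDerivAt_mI (hφ : MemLp φ 2 (volume.restrict d.I)) :
    ∀ᵐ x ∂(volume.restrict d.I), HasDerivAt (d.mI φ) ((d.E x : ℂ) * φ x) x :=
  ae_hasDerivAt_integral_Ioo fun _ hx => intervalIntegrable_mI hφ hx

theorem ae_hasDerivAt_mJ (hφ : MemLp φ 2 (volume.restrict d.I)) :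
    ∀ᵐ x ∂(volume.restrict d.I),
      HasDerivAt (d.mJ φ) (-(((d.E x * d.V x : ℝ) : ℂ) * φ x)) x := by
  have h := ae_hasDerivAt_integral_Ioo (φ := fun t => -(((d.E t * d.V t : ℝ) : ℂ) * φ t))
    fun x (hx : x ∈ Ioo d.lo d.hi) => (intervalIntegrable_mJ hφ hx).symm.neg
  have heq : d.mJ φ = fun x => ∫ t in d.hi..x, -(((d.E t * d.V t : ℝ) : ℂ) * φ t) :=
    funext fun x => mJ_eq d φ x
  rwa [← heq] at h

theorem locAC_V : LocAC d.lo d.hi fun x => (d.V x : ℂ) :=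
  LocAC.ofReal_of_hasDerivAt (fun _ hx => hasDerivAt_V hx) continuousOn_K.neg

theorem continuousOn_mI (hφ : MemLp φ 2 (volume.restrict d.I)) : ContinuousOn (d.mI φ) d.I :=
  (locAC_mI hφ).continuousOn

/-- In the derivative of `V mI + mJ` the terms `E V φ` cancel. What remains, `-K mI`, is continuous,
so the almost everywhere identity holds at every point. -/
theorem hasDerivAt_quo (hφ : MemLp φ 2 (volume.restrict d.I)) (hx : x ∈ d.I) :
    HasDerivAt (d.quo φ) (-((d.K x : ℂ) * d.mI φ x)) x := by
  refine LocAC.hasDerivAt_of_ae (α := d.lo) (β := d.hi) (F := d.quo φ)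
    (φ := fun x => -((d.K x : ℂ) * d.mI φ x))
    ((locAC_V.mul (locAC_mI hφ)).add (locAC_mJ hφ)) ?_ ?_ hx
  · exact ((Complex.continuous_ofReal.comp_continuousOn continuousOn_K).mul
      (continuousOn_mI hφ)).neg
  · filter_upwards [ae_hasDerivAt_mI hφ, ae_hasDerivAt_mJ hφ, ae_restrict_mem measurableSet_Ioo]
      with y h1 h2 hy
    refine (((hasDerivAt_V hy).ofReal_comp.mul h1).add h2).congr_deriv ?_
    push_cast
    ring

theorem E_mul_K (hx : x ∈ d.I) : d.E x * d.K x = 1 / (d.P x * d.E x) := by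
  have h1 := (P_pos hx).ne'
  have h2 := (E_pos hx).ne'
  rw [K]; field_simp

theorem hasDerivAt_sol (hφ : MemLp φ 2 (volume.restrict d.I)) (hx : x ∈ d.I) :
    HasDerivAt (d.sol φ)
      ((d.dE x : ℂ) * d.quo φ x - ((1 / (d.P x * d.E x) : ℝ) : ℂ) * d.mI φ x) x := by
  refine ((hasDerivAt_E hx).ofReal_comp.mul (hasDerivAt_quo hφ hx)).congr_deriv ?_
  rw [← E_mul_K hx]
  push_cast
  ring

theorem contDiffOn_E : ContDiffOn ℝ 1 d.E d.I :=
  contDiffOn_of_hasDerivAt (fun _ hx => hasDerivAt_E hx) continuousOn_dE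

theorem contDiffOn_E1 : ContDiffOn ℝ 1 d.E1 d.I :=
  contDiffOn_of_hasDerivAt (fun _ hx => hasDerivAt_E1 hx)
    (((continuousOn_E1.const_mul d.nl).div (by fun_prop) fun _ hy => (left_pos hy).ne').add
      ((continuousOn_E.const_mul _).div (by fun_prop) fun _ hy => (right_pos hy).ne'))

theorem contDiffOn_dE : ContDiffOn ℝ 1 d.dE d.I := by
  unfold dE
  exact ((contDiffOn_const.mul contDiffOn_E).div (by fun_prop) fun y hy => (left_pos hy).ne').add
    (contDiffOn_E1.div (by fun_prop) fun y hy => (right_pos hy).ne')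

theorem contDiff_P : ContDiff ℝ 1 d.P := by unfold P; fun_prop

theorem contDiffOn_PE_inv : ContDiffOn ℝ 1 (fun x => 1 / (d.P x * d.E x)) d.I :=
  contDiffOn_const.div (contDiff_P.contDiffOn.mul contDiffOn_E)
    fun _ hx => (mul_pos (P_pos hx) (E_pos hx)).ne'

theorem _root_.Ypq.LocAC.ofReal {α β : ℝ} {u : ℝ → ℝ} (hu : ContDiffOn ℝ 1 u (Ioo α β)) :
    LocAC α β fun x => (u x : ℂ) :=
  LocAC.of_contDiffOn (Complex.ofRealCLM.contDiff.comp_contDiffOn hu)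

theorem locAC_quo (hφ : MemLp φ 2 (volume.restrict d.I)) : LocAC d.lo d.hi (d.quo φ) :=
  (locAC_V.mul (locAC_mI hφ)).add (locAC_mJ hφ)

theorem isAC_sol (hφ : MemLp φ 2 (volume.restrict d.I)) : IsAC d.lo d.hi (d.sol φ) := by
  have h1 : LocAC d.lo d.hi fun x => (d.dE x : ℂ) * d.quo φ x -
      ((1 / (d.P x * d.E x) : ℝ) : ℂ) * d.mI φ x :=
    ((LocAC.ofReal contDiffOn_dE).mul (locAC_quo hφ)).sub
      ((LocAC.ofReal contDiffOn_PE_inv).mul (locAC_mI hφ))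
  refine ⟨contDiffOn_of_hasDerivAt (fun x hx => hasDerivAt_sol hφ hx) h1.continuousOn, ?_⟩
  exact h1.congr fun x hx => (hasDerivAt_sol hφ hx).deriv

/-- The flux is `P sol' = Q quo - mI / E`. Differentiating, the two terms with `mI` cancel because
`Q = P E'`, and `dQ quo` is `(dQ / E) sol`. -/
theorem ae_hasDerivAt_flux_sol (hφ : MemLp φ 2 (volume.restrict d.I)) :
    ∀ᵐ x ∂(volume.restrict d.I), HasDerivAt (fun x => (d.P x : ℂ) * deriv (d.sol φ) x)
      (((d.dQ x / d.E x : ℝ) : ℂ) * d.sol φ x - φ x) x := by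
  filter_upwards [ae_hasDerivAt_mI hφ, ae_restrict_mem measurableSet_Ioo] with x h1 hx
  have hE := (E_pos hx).ne'
  have hP := (P_pos hx).ne'
  have hEc : (d.E x : ℂ) ≠ 0 := Complex.ofReal_ne_zero.2 hE
  have hPc : (d.P x : ℂ) ≠ 0 := Complex.ofReal_ne_zero.2 hP
  have h2 : HasDerivAt (fun x => (d.Q x : ℂ) * d.quo φ x - d.mI φ x / (d.E x : ℂ))
      (((d.dQ x / d.E x : ℝ) : ℂ) * d.sol φ x - φ x) x := by
    refine (((hasDerivAt_Q hx).ofReal_comp.mul (hasDerivAt_quo hφ hx)).sub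
      (h1.div (hasDerivAt_E hx).ofReal_comp hEc)).congr_deriv ?_
    rw [← P_mul_dE hx, K, sol]
    push_cast
    field_simp
    ring
  refine h2.congr_of_eventuallyEq ?_
  filter_upwards [isOpen_Ioo.mem_nhds hx] with y hy
  have hE' := Complex.ofReal_ne_zero.2 (E_pos hy).ne'
  have hP' := Complex.ofReal_ne_zero.2 (P_pos hy).ne'
  rw [(hasDerivAt_sol hφ hy).deriv, ← P_mul_dE hy]
  push_cast
  field_simp

/-- The powers in the bounds for the solutions and for the moments cancel up to `X^(-1/4) √X =
X^(1/4)`, which is bounded. This uniform pointwise bound is what gives compactness of the Green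
operator. -/
theorem exists_sol_le (d : SLData) : ∃ C, 0 < C ∧ ∀ φ, MemLp φ 2 (volume.restrict d.I) →
    ∀ x ∈ d.I, ‖d.sol φ x‖ ≤ C * d.N2 φ := by
  obtain ⟨C₁, hC₁, hE⟩ := d.exists_E_le
  obtain ⟨C₂, hC₂, hEV⟩ := d.exists_E_mul_V_le
  obtain ⟨C₃, hC₃, hI⟩ := d.exists_mI_le
  obtain ⟨C₄, hC₄, hJ⟩ := d.exists_mJ_le
  have hD := d.len_pos
  have key : ∀ X : ℝ, 0 < X → X ≤ d.hi - d.lo →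
      X ^ (-(1 / 4) : ℝ) * √X ≤ (d.hi - d.lo) ^ (1 / 4 : ℝ) := by
    intro X hX hXD
    rw [Real.sqrt_eq_rpow, ← Real.rpow_add hX]
    norm_num
    gcongr
  set D4 := (d.hi - d.lo) ^ (1 / 4 : ℝ) with hD4
  have hD4' : 0 < D4 := Real.rpow_pos_of_pos hD _
  refine ⟨C₂ * C₃ * D4 + C₁ * C₄ * D4, by positivity, fun φ hφ x hx => ?_⟩
  have hl := left_pos hx
  have hr := right_pos hx
  have hN := N2_nonneg (d := d) (φ := φ)
  have e1 : (x - d.lo) ^ (-d.nl - 1 / 4) * (x - d.lo) ^ d.nl = (x - d.lo) ^ (-(1 / 4) : ℝ) := by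
    rw [← Real.rpow_add hl]; congr 1; ring
  have e2 : (d.hi - x) ^ d.nr * (d.hi - x) ^ (-d.nr) = 1 := by
    rw [← Real.rpow_add hr, add_neg_cancel, Real.rpow_zero]
  have e3 : (d.hi - x) ^ (-d.nr - 1 / 4) * (d.hi - x) ^ d.nr = (d.hi - x) ^ (-(1 / 4) : ℝ) := by
    rw [← Real.rpow_add hr]; congr 1; ring
  have e4 : (x - d.lo) ^ d.nl * (x - d.lo) ^ (-d.nl) = 1 := by
    rw [← Real.rpow_add hl, add_neg_cancel, Real.rpow_zero]
  have hE0 := (E_pos hx).le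
  have h1 : ‖((d.E x * d.V x : ℝ) : ℂ) * d.mI φ x‖ ≤ C₂ * C₃ * D4 * d.N2 φ := by
    rw [norm_mul, Complex.norm_real, Real.norm_of_nonneg (mul_nonneg hE0 (V_nonneg hx))]
    calc d.E x * d.V x * ‖d.mI φ x‖ ≤
          C₂ * ((x - d.lo) ^ (-d.nl - 1 / 4) * (d.hi - x) ^ d.nr) *
          (C₃ * ((x - d.lo) ^ d.nl * (d.hi - x) ^ (-d.nr) * √(x - d.lo)) * d.N2 φ) := by
          exact mul_le_mul (hEV x hx) (hI φ hφ x hx) (norm_nonneg _) (by positivity)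
      _ = C₂ * C₃ * (((x - d.lo) ^ (-d.nl - 1 / 4) * (x - d.lo) ^ d.nl) * √(x - d.lo)) *
          ((d.hi - x) ^ d.nr * (d.hi - x) ^ (-d.nr)) * d.N2 φ := by ring
      _ ≤ C₂ * C₃ * D4 * 1 * d.N2 φ := by
          rw [e1, e2]
          gcongr
          exact key _ hl (left_le hx)
      _ = _ := by ring
  have h2 : ‖(d.E x : ℂ) * d.mJ φ x‖ ≤ C₁ * C₄ * D4 * d.N2 φ := by
    rw [norm_mul, Complex.norm_real, Real.norm_of_nonneg hE0]
    calc d.E x * ‖d.mJ φ x‖ ≤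
          C₁ * ((x - d.lo) ^ d.nl * (d.hi - x) ^ (-d.nr - 1 / 4)) *
          (C₄ * ((x - d.lo) ^ (-d.nl) * (d.hi - x) ^ d.nr * √(d.hi - x)) * d.N2 φ) := by
          gcongr
          · exact hE x hx
          · exact hJ φ hφ x hx
      _ = C₁ * C₄ * (((d.hi - x) ^ (-d.nr - 1 / 4) * (d.hi - x) ^ d.nr) * √(d.hi - x)) *
          ((x - d.lo) ^ d.nl * (x - d.lo) ^ (-d.nl)) * d.N2 φ := by ring
      _ ≤ C₁ * C₄ * D4 * 1 * d.N2 φ := by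
          rw [e3, e4]
          gcongr
          exact key _ hr (right_le hx)
      _ = _ := by ring
  have h3 : d.sol φ x = ((d.E x * d.V x : ℝ) : ℂ) * d.mI φ x + (d.E x : ℂ) * d.mJ φ x := by
    rw [sol, quo]; push_cast; ring
  rw [h3]
  refine (norm_add_le _ _).trans ((add_le_add h1 h2).trans_eq (by ring))

theorem continuousOn_sol (hφ : MemLp φ 2 (volume.restrict d.I)) : ContinuousOn (d.sol φ) d.I :=
  fun _ hx => (hasDerivAt_sol hφ hx).continuousAt.continuousWithinAt

theorem memLp_sol (hφ : MemLp φ 2 (volume.restrict d.I)) :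
    MemLp (d.sol φ) 2 (volume.restrict d.I) := by
  obtain ⟨C, hC, h⟩ := d.exists_sol_le
  refine MemLp.of_bound ((continuousOn_sol hφ).aestronglyMeasurable measurableSet_Ioo)
    (C * d.N2 φ) ?_
  filter_upwards [ae_restrict_mem measurableSet_Ioo] with x hx using h φ hφ x hx

/-- All powers cancel in the product and only the two square roots survive, so the boundary terms in
the symmetry proof vanish. -/
theorem exists_mI_mul_mJ_le (d : SLData) : ∃ C, 0 < C ∧ ∀ φ χ, MemLp φ 2 (volume.restrict d.I) →
    MemLp χ 2 (volume.restrict d.I) → ∀ x ∈ d.I,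
    ‖d.mI φ x * d.mJ χ x‖ ≤ C * (√(x - d.lo) * √(d.hi - x)) * (d.N2 φ * d.N2 χ) := by
  obtain ⟨C₃, hC₃, hI⟩ := d.exists_mI_le
  obtain ⟨C₄, hC₄, hJ⟩ := d.exists_mJ_le
  refine ⟨C₃ * C₄, by positivity, fun φ χ hφ hχ x hx => ?_⟩
  have hl := left_pos hx
  have hr := right_pos hx
  have hN := N2_nonneg (d := d) (φ := φ)
  have hN' := N2_nonneg (d := d) (φ := χ)
  have e2 : (d.hi - x) ^ d.nr * (d.hi - x) ^ (-d.nr) = 1 := by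
    rw [← Real.rpow_add hr, add_neg_cancel, Real.rpow_zero]
  have e4 : (x - d.lo) ^ d.nl * (x - d.lo) ^ (-d.nl) = 1 := by
    rw [← Real.rpow_add hl, add_neg_cancel, Real.rpow_zero]
  rw [norm_mul]
  calc _ ≤ C₃ * ((x - d.lo) ^ d.nl * (d.hi - x) ^ (-d.nr) * √(x - d.lo)) * d.N2 φ *
      (C₄ * ((x - d.lo) ^ (-d.nl) * (d.hi - x) ^ d.nr * √(d.hi - x)) * d.N2 χ) := by
        gcongr
        · exact hI φ hφ x hx
        · exact hJ χ hχ x hx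
    _ = C₃ * C₄ * (√(x - d.lo) * √(d.hi - x)) * ((x - d.lo) ^ d.nl * (x - d.lo) ^ (-d.nl)) *
      ((d.hi - x) ^ d.nr * (d.hi - x) ^ (-d.nr)) * (d.N2 φ * d.N2 χ) := by ring
    _ = _ := by rw [e2, e4]; ring

theorem tendsto_mI_mul_mJ (hφ : MemLp φ 2 (volume.restrict d.I))
    (hχ : MemLp χ 2 (volume.restrict d.I)) :
    Tendsto (fun x => d.mI φ x * d.mJ χ x) (𝓝[>] d.lo) (𝓝 0) ∧
      Tendsto (fun x => d.mI φ x * d.mJ χ x) (𝓝[<] d.hi) (𝓝 0) := by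
  obtain ⟨C, hC, h⟩ := d.exists_mI_mul_mJ_le
  have hcont : Continuous fun x : ℝ => C * (√(x - d.lo) * √(d.hi - x)) * (d.N2 φ * d.N2 χ) := by
    fun_prop
  constructor
  · refine squeeze_zero_norm' (a := fun x => C * (√(x - d.lo) * √(d.hi - x)) *
      (d.N2 φ * d.N2 χ)) ?_ ?_
    · filter_upwards [Ioo_mem_nhdsGT d.lo_lt_hi] with x hx using h φ χ hφ hχ x hx
    · have := hcont.tendsto d.lo
      simp only [sub_self, Real.sqrt_zero, zero_mul, mul_zero] at this
      exact this.mono_left nhdsWithin_le_nhds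
  · refine squeeze_zero_norm' (a := fun x => C * (√(x - d.lo) * √(d.hi - x)) *
      (d.N2 φ * d.N2 χ)) ?_ ?_
    · filter_upwards [Ioo_mem_nhdsLT d.lo_lt_hi] with x hx using h φ χ hφ hχ x hx
    · have := hcont.tendsto d.hi
      simp only [sub_self, Real.sqrt_zero, zero_mul, mul_zero] at this
      exact this.mono_left nhdsWithin_le_nhds

theorem intervalIntegrable_mul (hφ : MemLp φ 2 (volume.restrict d.I))
    (hχ : MemLp χ 2 (volume.restrict d.I)) :
    IntervalIntegrable (fun x => φ x * χ x) volume d.lo d.hi :=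
  (intervalIntegrable_iff_integrableOn_Ioo_of_le d.lo_lt_hi.le).2 (MemLp.integrable_mul hφ hχ)

/-- The solution operator is symmetric. -/
theorem integral_sol_mul (hφ : MemLp φ 2 (volume.restrict d.I))
    (hχ : MemLp χ 2 (volume.restrict d.I)) :
    ∫ x in d.lo..d.hi, d.sol φ x * χ x = ∫ x in d.lo..d.hi, φ x * d.sol χ x := by
  have h1 := intervalIntegrable_mul (memLp_sol hφ) hχ
  have h2 := intervalIntegrable_mul hφ (memLp_sol hχ)
  rw [← sub_eq_zero, ← intervalIntegral.integral_sub h1 h2]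
  -- This is an antiderivative of `sol φ χ - φ sol χ` that tends to zero at both ends.
  have hF : LocAC d.lo d.hi fun x => d.mI χ x * d.mJ φ x - d.mI φ x * d.mJ χ x :=
    ((locAC_mI hχ).mul (locAC_mJ hφ)).sub ((locAC_mI hφ).mul (locAC_mJ hχ))
  obtain ⟨t1, t2⟩ := tendsto_mI_mul_mJ hχ hφ
  obtain ⟨t3, t4⟩ := tendsto_mI_mul_mJ hφ hχ
  rw [hF.integral_eq_sub (A := 0 - 0) (B := 0 - 0) d.lo_lt_hi (h1.sub h2) ?_ (t1.sub t3)
    (t2.sub t4)]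
  · ring
  · filter_upwards [ae_hasDerivAt_mI hφ, ae_hasDerivAt_mJ hφ, ae_hasDerivAt_mI hχ,
      ae_hasDerivAt_mJ hχ] with x g1 g2 g3 g4
    refine ((g3.mul g2).sub (g1.mul g4)).congr_deriv ?_
    rw [sol, sol, quo, quo]
    push_cast
    ring

end SLData

/-! ### Boundary behaviour of the Green solutions. -/

namespace SLData

variable {d : SLData} {φ χ : ℝ → ℂ} {x : ℝ}

theorem eventually_left : ∀ᶠ x in 𝓝[>] d.lo, x ∈ d.I := Ioo_mem_nhdsGT d.lo_lt_hi

theorem eventually_right : ∀ᶠ x in 𝓝[<] d.hi, x ∈ d.I := Ioo_mem_nhdsLT d.lo_lt_hi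

theorem tendsto_sub_lo : Tendsto (fun x => x - d.lo) (𝓝[>] d.lo) (𝓝 0) := by
  have : Tendsto (fun x => x - d.lo) (𝓝 d.lo) (𝓝 (d.lo - d.lo)) :=
    Continuous.tendsto (by fun_prop) _
  rw [sub_self] at this
  exact this.mono_left nhdsWithin_le_nhds

theorem tendsto_hi_sub : Tendsto (fun x => d.hi - x) (𝓝[<] d.hi) (𝓝 0) := by
  have : Tendsto (fun x => d.hi - x) (𝓝 d.hi) (𝓝 (d.hi - d.hi)) :=
    Continuous.tendsto (by fun_prop) _
  rw [sub_self] at this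
  exact this.mono_left nhdsWithin_le_nhds

theorem tendsto_hi_sub_pos : Tendsto (fun x => d.hi - x) (𝓝[<] d.hi) (𝓝[>] 0) :=
  tendsto_nhdsWithin_iff.2 ⟨tendsto_hi_sub, by
    filter_upwards [self_mem_nhdsWithin] with x hx using mem_Ioi.2 (sub_pos.2 hx)⟩

theorem tendsto_left_of_continuousAt {u : ℝ → ℝ} {z : ℝ} (hu : ContinuousAt u z) :
    Tendsto u (𝓝[>] z) (𝓝 (u z)) := hu.tendsto.mono_left nhdsWithin_le_nhds

theorem tendsto_right_of_continuousAt {u : ℝ → ℝ} {z : ℝ} (hu : ContinuousAt u z) :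
    Tendsto u (𝓝[<] z) (𝓝 (u z)) := hu.tendsto.mono_left nhdsWithin_le_nhds

theorem continuousAt_phi_lo : ContinuousAt (fun x => d.phi (d.hi - x)) d.lo :=
  ((d.hasDerivAt_phi d.len_pos).comp d.lo ((hasDerivAt_id d.lo).const_sub d.hi)).continuousAt

theorem continuousAt_rpow_hi : ContinuousAt (fun x => (x - d.lo) ^ d.nl) d.hi :=
  (by fun_prop : ContinuousAt (fun x => x - d.lo) d.hi).rpow_const (Or.inl d.len_pos.ne')

theorem tendsto_E_left (h : d.nl = 0) : Tendsto d.E (𝓝[>] d.lo) (𝓝 (d.phi (d.hi - d.lo))) := by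
  refine (tendsto_left_of_continuousAt d.continuousAt_phi_lo).congr fun x => ?_
  rw [E, h, Real.rpow_zero, one_mul]

theorem tendsto_phi (h : d.nr = 0) : Tendsto d.phi (𝓝[>] 0) atTop := by
  have h1 : Tendsto (fun X => (d.hi - d.lo) / X) (𝓝[>] (0 : ℝ)) atTop :=
    Tendsto.const_mul_atTop d.len_pos tendsto_inv_nhdsGT_zero
  have h2 := tendsto_atTop_add_const_left _ (1 : ℝ) (Real.tendsto_log_atTop.comp h1)
  refine h2.congr fun X => ?_
  simp [phi, h]

theorem tendsto_E_right (h : d.nr = 0) : Tendsto d.E (𝓝[<] d.hi) atTop :=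
  (tendsto_right_of_continuousAt d.continuousAt_rpow_hi).pos_mul_atTop
    (Real.rpow_pos_of_pos d.len_pos _) ((tendsto_phi h).comp tendsto_hi_sub_pos)

theorem tendsto_left_div_P : Tendsto (fun x => (x - d.lo) / d.P x) (𝓝[>] d.lo)
    (𝓝 (9 / (2 * ((d.hi - d.lo) * (d.y3 - d.lo))))) := by
  have h3 : 0 < d.y3 - d.lo := by linarith [d.lo_lt_hi, d.hi_lt_y3]
  have h1 : ContinuousAt (fun x => 9 / (2 * ((d.hi - x) * (d.y3 - x)))) d.lo :=
    ContinuousAt.div (by fun_prop) (by fun_prop) (by have := d.len_pos; positivity)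
  refine (tendsto_left_of_continuousAt h1).congr' ?_
  filter_upwards [d.eventually_left] with x hx
  have := left_pos hx
  have := right_pos hx
  have : d.y3 - x ≠ 0 := by linarith [hx.2, d.hi_lt_y3]
  rw [P]
  field_simp

theorem tendsto_right_div_P : Tendsto (fun x => (d.hi - x) / d.P x) (𝓝[<] d.hi)
    (𝓝 (9 / (2 * ((d.hi - d.lo) * (d.y3 - d.hi))))) := by
  have h3 : 0 < d.y3 - d.hi := by linarith [d.lo_lt_hi, d.hi_lt_y3]
  have h1 : ContinuousAt (fun x => 9 / (2 * ((x - d.lo) * (d.y3 - x)))) d.hi :=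
    ContinuousAt.div (by fun_prop) (by fun_prop) (by have := d.len_pos; positivity)
  refine (tendsto_right_of_continuousAt h1).congr' ?_
  filter_upwards [d.eventually_right] with x hx
  have := left_pos hx
  have := right_pos hx
  have : d.y3 - x ≠ 0 := by linarith [hx.2, d.hi_lt_y3]
  rw [P]
  field_simp

theorem tendsto_mI_left (hφ : MemLp φ 2 (volume.restrict d.I)) :
    Tendsto (d.mI φ) (𝓝[>] d.lo) (𝓝 0) := by
  obtain ⟨C, hC, h⟩ := d.exists_mI_le
  have h1 : ContinuousAt (fun x => C * ((x - d.lo) ^ d.nl * (d.hi - x) ^ (-d.nr) * √(x - d.lo)) *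
      d.N2 φ) d.lo := by
    have g1 : ContinuousAt (fun x => (x - d.lo) ^ d.nl) d.lo :=
      (by fun_prop : ContinuousAt (fun x => x - d.lo) d.lo).rpow_const (Or.inr d.nl_nonneg)
    have g2 : ContinuousAt (fun x => (d.hi - x) ^ (-d.nr)) d.lo :=
      (by fun_prop : ContinuousAt (fun x => d.hi - x) d.lo).rpow_const (Or.inl d.len_pos.ne')
    fun_prop
  have h2 := tendsto_left_of_continuousAt h1
  simp only [sub_self, Real.sqrt_zero, mul_zero, zero_mul] at h2
  refine squeeze_zero_norm' ?_ h2
  filter_upwards [d.eventually_left] with x hx using h φ hφ x hx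

/-- For exponent zero `E'` has no pole at `lo`, so its contribution is `x - lo` times a bounded
function. In the other term `(x - lo) / P` and `1 / E` converge while `mI` tends to zero. -/
theorem tendsto_sub_lo_mul_deriv_sol (h : d.nl = 0) (hφ : MemLp φ 2 (volume.restrict d.I)) :
    Tendsto (fun x => ((x - d.lo : ℝ) : ℂ) * deriv (d.sol φ) x) (𝓝[>] d.lo) (𝓝 0) := by
  obtain ⟨C, hC, hb⟩ := d.exists_sol_le
  have hp := d.phi_pos d.len_pos le_rfl
  have h1 : Tendsto (fun x => (x - d.lo) * ((d.nr + 1) / (d.hi - x) * (C * d.N2 φ))) (𝓝[>] d.lo)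
      (𝓝 (0 * ((d.nr + 1) / (d.hi - d.lo) * (C * d.N2 φ)))) := by
    refine tendsto_sub_lo.mul (tendsto_left_of_continuousAt ?_)
    have : ContinuousAt (fun x => (d.nr + 1) / (d.hi - x)) d.lo :=
      ContinuousAt.div (by fun_prop) (by fun_prop) d.len_pos.ne'
    fun_prop
  have h2 : Tendsto (fun x => (x - d.lo) / d.P x * (d.E x)⁻¹ * ‖d.mI φ x‖) (𝓝[>] d.lo)
      (𝓝 (9 / (2 * ((d.hi - d.lo) * (d.y3 - d.lo))) * (d.phi (d.hi - d.lo))⁻¹ * ‖(0 : ℂ)‖)) :=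
    (tendsto_left_div_P.mul ((tendsto_E_left h).inv₀ hp.ne')).mul (tendsto_mI_left hφ).norm
  have h3 := h1.add h2
  rw [norm_zero, mul_zero, zero_mul, add_zero] at h3
  refine squeeze_zero_norm' ?_ h3
  filter_upwards [d.eventually_left] with x hx
  have hE := E_pos hx
  have hl := left_pos hx
  have hr := right_pos hx
  have hP := P_pos hx
  have hE1 := E1_nonneg hx
  have e1 : ((x - d.lo : ℝ) : ℂ) * deriv (d.sol φ) x =
      (((x - d.lo) * (d.E1 x / d.E x / (d.hi - x)) : ℝ) : ℂ) * d.sol φ x -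
      (((x - d.lo) / d.P x * (d.E x)⁻¹ : ℝ) : ℂ) * d.mI φ x := by
    have hEc := Complex.ofReal_ne_zero.2 hE.ne'
    rw [(hasDerivAt_sol hφ hx).deriv, sol, dE, h]
    push_cast
    field_simp
    ring
  rw [e1]
  refine (norm_sub_le _ _).trans (add_le_add ?_ ?_)
  · rw [norm_mul, Complex.norm_real, Real.norm_of_nonneg (by positivity), mul_assoc]
    have : d.E1 x / d.E x ≤ d.nr + 1 := (div_le_iff₀ hE).2 (E1_le hx)
    have hn := d.nr_nonneg
    have h0 : 0 ≤ (d.nr + 1) / (d.hi - x) := by positivity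
    gcongr
    exact hb φ hφ x hx
  · rw [norm_mul, Complex.norm_real, Real.norm_of_nonneg (by positivity)]

/-- The moment `mI` need not vanish at `hi`; the logarithmic growth of `E` supplies the small factor
`1 / E` instead. -/
theorem tendsto_sub_hi_mul_deriv_sol (h : d.nr = 0) (hφ : MemLp φ 2 (volume.restrict d.I)) :
    Tendsto (fun x => ((x - d.hi : ℝ) : ℂ) * deriv (d.sol φ) x) (𝓝[<] d.hi) (𝓝 0) := by
  obtain ⟨C, hC, hb⟩ := d.exists_sol_le
  obtain ⟨C', hC', hm⟩ := d.exists_mI_le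
  have hN := N2_nonneg (d := d) (φ := φ)
  have h0 := tendsto_right_of_continuousAt d.continuousAt_rpow_hi
  have hinv : Tendsto (fun x => (d.E x)⁻¹) (𝓝[<] d.hi) (𝓝 0) :=
    tendsto_inv_atTop_zero.comp (tendsto_E_right h)
  have h1 : Tendsto (fun x => ((d.hi - x) * (d.nl / (x - d.lo)) + (x - d.lo) ^ d.nl * (d.E x)⁻¹) *
      (C * d.N2 φ)) (𝓝[<] d.hi) (𝓝 ((0 * (d.nl / (d.hi - d.lo)) + (d.hi - d.lo) ^ d.nl * 0) *
        (C * d.N2 φ))) := by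
    refine ((tendsto_hi_sub.mul (tendsto_right_of_continuousAt ?_)).add (h0.mul hinv)).mul_const _
    exact ContinuousAt.div (by fun_prop) (by fun_prop) d.len_pos.ne'
  have h2 : Tendsto (fun x => (d.hi - x) / d.P x * (d.E x)⁻¹ *
      (C' * ((x - d.lo) ^ d.nl * √(x - d.lo)) * d.N2 φ)) (𝓝[<] d.hi)
      (𝓝 (9 / (2 * ((d.hi - d.lo) * (d.y3 - d.hi))) * 0 *
        (C' * ((d.hi - d.lo) ^ d.nl * √(d.hi - d.lo)) * d.N2 φ))) := by
    refine (tendsto_right_div_P.mul hinv).mul (tendsto_right_of_continuousAt ?_)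
    have := d.continuousAt_rpow_hi
    fun_prop
  have h3 := h1.add h2
  simp only [zero_mul, mul_zero, add_zero] at h3
  refine squeeze_zero_norm' ?_ h3
  filter_upwards [d.eventually_right] with x hx
  have hE := E_pos hx
  have hl := left_pos hx
  have hr := right_pos hx
  have hP := P_pos hx
  have hE1 : d.E1 x = (x - d.lo) ^ d.nl := by simp [E1, phi1, h]
  have hn := d.nl_nonneg
  have e1 : ((x - d.hi : ℝ) : ℂ) * deriv (d.sol φ) x =
      -(((((d.hi - x) * (d.nl / (x - d.lo)) + (x - d.lo) ^ d.nl * (d.E x)⁻¹) : ℝ) : ℂ) *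
        d.sol φ x) + (((d.hi - x) / d.P x * (d.E x)⁻¹ : ℝ) : ℂ) * d.mI φ x := by
    have hEc := Complex.ofReal_ne_zero.2 hE.ne'
    have hlc := Complex.ofReal_ne_zero.2 hl.ne'
    have hrc := Complex.ofReal_ne_zero.2 hr.ne'
    have hPc := Complex.ofReal_ne_zero.2 hP.ne'
    rw [(hasDerivAt_sol hφ hx).deriv, sol, dE, hE1, show x - d.hi = -(d.hi - x) by ring]
    push_cast at hlc hrc ⊢
    field_simp
    ring
  rw [e1]
  refine (norm_add_le _ _).trans (add_le_add ?_ ?_)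
  · rw [norm_neg, norm_mul, Complex.norm_real, Real.norm_of_nonneg (by positivity)]
    gcongr
    exact hb φ hφ x hx
  · rw [norm_mul, Complex.norm_real, Real.norm_of_nonneg (by positivity)]
    gcongr
    have := hm φ hφ x hx
    rwa [h, neg_zero, Real.rpow_zero, mul_one] at this

/-- A function that is at least of the order of the inverse square root of the distance to the
left end point is not square integrable. -/
theorem not_memLp_of_left {k : ℝ → ℂ} {c : ℝ} (hc : 0 < c)
    (hk : ∀ᶠ x in 𝓝[>] d.lo, c ≤ (x - d.lo) * ‖k x‖ ^ 2) :
    ¬ MemLp k 2 (volume.restrict d.I) := by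
  intro hm
  obtain ⟨u, hu, hsub⟩ := mem_nhdsGT_iff_exists_Ioo_subset.1 (hk.and d.eventually_left)
  have hu' : d.lo < u := hu
  have h1 : IntegrableOn (fun x => ‖k x‖ ^ 2) (Ioo d.lo u) :=
    IntegrableOn.mono_set (hm.integrable_norm_pow two_ne_zero) fun x hx => (hsub hx).2
  have h2 : IntegrableOn (fun x => (x - d.lo)⁻¹) (Ioo d.lo u) := by
    refine (h1.const_mul c⁻¹).mono' (by fun_prop) ?_
    filter_upwards [ae_restrict_mem measurableSet_Ioo] with x hx
    have hx' := sub_pos.2 hx.1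
    have := (hsub hx).1
    rw [Real.norm_of_nonneg (by positivity), inv_mul_eq_div, inv_eq_one_div, div_le_div_iff₀ hx' hc]
    linarith
  have h3 := (intervalIntegrable_iff_integrableOn_Ioo_of_le hu'.le).2 h2
  rw [intervalIntegrable_sub_inv_iff] at h3
  rcases h3 with h | h
  · exact hu'.ne h
  · exact h left_mem_uIcc

theorem not_memLp_of_right {k : ℝ → ℂ} {c : ℝ} (hc : 0 < c)
    (hk : ∀ᶠ x in 𝓝[<] d.hi, c ≤ (d.hi - x) * ‖k x‖ ^ 2) :
    ¬ MemLp k 2 (volume.restrict d.I) := by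
  intro hm
  obtain ⟨u, hu, hsub⟩ := mem_nhdsLT_iff_exists_Ioo_subset.1 (hk.and d.eventually_right)
  have hu' : u < d.hi := hu
  have h1 : IntegrableOn (fun x => ‖k x‖ ^ 2) (Ioo u d.hi) :=
    IntegrableOn.mono_set (hm.integrable_norm_pow two_ne_zero) fun x hx => (hsub hx).2
  have h2 : IntegrableOn (fun x => (x - d.hi)⁻¹) (Ioo u d.hi) := by
    refine (h1.const_mul c⁻¹).mono' (by fun_prop) ?_
    filter_upwards [ae_restrict_mem measurableSet_Ioo] with x hx
    have hx' := sub_pos.2 hx.2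
    have := (hsub hx).1
    rw [show x - d.hi = -(d.hi - x) by ring, inv_neg, norm_neg,
      Real.norm_of_nonneg (by positivity), inv_mul_eq_div, inv_eq_one_div, div_le_div_iff₀ hx' hc]
    linarith
  have h3 := (intervalIntegrable_iff_integrableOn_Ioo_of_le hu'.le).2 h2
  rw [intervalIntegrable_sub_inv_iff] at h3
  rcases h3 with h | h
  · exact hu'.ne h
  · exact h right_mem_uIcc

end SLData

/-! ### Homogeneous solutions and uniqueness of the boundary value problem. -/

namespace SLData

variable {d : SLData} {φ χ : ℝ → ℂ} {x : ℝ}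

theorem _root_.Ypq.IsAC.hasDerivAt {α β : ℝ} {f : ℝ → ℂ} (hf : IsAC α β f) {x : ℝ}
    (hx : x ∈ Ioo α β) : HasDerivAt f (deriv f x) x :=
  ((hf.1.differentiableOn one_ne_zero).differentiableAt (isOpen_Ioo.mem_nhds hx)).hasDerivAt

theorem _root_.Ypq.IsAC.locAC {α β : ℝ} {f : ℝ → ℂ} (hf : IsAC α β f) : LocAC α β f :=
  LocAC.of_contDiffOn hf.1

theorem _root_.Ypq.IsAC.locAC_deriv {α β : ℝ} {f : ℝ → ℂ} (hf : IsAC α β f) :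
    LocAC α β (deriv f) := hf.2

theorem _root_.Ypq.IsAC.sub {α β : ℝ} {f g : ℝ → ℂ} (hf : IsAC α β f) (hg : IsAC α β g) :
    IsAC α β fun x => f x - g x :=
  ⟨hf.1.sub hg.1, (hf.locAC_deriv.sub hg.locAC_deriv).congr fun _ hx =>
    ((hf.hasDerivAt hx).sub (hg.hasDerivAt hx)).deriv⟩

/-- Solutions of the homogeneous equation are combinations of `E` and `E V`. -/
theorem exists_eq_of_flux {k : ℝ → ℂ} (hk : IsAC d.lo d.hi k)
    (h : ∀ᵐ x ∂(volume.restrict d.I), HasDerivAt (fun x => (d.P x : ℂ) * deriv k x)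
      (((d.dQ x / d.E x : ℝ) : ℂ) * k x) x) :
    ∃ e c : ℂ, ∀ x ∈ d.I, k x = (d.E x : ℂ) * (e - c * d.V x) := by
  -- The Wronskian of `k` and `E`, multiplied by `P`, is a constant `c`; hence `(k / E)' = c K = -c
  -- V'`.
  have hJ : LocAC d.lo d.hi fun x => (d.P x : ℂ) * deriv k x * d.E x - k x * d.Q x :=
    (((LocAC.ofReal contDiff_P.contDiffOn).mul hk.locAC_deriv).mul
      (LocAC.ofReal contDiffOn_E)).sub (hk.locAC.mul
        (LocAC.ofReal_of_hasDerivAt (fun _ hx => hasDerivAt_Q hx) continuousOn_dQ))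
  obtain ⟨c, hc⟩ := hJ.eq_const (by
    filter_upwards [h, ae_restrict_mem measurableSet_Ioo] with x h1 hx
    refine ((h1.mul (hasDerivAt_E hx).ofReal_comp).sub
      ((hk.hasDerivAt hx).mul (hasDerivAt_Q hx).ofReal_comp)).congr_deriv ?_
    have := Complex.ofReal_ne_zero.2 (E_pos hx).ne'
    rw [← P_mul_dE hx]
    push_cast
    field_simp
    ring)
  have hq : ∀ x ∈ d.I, HasDerivAt (fun x => k x / (d.E x : ℂ) + c * d.V x) 0 x := by
    intro x hx
    have hE := Complex.ofReal_ne_zero.2 (E_pos hx).ne'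
    have hP := Complex.ofReal_ne_zero.2 (P_pos hx).ne'
    refine (((hk.hasDerivAt hx).div (hasDerivAt_E hx).ofReal_comp hE).add
      ((hasDerivAt_V hx).ofReal_comp.const_mul c)).congr_deriv ?_
    rw [← hc x hx, ← P_mul_dE hx, K]
    push_cast
    field_simp
    ring
  obtain ⟨e, he⟩ := (LocAC.of_hasDerivAt hq continuousOn_const).eq_const (by
    filter_upwards [ae_restrict_mem measurableSet_Ioo] with x hx using hq x hx)
  refine ⟨e, c, fun x hx => ?_⟩
  have hE := Complex.ofReal_ne_zero.2 (E_pos hx).ne'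
  rw [← he x hx]
  field_simp
  ring

theorem tendsto_sqrt_mul_E_left (h : 0 < d.nl) :
    Tendsto (fun x => √(x - d.lo) * d.E x) (𝓝[>] d.lo) (𝓝 0) := by
  have h1 : ContinuousAt (fun x => √(x - d.lo) * ((x - d.lo) ^ d.nl * d.phi (d.hi - x))) d.lo := by
    have g1 : ContinuousAt (fun x => (x - d.lo) ^ d.nl) d.lo :=
      (by fun_prop : ContinuousAt (fun x => x - d.lo) d.lo).rpow_const (Or.inr h.le)
    have g2 := d.continuousAt_phi_lo
    fun_prop
  have := tendsto_left_of_continuousAt h1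
  rwa [sub_self, Real.sqrt_zero, zero_mul] at this

/-- On the left half, `φ(hi - y)` is at most its value at the midpoint, so `K` is at least a
multiple of `(y - lo)^(-2 nl - 1)`. Subtracting the corresponding primitive from `V` leaves a
decreasing function. -/
theorem exists_rpow_le_V (h : 0 < d.nl) : ∃ c M, 0 < c ∧ ∀ᶠ x in 𝓝[>] d.lo,
    c * ((x - d.lo) ^ (-(2 * d.nl)) - M) ≤ d.V x := by
  have hD := d.len_pos
  set z := (d.lo + d.hi) / 2 with hz
  have hzl : d.lo < z := by linarith
  have hzh : z < d.hi := by linarith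
  have hsub : Ioc d.lo z ⊆ d.I := fun y hy => ⟨hy.1, hy.2.trans_lt hzh⟩
  have hzI : z ∈ d.I := ⟨hzl, hzh⟩
  have hy3 : 0 < d.y3 - d.lo := by linarith [d.hi_lt_y3]
  set B := d.phi (d.hi - z) with hB
  have hBpos : 0 < B := d.phi_pos (right_pos hzI) (right_le hzI)
  set A := 2 / 9 * ((d.hi - d.lo) * (d.y3 - d.lo)) with hA
  have hApos : 0 < A := by positivity
  have hK : ∀ y ∈ Ioc d.lo z, 1 / (A * B ^ 2) * (y - d.lo) ^ (-(2 * d.nl) - 1) ≤ d.K y := by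
    intro y hy
    have hyI := hsub hy
    have h1 := left_pos hyI
    have h2 := right_pos hyI
    have e1 : (y - d.lo) ^ (-(2 * d.nl) - 1) = 1 / ((y - d.lo) * ((y - d.lo) ^ d.nl) ^ 2) := by
      rw [show -(2 * d.nl) - 1 = -(1 + (d.nl + d.nl)) by ring, Real.rpow_neg h1.le,
        Real.rpow_add h1, Real.rpow_add h1, Real.rpow_one, one_div]
      ring
    have hp := d.phi_pos h2 (right_le hyI)
    have hr := Real.rpow_pos_of_pos h1 d.nl
    have hP := P_pos hyI
    have hE := E_pos hyI
    have hPle : d.P y ≤ A * (y - d.lo) := by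
      rw [P, hA]
      have g1 : d.hi - y ≤ d.hi - d.lo := by linarith
      have g2 : d.y3 - y ≤ d.y3 - d.lo := by linarith
      have g3 : 0 ≤ d.y3 - y := by linarith [d.hi_lt_y3]
      calc 2 / 9 * ((y - d.lo) * (d.hi - y) * (d.y3 - y)) ≤
          2 / 9 * ((y - d.lo) * (d.hi - d.lo) * (d.y3 - d.lo)) := by gcongr
        _ = _ := by ring
    have hEle : d.E y ≤ (y - d.lo) ^ d.nl * B :=
      mul_le_mul_of_nonneg_left (d.phi_anti (right_pos hzI) (by linarith [hy.2])) hr.le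
    rw [e1, K, div_mul_div_comm, one_mul]
    refine one_div_le_one_div_of_le (by positivity) ?_
    calc d.P y * d.E y ^ 2 ≤ A * (y - d.lo) * ((y - d.lo) ^ d.nl * B) ^ 2 := by gcongr
      _ = _ := by ring
  set c₁ := 1 / (A * B ^ 2) / (2 * d.nl) with hc₁
  have hanti : AntitoneOn (fun y => d.V y - c₁ * (y - d.lo) ^ (-(2 * d.nl))) (Ioc d.lo z) := by
    have hder : ∀ y ∈ Ioc d.lo z, HasDerivAt (fun y => d.V y - c₁ * (y - d.lo) ^ (-(2 * d.nl)))
        (-d.K y + 1 / (A * B ^ 2) * (y - d.lo) ^ (-(2 * d.nl) - 1)) y := by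
      intro y hy
      have g := ((Real.hasDerivAt_rpow_const (p := -(2 * d.nl))
        (Or.inl (left_pos (hsub hy)).ne')).comp y ((hasDerivAt_id y).sub_const d.lo)).const_mul c₁
      refine ((hasDerivAt_V (hsub hy)).sub g).congr_deriv ?_
      rw [hc₁]
      field_simp
      ring
    refine antitoneOn_of_deriv_nonpos (convex_Ioc _ _)
      (fun y hy => (hder y hy).continuousAt.continuousWithinAt)
      (fun y hy => (hder y (interior_subset hy)).differentiableAt.differentiableWithinAt)
      fun y hy => ?_
    rw [(hder y (interior_subset hy)).deriv]
    linarith [hK y (interior_subset hy)]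
  refine ⟨c₁, (z - d.lo) ^ (-(2 * d.nl)), by positivity, ?_⟩
  filter_upwards [Ioc_mem_nhdsGT hzl] with y hy
  have := hanti hy ⟨hzl, le_rfl⟩ hy.2
  simp only at this
  linarith [V_nonneg hzI]

/-- `E V` is at least of order `(x - lo)^(-nl)`, and `1/2 - nl ≤ 0`. Thus the second solution is not
square integrable at `lo`, the borderline exponent `1/2` included. -/
theorem exists_le_sqrt_mul_EV_left (h : 1 / 2 ≤ d.nl) : ∃ c, 0 < c ∧ ∀ᶠ x in 𝓝[>] d.lo,
    c ≤ √(x - d.lo) * (d.E x * d.V x) := by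
  have hD := d.len_pos
  have hn : 0 < d.nl := by linarith
  obtain ⟨c, M, hc, hV⟩ := exists_rpow_le_V hn
  have hp := d.phi_pos hD le_rfl
  refine ⟨(d.hi - d.lo) ^ (1 / 2 - d.nl) * d.phi (d.hi - d.lo) * c * (1 / 2), by positivity, ?_⟩
  have hlim : Tendsto (fun x => 1 - M * (x - d.lo) ^ (2 * d.nl)) (𝓝[>] d.lo) (𝓝 1) := by
    have g1 : ContinuousAt (fun x => 1 - M * (x - d.lo) ^ (2 * d.nl)) d.lo := by
      have g1 : ContinuousAt (fun x => (x - d.lo) ^ (2 * d.nl)) d.lo :=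
        (by fun_prop : ContinuousAt (fun x => x - d.lo) d.lo).rpow_const (Or.inr (by positivity))
      fun_prop
    have := tendsto_left_of_continuousAt g1
    rwa [sub_self, Real.zero_rpow (by positivity), mul_zero, sub_zero] at this
  filter_upwards [hV, d.eventually_left, hlim.eventually (eventually_ge_nhds (by norm_num :
    (1 / 2 : ℝ) < 1))] with x h1 hx h2
  have hl := left_pos hx
  have hr := Real.rpow_pos_of_pos hl d.nl
  have hpx : d.phi (d.hi - d.lo) ≤ d.phi (d.hi - x) := d.phi_anti (right_pos hx) (right_le hx)
  have hd : (d.hi - d.lo) ^ (1 / 2 - d.nl) ≤ (x - d.lo) ^ (1 / 2 - d.nl) :=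
    Real.rpow_le_rpow_of_nonpos hl (left_le hx) (by linarith)
  have e1 : √(x - d.lo) * (x - d.lo) ^ d.nl * ((x - d.lo) ^ (-(2 * d.nl)) - M) =
      (x - d.lo) ^ (1 / 2 - d.nl) * (1 - M * (x - d.lo) ^ (2 * d.nl)) := by
    rw [Real.sqrt_eq_rpow, mul_sub, mul_sub, ← Real.rpow_add hl, ← Real.rpow_add hl, mul_one,
      mul_left_comm (_ ^ (1 / 2 - d.nl)), ← Real.rpow_add hl, mul_comm M]
    ring_nf
  have hV' := V_nonneg hx
  calc (d.hi - d.lo) ^ (1 / 2 - d.nl) * d.phi (d.hi - d.lo) * c * (1 / 2)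
      ≤ (x - d.lo) ^ (1 / 2 - d.nl) * d.phi (d.hi - d.lo) * c *
        (1 - M * (x - d.lo) ^ (2 * d.nl)) := by gcongr
    _ = √(x - d.lo) * ((x - d.lo) ^ d.nl * d.phi (d.hi - d.lo)) *
        (c * ((x - d.lo) ^ (-(2 * d.nl)) - M)) := by
          linear_combination (-d.phi (d.hi - d.lo) * c) * e1
    _ ≤ √(x - d.lo) * ((x - d.lo) ^ d.nl * d.phi (d.hi - d.lo)) * d.V x := by gcongr
    _ ≤ √(x - d.lo) * ((x - d.lo) ^ d.nl * d.phi (d.hi - x)) * d.V x := by gcongr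
    _ = _ := by rw [E]; ring

theorem tendsto_sub_lo_mul_EV : d.nl = 0 →
    Tendsto (fun x => (x - d.lo) * (d.E x * d.V x)) (𝓝[>] d.lo) (𝓝 0) := by
  intro h
  obtain ⟨C, hC, hEV⟩ := d.exists_E_mul_V_le
  have h1 : ContinuousAt (fun x => C * ((x - d.lo) ^ (3 / 4 : ℝ) * (d.hi - x) ^ d.nr)) d.lo := by
    have g1 : ContinuousAt (fun x => (x - d.lo) ^ (3 / 4 : ℝ)) d.lo :=
      (by fun_prop : ContinuousAt (fun x => x - d.lo) d.lo).rpow_const (Or.inr (by positivity))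
    have g2 : ContinuousAt (fun x => (d.hi - x) ^ d.nr) d.lo :=
      (by fun_prop : ContinuousAt (fun x => d.hi - x) d.lo).rpow_const (Or.inl d.len_pos.ne')
    fun_prop
  have h2 := tendsto_left_of_continuousAt h1
  rw [sub_self, Real.zero_rpow (by norm_num), zero_mul, mul_zero] at h2
  refine squeeze_zero' ?_ ?_ h2
  · filter_upwards [d.eventually_left] with x hx
    exact mul_nonneg (left_pos hx).le (mul_nonneg (E_pos hx).le (V_nonneg hx))
  · filter_upwards [d.eventually_left] with x hx
    have hl := left_pos hx
    have e1 : (x - d.lo) ^ (3 / 4 : ℝ) = (x - d.lo) * (x - d.lo) ^ (-d.nl - 1 / 4) := by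
      nth_rewrite 2 [← Real.rpow_one (x - d.lo)]
      rw [← Real.rpow_add hl, h]; norm_num
    rw [e1]
    calc _ ≤ (x - d.lo) * (C * ((x - d.lo) ^ (-d.nl - 1 / 4) * (d.hi - x) ^ d.nr)) := by
          exact mul_le_mul_of_nonneg_left (hEV x hx) hl.le
      _ = _ := by ring

theorem deriv_comb {k : ℝ → ℂ} {e c : ℂ} (hk : ∀ x ∈ d.I, k x = (d.E x : ℂ) * (e - c * d.V x))
    (hx : x ∈ d.I) : deriv k x =
      (d.dE x : ℂ) * (e - c * d.V x) + c * ((1 / (d.P x * d.E x) : ℝ) : ℂ) := by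
  have h1 : HasDerivAt (fun x => (d.E x : ℂ) * (e - c * d.V x)) ((d.dE x : ℂ) * (e - c * d.V x) +
      c * ((1 / (d.P x * d.E x) : ℝ) : ℂ)) x := by
    refine ((hasDerivAt_E hx).ofReal_comp.mul
      (((hasDerivAt_V hx).ofReal_comp.const_mul c).const_sub e)).congr_deriv ?_
    rw [← E_mul_K hx]
    push_cast
    ring
  refine (h1.congr_of_eventuallyEq ?_).deriv
  filter_upwards [isOpen_Ioo.mem_nhds hx] with y hy using hk y hy

/-- If `nl = 0`, then `(x - lo) k'` differs by a null function from a positive quantity times `c`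
with nonzero limit, so the boundary condition forces `c = 0`. If `nl ≥ 1/2`, the term `c E V`
violates square integrability and `e E` is too small to compensate it. -/
theorem comb_left_eq_zero {k : ℝ → ℂ} {e c : ℂ}
    (hk : ∀ x ∈ d.I, k x = (d.E x : ℂ) * (e - c * d.V x))
    (hm : MemLp k 2 (volume.restrict d.I))
    (hb : d.nl = 0 → Tendsto (fun x => ((x - d.lo : ℝ) : ℂ) * deriv k x) (𝓝[>] d.lo) (𝓝 0)) :
    c = 0 := by
  have hD := d.len_pos
  by_contra hc0
  have hc : 0 < ‖c‖ := norm_pos_iff.2 hc0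
  rcases d.hnl with h | h
  · have hp := d.phi_pos hD le_rfl
    have hy3 : 0 < d.y3 - d.lo := by linarith [d.lo_lt_hi, d.hi_lt_y3]
    have t1 : Tendsto (fun x => (x - d.lo) / d.P x * (d.E x)⁻¹) (𝓝[>] d.lo)
        (𝓝 (9 / (2 * ((d.hi - d.lo) * (d.y3 - d.lo))) * (d.phi (d.hi - d.lo))⁻¹)) :=
      tendsto_left_div_P.mul ((tendsto_E_left h).inv₀ hp.ne')
    have t2 : Tendsto (fun x => (d.nr + 1) / (d.hi - x) * ((x - d.lo) * d.E x * ‖e‖ +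
        ‖c‖ * ((x - d.lo) * (d.E x * d.V x)))) (𝓝[>] d.lo)
        (𝓝 ((d.nr + 1) / (d.hi - d.lo) * (0 * d.phi (d.hi - d.lo) * ‖e‖ + ‖c‖ * 0))) := by
      refine (tendsto_left_of_continuousAt ?_).mul
        (((tendsto_sub_lo.mul (tendsto_E_left h)).mul_const _).add
          ((tendsto_sub_lo_mul_EV h).const_mul _))
      exact ContinuousAt.div (by fun_prop) (by fun_prop) hD.ne'
    simp only [zero_mul, mul_zero, add_zero] at t2
    have t3 : Tendsto (fun x => ((x - d.lo : ℝ) : ℂ) * deriv k x -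
        c * (((x - d.lo) / d.P x * (d.E x)⁻¹ : ℝ) : ℂ)) (𝓝[>] d.lo) (𝓝 0) := by
      refine squeeze_zero_norm' ?_ t2
      filter_upwards [d.eventually_left] with x hx
      have hE := E_pos hx
      have hl := left_pos hx
      have hr := right_pos hx
      have hP := P_pos hx
      have hV := V_nonneg hx
      have hE1 := E1_nonneg hx
      have hE1' := E1_le hx
      have hEc := Complex.ofReal_ne_zero.2 hE.ne'
      have hPc := Complex.ofReal_ne_zero.2 hP.ne'
      have e1 : ((x - d.lo : ℝ) : ℂ) * deriv k x -
          c * (((x - d.lo) / d.P x * (d.E x)⁻¹ : ℝ) : ℂ) =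
          (((x - d.lo) * (d.E1 x / (d.hi - x)) : ℝ) : ℂ) * (e - c * d.V x) := by
        rw [deriv_comb hk hx, dE, h]
        push_cast
        field_simp
        ring
      rw [e1, norm_mul, Complex.norm_real, Real.norm_of_nonneg (by positivity)]
      have hn : ‖e - c * d.V x‖ ≤ ‖e‖ + ‖c‖ * d.V x := by
        refine (norm_sub_le _ _).trans_eq ?_
        rw [norm_mul, Complex.norm_real, Real.norm_of_nonneg hV]
      have hnr := d.nr_nonneg
      have h0 : 0 ≤ (x - d.lo) * ((d.nr + 1) * d.E x / (d.hi - x)) := by positivity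
      calc (x - d.lo) * (d.E1 x / (d.hi - x)) * ‖e - c * d.V x‖
          ≤ (x - d.lo) * ((d.nr + 1) * d.E x / (d.hi - x)) * (‖e‖ + ‖c‖ * d.V x) := by gcongr
        _ = _ := by ring
    have t4 := (hb h).sub t3
    simp only [sub_sub_cancel, sub_zero] at t4
    have t5 := (((Complex.continuous_ofReal.tendsto _).comp t1).const_mul c)
    have := tendsto_nhds_unique t4 t5
    rcases mul_eq_zero.1 this.symm with h' | h'
    · exact hc0 h'
    · exact (Complex.ofReal_ne_zero.2 (by positivity)) h'
  · obtain ⟨b, hb0, hb1⟩ := exists_le_sqrt_mul_EV_left h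
    refine not_memLp_of_left (k := k) (c := (‖c‖ * b / 2) ^ 2) (by positivity) ?_ hm
    have t1 := (tendsto_sqrt_mul_E_left (d := d) (by linarith)).const_mul ‖e‖
    rw [mul_zero] at t1
    filter_upwards [hb1, d.eventually_left,
      t1.eventually (eventually_le_nhds (by positivity : 0 < ‖c‖ * b / 2))] with x h1 hx h2
    have hl := left_pos hx
    have hE := E_pos hx
    have hV := V_nonneg hx
    have e1 : (x - d.lo) * ‖k x‖ ^ 2 = (√(x - d.lo) * ‖k x‖) ^ 2 := by
      rw [mul_pow, Real.sq_sqrt hl.le]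
    rw [e1]
    have h3 : d.E x * (‖c‖ * d.V x - ‖e‖) ≤ ‖k x‖ := by
      rw [hk x hx, norm_mul, Complex.norm_real, Real.norm_of_nonneg hE.le]
      refine mul_le_mul_of_nonneg_left ?_ hE.le
      have := norm_sub_norm_le (c * (d.V x : ℂ)) e
      rw [norm_mul, Complex.norm_real, Real.norm_of_nonneg hV, norm_sub_rev] at this
      exact this
    refine pow_le_pow_left₀ (by positivity) ?_ 2
    have h4 := mul_le_mul_of_nonneg_left h3 (Real.sqrt_nonneg (x - d.lo))
    have h5 := mul_le_mul_of_nonneg_left h1 hc.le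
    linarith

/-- At `hi` the singular solution is `E` itself. For `nr = 0` the product `(x - hi) E'` has the
nonzero limit `-(hi - lo)^nl`; for `nr ≥ 1/2`, `E` is not square integrable. -/
theorem comb_right_eq_zero {k : ℝ → ℂ} {e : ℂ} (hk : ∀ x ∈ d.I, k x = (d.E x : ℂ) * e)
    (hm : MemLp k 2 (volume.restrict d.I))
    (hb : d.nr = 0 → Tendsto (fun x => ((x - d.hi : ℝ) : ℂ) * deriv k x) (𝓝[<] d.hi) (𝓝 0)) :
    e = 0 := by
  have hD := d.len_pos
  have hpow := tendsto_right_of_continuousAt d.continuousAt_rpow_hi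
  have hDn := Real.rpow_pos_of_pos hD d.nl
  by_contra he0
  have he : 0 < ‖e‖ := norm_pos_iff.2 he0
  rcases d.hnr with h | h
  · obtain ⟨C, hC, hE⟩ := d.exists_E_le
    have t2 : Tendsto (fun x => (d.hi - x) * d.E x) (𝓝[<] d.hi) (𝓝 0) := by
      have h1 : ContinuousAt (fun x => C * ((x - d.lo) ^ d.nl * (d.hi - x) ^ (3 / 4 : ℝ)))
          d.hi := by
        have g1 : ContinuousAt (fun x => (d.hi - x) ^ (3 / 4 : ℝ)) d.hi :=
          (by fun_prop : ContinuousAt (fun x => d.hi - x) d.hi).rpow_const (Or.inr (by positivity))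
        have := d.continuousAt_rpow_hi
        fun_prop
      have h2 := tendsto_right_of_continuousAt h1
      rw [sub_self, Real.zero_rpow (by norm_num), mul_zero, mul_zero] at h2
      refine squeeze_zero' ?_ ?_ h2
      · filter_upwards [d.eventually_right] with x hx
        exact mul_nonneg (right_pos hx).le (E_pos hx).le
      · filter_upwards [d.eventually_right] with x hx
        have hr := right_pos hx
        have e1 : (d.hi - x) ^ (3 / 4 : ℝ) = (d.hi - x) * (d.hi - x) ^ (-d.nr - 1 / 4) := by
          nth_rewrite 2 [← Real.rpow_one (d.hi - x)]
          rw [← Real.rpow_add hr, h]; norm_num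
        rw [e1]
        calc _ ≤ (d.hi - x) * (C * ((x - d.lo) ^ d.nl * (d.hi - x) ^ (-d.nr - 1 / 4))) := by
              gcongr; exact hE x hx
          _ = _ := by ring
    have t3 : Tendsto (fun x => -((d.hi - x) * d.E x * (d.nl / (x - d.lo)) + (x - d.lo) ^ d.nl))
        (𝓝[<] d.hi) (𝓝 (-(0 * (d.nl / (d.hi - d.lo)) + (d.hi - d.lo) ^ d.nl))) := by
      refine ((t2.mul (tendsto_right_of_continuousAt ?_)).add hpow).neg
      exact ContinuousAt.div (by fun_prop) (by fun_prop) hD.ne'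
    have t4 := ((Complex.continuous_ofReal.tendsto _).comp t3).mul_const e
    have t5 := tendsto_nhds_unique ((hb h).congr' ?_) t4
    · rcases mul_eq_zero.1 t5.symm with h' | h'
      · refine Complex.ofReal_ne_zero.2 ?_ h'
        rw [zero_mul, zero_add]
        exact (neg_neg_of_pos hDn).ne
      · exact he0 h'
    · filter_upwards [d.eventually_right] with x hx
      have hlc := Complex.ofReal_ne_zero.2 (left_pos hx).ne'
      have hrc := Complex.ofReal_ne_zero.2 (right_pos hx).ne'
      have hE1 : d.E1 x = (x - d.lo) ^ d.nl := by simp [E1, phi1, h]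
      have := deriv_comb (k := k) (e := e) (c := 0) (fun x hx => by rw [hk x hx]; ring) hx
      rw [this, dE, hE1, Function.comp_apply, show x - d.hi = -(d.hi - x) by ring]
      push_cast at hlc hrc ⊢
      field_simp
      ring
  · refine not_memLp_of_right (k := k) (c := ‖e‖ ^ 2 * (((d.hi - d.lo) ^ d.nl / 2) ^ 2 *
      (d.hi - d.lo) ^ (1 - 2 * d.nr))) (by positivity) ?_ hm
    filter_upwards [d.eventually_right,
      hpow.eventually (eventually_ge_nhds (by linarith : (d.hi - d.lo) ^ d.nl / 2 <
        (d.hi - d.lo) ^ d.nl))] with x hx h1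
    have hr := right_pos hx
    have hn : d.nr ≠ 0 := by linarith
    have e1 : (d.hi - x) * ((d.hi - x) ^ (-d.nr)) ^ 2 = (d.hi - x) ^ (1 - 2 * d.nr) := by
      rw [show 1 - 2 * d.nr = 1 + (-d.nr + -d.nr) by ring, Real.rpow_add hr, Real.rpow_add hr,
        Real.rpow_one]
      ring
    rw [hk x hx, norm_mul, Complex.norm_real, Real.norm_of_nonneg (E_pos hx).le, E, phi,
      if_neg hn]
    have h2 : (d.hi - d.lo) ^ (1 - 2 * d.nr) ≤ (d.hi - x) ^ (1 - 2 * d.nr) :=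
      Real.rpow_le_rpow_of_nonpos hr (right_le hx) (by linarith)
    calc _ ≤ ‖e‖ ^ 2 * (((x - d.lo) ^ d.nl) ^ 2 * (d.hi - x) ^ (1 - 2 * d.nr)) := by gcongr
      _ = _ := by rw [← e1]; ring

/-- The boundary value problem has only one square integrable solution. -/
theorem eq_sol {f : ℝ → ℂ} (hf : IsAC d.lo d.hi f) (hfm : MemLp f 2 (volume.restrict d.I))
    (hφ : MemLp φ 2 (volume.restrict d.I))
    (h : ∀ᵐ x ∂(volume.restrict d.I), HasDerivAt (fun x => (d.P x : ℂ) * deriv f x)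
      (((d.dQ x / d.E x : ℝ) : ℂ) * f x - φ x) x)
    (hl : d.nl = 0 → Tendsto (fun x => ((x - d.lo : ℝ) : ℂ) * deriv f x) (𝓝[>] d.lo) (𝓝 0))
    (hr : d.nr = 0 → Tendsto (fun x => ((x - d.hi : ℝ) : ℂ) * deriv f x) (𝓝[<] d.hi) (𝓝 0)) :
    ∀ x ∈ d.I, f x = d.sol φ x := by
  have hk := hf.sub (isAC_sol hφ)
  have hkd : ∀ x ∈ d.I, deriv (fun x => f x - d.sol φ x) x = deriv f x - deriv (d.sol φ) x :=
    fun x hx => ((hf.hasDerivAt hx).sub ((isAC_sol hφ).hasDerivAt hx)).deriv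
  have hm : MemLp (fun x => f x - d.sol φ x) 2 (volume.restrict d.I) := hfm.sub (memLp_sol hφ)
  obtain ⟨e, c, hec⟩ := exists_eq_of_flux hk (by
    filter_upwards [h, ae_hasDerivAt_flux_sol hφ, ae_restrict_mem measurableSet_Ioo]
      with x h1 h2 hx
    refine ((h1.sub h2).congr_deriv (by ring)).congr_of_eventuallyEq ?_
    filter_upwards [isOpen_Ioo.mem_nhds hx] with y hy
    simp only [hkd y hy, Pi.sub_apply]
    ring)
  have hc : c = 0 := comb_left_eq_zero hec hm fun h0 => by
    have := (hl h0).sub (tendsto_sub_lo_mul_deriv_sol h0 hφ)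
    rw [sub_zero] at this
    refine this.congr' ?_
    filter_upwards [d.eventually_left] with x hx
    rw [hkd x hx]; ring
  have he : e = 0 := comb_right_eq_zero (k := fun x => f x - d.sol φ x)
    (fun x hx => by rw [hec x hx, hc]; ring) hm fun h0 => by
    have := (hr h0).sub (tendsto_sub_hi_mul_deriv_sol h0 hφ)
    rw [sub_zero] at this
    refine this.congr' ?_
    filter_upwards [d.eventually_right] with x hx
    rw [hkd x hx]; ring
  intro x hx
  have := hec x hx
  rw [he, hc, zero_mul, sub_zero, mul_zero] at this
  exact sub_eq_zero.1 this

end SLData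

/-! ### Decay of eigenfunctions at the end points. -/

theorem norm_integral_le_of_forall_Ioo {g : ℝ → ℂ} {a b C : ℝ} (hab : a ≤ b)
    (h : ∀ t ∈ Ioo a b, ‖g t‖ ≤ C) : ‖∫ t in a..b, g t‖ ≤ C * (b - a) := by
  have := intervalIntegral.norm_integral_le_of_norm_le_const_ae (a := a) (b := b) (f := g) (C := C)
    (by
      have hne : ∀ᵐ y : ℝ, y ≠ b := by simp [ae_iff, measure_singleton]
      filter_upwards [hne] with y hy hyI
      rw [uIoc_of_le hab] at hyI
      exact h y ⟨hyI.1, lt_of_le_of_ne hyI.2 hy⟩)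
  rwa [abs_of_nonneg (sub_nonneg.2 hab)] at this

theorem integral_rpow_sub_one {s X Y : ℝ} (hs : s ≠ 0) (hX : 0 < X) (hXY : X ≤ Y) :
    ∫ t in X..Y, t ^ (s - 1) = (Y ^ s - X ^ s) / s := by
  rw [integral_rpow]
  · rw [sub_add_cancel]
  · right
    refine ⟨fun h => hs (by linarith), ?_⟩
    rw [uIcc_of_le hXY]
    exact fun h => absurd h.1 hX.not_ge

/-- Iterating a gain of decay until the exponent `n` is reached. -/
theorem exists_le_rpow_of_gain {n X₀ : ℝ} (hn : 0 ≤ n) (hX₀ : 0 < X₀) {F : ℝ → ℝ}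
    (h0 : ∃ C, ∀ X ∈ Ioc 0 X₀, F X ≤ C)
    (hstep : ∀ γ, 0 ≤ γ → ∀ C, 0 ≤ C → (∀ X ∈ Ioc 0 X₀, F X ≤ C * X ^ γ) → ∃ C', 0 ≤ C' ∧
      ∀ X ∈ Ioc 0 X₀, F X ≤ C' *
        (X ^ n * (1 + ∫ t in X..X₀, t ^ (γ - n - 1 / 4)) + X ^ (γ + 3 / 4))) :
    ∃ C, ∀ X ∈ Ioc 0 X₀, F X ≤ C * X ^ n := by
  have hcmp : ∀ s : ℝ, 0 ≤ s → ∀ X ∈ Ioc 0 X₀, X ^ s ≤ X₀ ^ s := fun s hs X hX =>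
    Real.rpow_le_rpow hX.1.le hX.2 hs
  -- Half a power per round is safe: the last term already carries `γ + 3/4`, and for `δ = n` the
  -- integrand has exponent `γ - n - 1/4 ≥ -3/4`, so its integral stays bounded.
  have key : ∀ γ δ, 0 ≤ γ → δ ≤ γ + 1 / 2 → δ ≤ n →
      (∃ C, 0 ≤ C ∧ ∀ X ∈ Ioc 0 X₀, F X ≤ C * X ^ γ) →
      ∃ C, 0 ≤ C ∧ ∀ X ∈ Ioc 0 X₀, F X ≤ C * X ^ δ := by
    rintro γ δ hγ hδγ hδn ⟨C, hC, hF⟩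
    obtain ⟨C', hC', hF'⟩ := hstep γ hγ C hC hF
    have hint : ∃ A, 0 ≤ A ∧ ∀ X ∈ Ioc 0 X₀,
        X ^ n * (1 + ∫ t in X..X₀, t ^ (γ - n - 1 / 4)) ≤ A * X ^ δ := by
      -- The exponent is lowered to some `s ≠ -1`, so that no logarithm arises: `s = -3/4` when `δ =
      -- n`, and `s = δ - n - 1` when `δ < n`.
      have hmono : ∀ s, s ≤ γ - n - 1 / 4 → ∀ X ∈ Ioc 0 X₀, ∫ t in X..X₀, t ^ (γ - n - 1 / 4) ≤
          X₀ ^ (γ - n - 1 / 4 - s) * ∫ t in X..X₀, t ^ s := by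
        intro s hs X hX
        rw [← intervalIntegral.integral_const_mul]
        have hii : ∀ s : ℝ, IntervalIntegrable (fun t : ℝ => t ^ s) volume X X₀ := fun s =>
          intervalIntegral.intervalIntegrable_rpow (Or.inr (by
            rw [uIcc_of_le hX.2]; exact fun h => absurd h.1 hX.1.not_ge))
        refine intervalIntegral.integral_mono_on hX.2 (hii _) ((hii s).const_mul _) fun t ht => ?_
        have ht0 : 0 < t := hX.1.trans_le ht.1
        calc t ^ (γ - n - 1 / 4) = t ^ (γ - n - 1 / 4 - s) * t ^ s := by
              rw [← Real.rpow_add ht0]; congr 1; ring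
          _ ≤ _ := mul_le_mul_of_nonneg_right (hcmp _ (by linarith) t ⟨ht0, ht.2⟩)
              (Real.rpow_pos_of_pos ht0 _).le
      rcases hδn.eq_or_lt with rfl | hlt
      · refine ⟨1 + X₀ ^ (γ - δ - 1 / 4 - (1 / 4 - 1)) * (X₀ ^ (1 / 4 : ℝ) / (1 / 4)),
          by positivity, fun X hX => ?_⟩
        have hXp := Real.rpow_pos_of_pos hX.1 δ
        rw [mul_comm _ (X ^ δ)]
        refine mul_le_mul_of_nonneg_left (add_le_add le_rfl ?_) hXp.le
        refine (hmono (1 / 4 - 1) (by linarith) X hX).trans ?_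
        rw [integral_rpow_sub_one (by norm_num) hX.1 hX.2]
        have := Real.rpow_pos_of_pos hX.1 (1 / 4)
        gcongr
        linarith
      · refine ⟨X₀ ^ (n - δ) + X₀ ^ (γ - n - 1 / 4 - (δ - n - 1)) / (n - δ), ?_, fun X hX => ?_⟩
        · have : 0 < n - δ := sub_pos.2 hlt
          positivity
        · have hnd : 0 < n - δ := sub_pos.2 hlt
          have e1 : X ^ n = X ^ (n - δ) * X ^ δ := by
            rw [← Real.rpow_add hX.1, sub_add_cancel]
          have e2 : X ^ n * X ^ (δ - n) = X ^ δ := by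
            rw [← Real.rpow_add hX.1]; congr 1; ring
          have hXn := Real.rpow_pos_of_pos hX.1 n
          have hXd := Real.rpow_pos_of_pos hX.1 δ
          have h1 := hmono (δ - n - 1) (by linarith) X hX
          rw [integral_rpow_sub_one (by linarith) hX.1 hX.2] at h1
          have h2 : (X₀ ^ (δ - n) - X ^ (δ - n)) / (δ - n) ≤ X ^ (δ - n) / (n - δ) := by
            rw [← neg_sub n δ, div_neg, ← neg_div]
            gcongr
            have := Real.rpow_pos_of_pos hX₀ (-(n - δ))
            linarith
          have hXc := Real.rpow_pos_of_pos hX₀ (γ - n - 1 / 4 - (δ - n - 1))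
          rw [mul_add, mul_one, add_mul]
          refine add_le_add ?_ ?_
          · rw [e1]
            exact mul_le_mul_of_nonneg_right (hcmp _ hnd.le X hX) hXd.le
          · calc _ ≤ X ^ n * (X₀ ^ (γ - n - 1 / 4 - (δ - n - 1)) * (X ^ (δ - n) / (n - δ))) := by
                  refine mul_le_mul_of_nonneg_left (h1.trans ?_) hXn.le
                  gcongr
              _ = _ := by rw [← e2]; ring
    obtain ⟨A, hA, hAX⟩ := hint
    refine ⟨C' * (A + X₀ ^ (γ + 3 / 4 - δ)), by positivity, fun X hX => (hF' X hX).trans ?_⟩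
    rw [mul_assoc, add_mul]
    refine mul_le_mul_of_nonneg_left (add_le_add (hAX X hX) ?_) hC'
    have hXd := Real.rpow_pos_of_pos hX.1 δ
    calc X ^ (γ + 3 / 4) = X ^ (γ + 3 / 4 - δ) * X ^ δ := by
          rw [← Real.rpow_add hX.1, sub_add_cancel]
      _ ≤ _ := mul_le_mul_of_nonneg_right (hcmp _ (by linarith) X hX) hXd.le
  have hall : ∀ k : ℕ, ∃ C, 0 ≤ C ∧ ∀ X ∈ Ioc 0 X₀, F X ≤ C * X ^ min ((k : ℝ) / 2) n := by
    intro k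
    induction k with
    | zero =>
      obtain ⟨C, hC⟩ := h0
      refine ⟨max C 0, le_max_right _ _, fun X hX => ?_⟩
      rw [Nat.cast_zero, zero_div, min_eq_left hn, Real.rpow_zero, mul_one]
      exact (hC X hX).trans (le_max_left _ _)
    | succ k ih =>
      refine key _ _ (le_min (by positivity) hn) ?_ (min_le_right _ _) ih
      rw [← min_add_add_right]
      refine min_le_min ?_ (by linarith)
      push_cast
      linarith
  obtain ⟨k, hk⟩ := exists_nat_ge (2 * n)
  obtain ⟨C, -, hC⟩ := hall k
  rw [min_eq_right (by linarith)] at hC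
  exact ⟨C, hC⟩

namespace SLData

variable {d : SLData} {φ χ : ℝ → ℂ} {x : ℝ}

theorem exists_left_bounds (d : SLData) : ∃ C, 0 < C ∧ ∀ y ∈ d.I, y ≤ d.lo + (d.hi - d.lo) / 2 →
    d.E y ≤ C * (y - d.lo) ^ d.nl ∧ d.E y * d.V y ≤ C * (y - d.lo) ^ (-d.nl - 1 / 4) := by
  obtain ⟨C₁, hC₁, hE⟩ := d.exists_E_le
  obtain ⟨C₂, hC₂, hEV⟩ := d.exists_E_mul_V_le
  have hD := d.len_pos
  refine ⟨max (C₁ * ((d.hi - d.lo) / 2) ^ (-d.nr - 1 / 4)) (C₂ * (d.hi - d.lo) ^ d.nr),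
    by positivity, fun y hy hym => ?_⟩
  have hl := left_pos hy
  have hr := right_pos hy
  constructor
  · refine (hE y hy).trans ?_
    have : (d.hi - y) ^ (-d.nr - 1 / 4) ≤ ((d.hi - d.lo) / 2) ^ (-d.nr - 1 / 4) :=
      Real.rpow_le_rpow_of_nonpos (by positivity) (by linarith) (by linarith [d.nr_nonneg])
    calc _ ≤ C₁ * ((y - d.lo) ^ d.nl * ((d.hi - d.lo) / 2) ^ (-d.nr - 1 / 4)) := by gcongr
      _ = C₁ * ((d.hi - d.lo) / 2) ^ (-d.nr - 1 / 4) * (y - d.lo) ^ d.nl := by ring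
      _ ≤ _ := by gcongr; exact le_max_left _ _
  · refine (hEV y hy).trans ?_
    have : (d.hi - y) ^ d.nr ≤ (d.hi - d.lo) ^ d.nr :=
      Real.rpow_le_rpow hr.le (right_le hy) d.nr_nonneg
    calc _ ≤ C₂ * ((y - d.lo) ^ (-d.nl - 1 / 4) * (d.hi - d.lo) ^ d.nr) := by gcongr
      _ = C₂ * (d.hi - d.lo) ^ d.nr * (y - d.lo) ^ (-d.nl - 1 / 4) := by ring
      _ ≤ _ := by gcongr; exact le_max_right _ _

theorem exists_right_bounds (d : SLData) : ∃ C, 0 < C ∧ ∀ y ∈ d.I, d.hi - (d.hi - d.lo) / 2 ≤ y →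
    d.E y ≤ C * (d.hi - y) ^ (-d.nr - 1 / 4) ∧ d.E y * d.V y ≤ C * (d.hi - y) ^ d.nr := by
  obtain ⟨C₁, hC₁, hE⟩ := d.exists_E_le
  obtain ⟨C₂, hC₂, hEV⟩ := d.exists_E_mul_V_le
  have hD := d.len_pos
  refine ⟨max (C₂ * ((d.hi - d.lo) / 2) ^ (-d.nl - 1 / 4)) (C₁ * (d.hi - d.lo) ^ d.nl),
    by positivity, fun y hy hym => ?_⟩
  have hl := left_pos hy
  have hr := right_pos hy
  constructor
  · refine (hE y hy).trans ?_
    have : (y - d.lo) ^ d.nl ≤ (d.hi - d.lo) ^ d.nl :=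
      Real.rpow_le_rpow hl.le (left_le hy) d.nl_nonneg
    calc _ ≤ C₁ * ((d.hi - d.lo) ^ d.nl * (d.hi - y) ^ (-d.nr - 1 / 4)) := by gcongr
      _ = C₁ * (d.hi - d.lo) ^ d.nl * (d.hi - y) ^ (-d.nr - 1 / 4) := by ring
      _ ≤ _ := by gcongr; exact le_max_right _ _
  · refine (hEV y hy).trans ?_
    have : (y - d.lo) ^ (-d.nl - 1 / 4) ≤ ((d.hi - d.lo) / 2) ^ (-d.nl - 1 / 4) :=
      Real.rpow_le_rpow_of_nonpos (by positivity) (by linarith) (by linarith [d.nl_nonneg])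
    calc _ ≤ C₂ * (((d.hi - d.lo) / 2) ^ (-d.nl - 1 / 4) * (d.hi - y) ^ d.nr) := by gcongr
      _ = C₂ * ((d.hi - d.lo) / 2) ^ (-d.nl - 1 / 4) * (d.hi - y) ^ d.nr := by ring
      _ ≤ _ := by gcongr; exact le_max_left _ _

theorem mI_eq_add (hφ : MemLp φ 2 (volume.restrict d.I)) {z : ℝ} (hz : z ∈ d.I) (hx : x ∈ d.I) :
    d.mI φ x = d.mI φ z + ∫ t in z..x, (d.E t : ℂ) * φ t := by
  rw [mI, mI, intervalIntegral.integral_add_adjacent_intervals (intervalIntegrable_mI hφ hz)]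
  exact (intervalIntegrable_mI hφ hz).symm.trans (intervalIntegrable_mI hφ hx)

theorem mJ_eq_add (hφ : MemLp φ 2 (volume.restrict d.I)) {z : ℝ} (hz : z ∈ d.I) (hx : x ∈ d.I) :
    d.mJ φ x = d.mJ φ z + ∫ t in x..z, ((d.E t * d.V t : ℝ) : ℂ) * φ t := by
  rw [mJ, mJ, add_comm, intervalIntegral.integral_add_adjacent_intervals _
    (intervalIntegrable_mJ hφ hz)]
  exact (intervalIntegrable_mJ hφ hx).trans (intervalIntegrable_mJ hφ hz).symm

theorem sol_eq (d : SLData) (φ : ℝ → ℂ) (x : ℝ) :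
    d.sol φ x = ((d.E x * d.V x : ℝ) : ℂ) * d.mI φ x + (d.E x : ℂ) * d.mJ φ x := by
  rw [sol, quo]; push_cast; ring

/-- An eigenfunction decays at `hi` like the regular solution. -/
theorem exists_sol_le_right (hφ : MemLp φ 2 (volume.restrict d.I)) {M : ℝ}
    (hM : ∀ x ∈ d.I, ‖φ x‖ ≤ M * ‖d.sol φ x‖) :
    ∃ C, ∀ X ∈ Ioc 0 ((d.hi - d.lo) / 2), ‖d.sol φ (d.hi - X)‖ ≤ C * X ^ d.nr := by
  have hD := d.len_pos
  set X₀ := (d.hi - d.lo) / 2 with hX₀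
  have hX₀p : 0 < X₀ := by positivity
  have hmem : ∀ X ∈ Ioc 0 X₀, d.hi - X ∈ d.I := fun X hX =>
    ⟨by linarith [hX.2], by linarith [hX.1]⟩
  have hzI := hmem X₀ ⟨hX₀p, le_rfl⟩
  obtain ⟨C₀, hC₀, hb⟩ := d.exists_sol_le
  obtain ⟨B, hB, hEB⟩ := d.exists_right_bounds
  refine exists_le_rpow_of_gain d.nr_nonneg hX₀p
    ⟨C₀ * d.N2 φ, fun X hX => hb φ hφ _ (hmem X hX)⟩ fun γ hγ C hC hF => ?_
  have hM' : ∀ x ∈ d.I, d.hi - X₀ ≤ x → ‖φ x‖ ≤ |M| * (C * (d.hi - x) ^ γ) := by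
    intro x hx hx2
    have := hF (d.hi - x) ⟨right_pos hx, by linarith⟩
    rw [sub_sub_cancel] at this
    refine (hM x hx).trans (mul_le_mul (le_abs_self M) this (norm_nonneg _) (abs_nonneg M))
  refine ⟨B * (‖d.mI φ (d.hi - X₀)‖ + B * (|M| * C)) + B * (B * (|M| * C)), by positivity,
    fun X hX => ?_⟩
  have hx := hmem X hX
  have hXn := Real.rpow_pos_of_pos hX.1 d.nr
  have hz : d.hi - X₀ ≤ d.hi - X := by linarith [hX.2]
  have hint0 : 0 ≤ ∫ t in X..X₀, t ^ (γ - d.nr - 1 / 4) :=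
    intervalIntegral.integral_nonneg hX.2 fun t ht =>
      (Real.rpow_pos_of_pos (hX.1.trans_le ht.1) _).le
  -- The moment up to `hi - X₀` is a fixed constant. Beyond it, `E ≲ t^(-nr - 1/4)` in the distance
  -- `t` to `hi`, times the assumed decay `t^γ`, gives the integral in the gain hypothesis.
  have hmI : ‖d.mI φ (d.hi - X)‖ ≤ ‖d.mI φ (d.hi - X₀)‖ +
      B * (|M| * C) * ∫ t in X..X₀, t ^ (γ - d.nr - 1 / 4) := by
    rw [mI_eq_add hφ hzI hx]
    refine (norm_add_le _ _).trans (add_le_add le_rfl ?_)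
    have hsubst := intervalIntegral.integral_comp_sub_left (a := d.hi - X₀) (b := d.hi - X)
      (fun t => t ^ (γ - d.nr - 1 / 4)) d.hi
    rw [sub_sub_cancel, sub_sub_cancel] at hsubst
    rw [← hsubst, ← intervalIntegral.integral_const_mul]
    refine intervalIntegral.norm_integral_le_of_norm_le hz ?_ ?_
    · refine ae_of_all _ fun t ht => ?_
      have htI : t ∈ d.I := ⟨hzI.1.trans ht.1, ht.2.trans_lt hx.2⟩
      have hr := right_pos htI
      rw [norm_mul, Complex.norm_real, Real.norm_of_nonneg (E_pos htI).le]
      calc _ ≤ B * (d.hi - t) ^ (-d.nr - 1 / 4) * (|M| * (C * (d.hi - t) ^ γ)) :=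
            mul_le_mul (hEB t htI ht.1.le).1 (hM' t htI ht.1.le) (norm_nonneg _) (by positivity)
        _ = B * (|M| * C) * ((d.hi - t) ^ γ * (d.hi - t) ^ (-d.nr - 1 / 4)) := by ring
        _ = _ := by rw [← Real.rpow_add hr]; ring_nf
    · refine ContinuousOn.intervalIntegrable ?_
      rw [uIcc_of_le hz]
      refine continuousOn_const.mul fun t ht => ?_
      have : d.hi - t ≠ 0 := by linarith [ht.2, hX.1]
      exact ((by fun_prop : ContinuousAt (fun t => d.hi - t) t).rpow_const
        (Or.inl this)).continuousWithinAt
  -- `E V ≲ X^nr` and the decay `X^γ` integrate to `X^(nr + γ + 1)`; the prefactor `E` turns this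
  -- into `X^(γ + 3/4)`.
  have hmJ : ‖d.mJ φ (d.hi - X)‖ ≤ B * (|M| * C) * (X ^ (d.nr + γ) * X) := by
    have h1 : ∀ t ∈ Ioo (d.hi - X) d.hi, ‖((d.E t * d.V t : ℝ) : ℂ) * φ t‖ ≤
        B * (|M| * C) * X ^ (d.nr + γ) := by
      intro t ht
      have htI : t ∈ d.I := ⟨hx.1.trans ht.1, ht.2⟩
      have hr := right_pos htI
      have hrX : d.hi - t ≤ X := by linarith [ht.1]
      have htm : d.hi - X₀ ≤ t := hz.trans ht.1.le
      rw [norm_mul, Complex.norm_real,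
        Real.norm_of_nonneg (mul_nonneg (E_pos htI).le (V_nonneg htI))]
      have hn := d.nr_nonneg
      calc _ ≤ B * (d.hi - t) ^ d.nr * (|M| * (C * (d.hi - t) ^ γ)) :=
            mul_le_mul (hEB t htI htm).2 (hM' t htI htm) (norm_nonneg _) (by positivity)
        _ ≤ B * X ^ d.nr * (|M| * (C * X ^ γ)) := by gcongr
        _ = _ := by rw [Real.rpow_add hX.1]; ring
    have := norm_integral_le_of_forall_Ioo hx.2.le h1
    rw [sub_sub_cancel] at this
    exact this.trans_eq (by ring)
  rw [sol_eq]
  refine (norm_add_le _ _).trans ?_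
  rw [norm_mul, norm_mul, Complex.norm_real, Complex.norm_real,
    Real.norm_of_nonneg (mul_nonneg (E_pos hx).le (V_nonneg hx)), Real.norm_of_nonneg (E_pos hx).le]
  obtain ⟨g1, g2⟩ := hEB _ hx hz
  rw [sub_sub_cancel] at g1 g2
  have h34 := Real.rpow_pos_of_pos hX.1 (γ + 3 / 4)
  calc _ ≤ B * X ^ d.nr * (‖d.mI φ (d.hi - X₀)‖ +
        B * (|M| * C) * ∫ t in X..X₀, t ^ (γ - d.nr - 1 / 4)) +
        B * X ^ (-d.nr - 1 / 4) * (B * (|M| * C) * (X ^ (d.nr + γ) * X)) :=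
        add_le_add (mul_le_mul g2 hmI (norm_nonneg _) (by positivity))
          (mul_le_mul g1 hmJ (norm_nonneg _) (by have := hX.1; positivity))
    _ = X ^ d.nr * (B * (‖d.mI φ (d.hi - X₀)‖ * 1 +
        B * (|M| * C) * ∫ t in X..X₀, t ^ (γ - d.nr - 1 / 4))) +
        B * (B * (|M| * C)) * X ^ (γ + 3 / 4) := by
        have e : X ^ (-d.nr - 1 / 4) * (X ^ (d.nr + γ) * X) = X ^ (γ + 3 / 4) := by
          nth_rewrite 3 [← Real.rpow_one X]
          rw [← Real.rpow_add hX.1, ← Real.rpow_add hX.1]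
          congr 1; ring
        rw [← e]; ring
    _ ≤ X ^ d.nr * (B * ((‖d.mI φ (d.hi - X₀)‖ + B * (|M| * C)) * 1 +
        (‖d.mI φ (d.hi - X₀)‖ + B * (|M| * C)) * ∫ t in X..X₀, t ^ (γ - d.nr - 1 / 4))) +
        B * (B * (|M| * C)) * X ^ (γ + 3 / 4) := by
        gcongr
        · linarith [show 0 ≤ B * (|M| * C) by positivity]
        · linarith [norm_nonneg (d.mI φ (d.hi - X₀))]
    _ ≤ _ := by
        have : 0 ≤ X ^ d.nr * (1 + ∫ t in X..X₀, t ^ (γ - d.nr - 1 / 4)) := by positivity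
        have g3 : 0 ≤ B * (B * (|M| * C)) := by positivity
        have g4 : 0 ≤ B * (‖d.mI φ (d.hi - X₀)‖ + B * (|M| * C)) := by positivity
        have := mul_nonneg g3 this
        have := mul_nonneg g4 h34.le
        linarith

/-- An eigenfunction decays at `lo` like the regular solution. -/
theorem exists_sol_le_left (hφ : MemLp φ 2 (volume.restrict d.I)) {M : ℝ}
    (hM : ∀ x ∈ d.I, ‖φ x‖ ≤ M * ‖d.sol φ x‖) :
    ∃ C, ∀ X ∈ Ioc 0 ((d.hi - d.lo) / 2), ‖d.sol φ (d.lo + X)‖ ≤ C * X ^ d.nl := by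
  have hD := d.len_pos
  set X₀ := (d.hi - d.lo) / 2 with hX₀
  have hX₀p : 0 < X₀ := by positivity
  have hmem : ∀ X ∈ Ioc 0 X₀, d.lo + X ∈ d.I := fun X hX =>
    ⟨by linarith [hX.1], by linarith [hX.2]⟩
  have hzI := hmem X₀ ⟨hX₀p, le_rfl⟩
  obtain ⟨C₀, hC₀, hb⟩ := d.exists_sol_le
  obtain ⟨B, hB, hEB⟩ := d.exists_left_bounds
  refine exists_le_rpow_of_gain d.nl_nonneg hX₀p
    ⟨C₀ * d.N2 φ, fun X hX => hb φ hφ _ (hmem X hX)⟩ fun γ hγ C hC hF => ?_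
  have hM' : ∀ x ∈ d.I, x ≤ d.lo + X₀ → ‖φ x‖ ≤ |M| * (C * (x - d.lo) ^ γ) := by
    intro x hx hx2
    have := hF (x - d.lo) ⟨left_pos hx, by linarith⟩
    rw [add_sub_cancel] at this
    refine (hM x hx).trans (mul_le_mul (le_abs_self M) this (norm_nonneg _) (abs_nonneg M))
  refine ⟨B * (‖d.mJ φ (d.lo + X₀)‖ + B * (|M| * C)) + B * (B * (|M| * C)), by positivity,
    fun X hX => ?_⟩
  have hx := hmem X hX
  have hXn := Real.rpow_pos_of_pos hX.1 d.nl
  have hz : d.lo + X ≤ d.lo + X₀ := by linarith [hX.2]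
  have hint0 : 0 ≤ ∫ t in X..X₀, t ^ (γ - d.nl - 1 / 4) :=
    intervalIntegral.integral_nonneg hX.2 fun t ht =>
      (Real.rpow_pos_of_pos (hX.1.trans_le ht.1) _).le
  -- At `lo` the roles are exchanged: `E` is regular and `E V` loses the quarter power, so `mJ`
  -- produces the integral term.
  have hmJ : ‖d.mJ φ (d.lo + X)‖ ≤ ‖d.mJ φ (d.lo + X₀)‖ +
      B * (|M| * C) * ∫ t in X..X₀, t ^ (γ - d.nl - 1 / 4) := by
    rw [mJ_eq_add hφ hzI hx]
    refine (norm_add_le _ _).trans (add_le_add le_rfl ?_)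
    have hsubst := intervalIntegral.integral_comp_sub_right (a := d.lo + X) (b := d.lo + X₀)
      (fun t => t ^ (γ - d.nl - 1 / 4)) d.lo
    rw [add_sub_cancel_left, add_sub_cancel_left] at hsubst
    rw [← hsubst, ← intervalIntegral.integral_const_mul]
    refine intervalIntegral.norm_integral_le_of_norm_le hz ?_ ?_
    · refine ae_of_all _ fun t ht => ?_
      have htI : t ∈ d.I := ⟨hx.1.trans ht.1, ht.2.trans_lt hzI.2⟩
      have hl := left_pos htI
      rw [norm_mul, Complex.norm_real,
        Real.norm_of_nonneg (mul_nonneg (E_pos htI).le (V_nonneg htI))]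
      calc _ ≤ B * (t - d.lo) ^ (-d.nl - 1 / 4) * (|M| * (C * (t - d.lo) ^ γ)) :=
            mul_le_mul (hEB t htI ht.2).2 (hM' t htI ht.2) (norm_nonneg _) (by positivity)
        _ = B * (|M| * C) * ((t - d.lo) ^ γ * (t - d.lo) ^ (-d.nl - 1 / 4)) := by ring
        _ = _ := by rw [← Real.rpow_add hl]; ring_nf
    · refine ContinuousOn.intervalIntegrable ?_
      rw [uIcc_of_le hz]
      refine continuousOn_const.mul fun t ht => ?_
      have : t - d.lo ≠ 0 := by linarith [ht.1, hX.1]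
      exact ((by fun_prop : ContinuousAt (fun t => t - d.lo) t).rpow_const
        (Or.inl this)).continuousWithinAt
  have hmI : ‖d.mI φ (d.lo + X)‖ ≤ B * (|M| * C) * (X ^ (d.nl + γ) * X) := by
    have h1 : ∀ t ∈ Ioo d.lo (d.lo + X), ‖(d.E t : ℂ) * φ t‖ ≤
        B * (|M| * C) * X ^ (d.nl + γ) := by
      intro t ht
      have htI : t ∈ d.I := ⟨ht.1, ht.2.trans hx.2⟩
      have hl := left_pos htI
      have hlX : t - d.lo ≤ X := by linarith [ht.2]
      have htm : t ≤ d.lo + X₀ := ht.2.le.trans hz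
      rw [norm_mul, Complex.norm_real, Real.norm_of_nonneg (E_pos htI).le]
      have hn := d.nl_nonneg
      calc _ ≤ B * (t - d.lo) ^ d.nl * (|M| * (C * (t - d.lo) ^ γ)) :=
            mul_le_mul (hEB t htI htm).1 (hM' t htI htm) (norm_nonneg _) (by positivity)
        _ ≤ B * X ^ d.nl * (|M| * (C * X ^ γ)) := by gcongr
        _ = _ := by rw [Real.rpow_add hX.1]; ring
    have := norm_integral_le_of_forall_Ioo hx.1.le h1
    rw [add_sub_cancel_left] at this
    exact this.trans_eq (by ring)
  rw [sol_eq, add_comm]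
  refine (norm_add_le _ _).trans ?_
  rw [norm_mul, norm_mul, Complex.norm_real, Complex.norm_real,
    Real.norm_of_nonneg (mul_nonneg (E_pos hx).le (V_nonneg hx)), Real.norm_of_nonneg (E_pos hx).le]
  obtain ⟨g1, g2⟩ := hEB _ hx hz
  rw [add_sub_cancel_left] at g1 g2
  have h34 := Real.rpow_pos_of_pos hX.1 (γ + 3 / 4)
  calc _ ≤ B * X ^ d.nl * (‖d.mJ φ (d.lo + X₀)‖ +
        B * (|M| * C) * ∫ t in X..X₀, t ^ (γ - d.nl - 1 / 4)) +
        B * X ^ (-d.nl - 1 / 4) * (B * (|M| * C) * (X ^ (d.nl + γ) * X)) :=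
        add_le_add (mul_le_mul g1 hmJ (norm_nonneg _) (by positivity))
          (mul_le_mul g2 hmI (norm_nonneg _) (by have := hX.1; positivity))
    _ = X ^ d.nl * (B * (‖d.mJ φ (d.lo + X₀)‖ * 1 +
        B * (|M| * C) * ∫ t in X..X₀, t ^ (γ - d.nl - 1 / 4))) +
        B * (B * (|M| * C)) * X ^ (γ + 3 / 4) := by
        have e : X ^ (-d.nl - 1 / 4) * (X ^ (d.nl + γ) * X) = X ^ (γ + 3 / 4) := by
          nth_rewrite 3 [← Real.rpow_one X]
          rw [← Real.rpow_add hX.1, ← Real.rpow_add hX.1]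
          congr 1; ring
        rw [← e]; ring
    _ ≤ X ^ d.nl * (B * ((‖d.mJ φ (d.lo + X₀)‖ + B * (|M| * C)) * 1 +
        (‖d.mJ φ (d.lo + X₀)‖ + B * (|M| * C)) * ∫ t in X..X₀, t ^ (γ - d.nl - 1 / 4))) +
        B * (B * (|M| * C)) * X ^ (γ + 3 / 4) := by
        gcongr
        · linarith [show 0 ≤ B * (|M| * C) by positivity]
        · linarith [norm_nonneg (d.mJ φ (d.lo + X₀))]
    _ ≤ _ := by
        have : 0 ≤ X ^ d.nl * (1 + ∫ t in X..X₀, t ^ (γ - d.nl - 1 / 4)) := by positivity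
        have g3 : 0 ≤ B * (B * (|M| * C)) := by positivity
        have g4 : 0 ≤ B * (‖d.mJ φ (d.lo + X₀)‖ + B * (|M| * C)) := by positivity
        have := mul_nonneg g3 this
        have := mul_nonneg g4 h34.le
        linarith

theorem isBigO_sol (hφ : MemLp φ 2 (volume.restrict d.I)) {M : ℝ}
    (hM : ∀ x ∈ d.I, ‖φ x‖ ≤ M * ‖d.sol φ x‖) :
    d.sol φ =O[𝓝[<] d.hi] (fun y => (d.hi - y) ^ d.nr) ∧
      d.sol φ =O[𝓝[>] d.lo] (fun y => (y - d.lo) ^ d.nl) := by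
  have hD := d.len_pos
  obtain ⟨C₁, h1⟩ := exists_sol_le_right hφ hM
  obtain ⟨C₂, h2⟩ := exists_sol_le_left hφ hM
  constructor
  · refine IsBigO.of_bound C₁ ?_
    filter_upwards [Ioo_mem_nhdsLT (by linarith : d.hi - (d.hi - d.lo) / 2 < d.hi)] with y hy
    have h3 := h1 (d.hi - y) ⟨by linarith [hy.2], by linarith [hy.1]⟩
    rw [sub_sub_cancel] at h3
    rwa [Real.norm_of_nonneg (Real.rpow_nonneg (by linarith [hy.2]) _)]
  · refine IsBigO.of_bound C₂ ?_
    filter_upwards [Ioo_mem_nhdsGT (by linarith : d.lo < d.lo + (d.hi - d.lo) / 2)] with y hy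
    have h3 := h2 (y - d.lo) ⟨by linarith [hy.1], by linarith [hy.2]⟩
    rw [add_sub_cancel] at h3
    rwa [Real.norm_of_nonneg (Real.rpow_nonneg (by linarith [hy.1]) _)]

end SLData

/-! ### Simplicity of eigenvalues and positivity of the quadratic form. -/

/-- Uniqueness for the linear system `u' = A v`, `v' = B u`. -/
theorem eq_zero_of_linear_system {α β : ℝ} {A B : ℝ → ℂ} {u v : ℝ → ℂ}
    (hA : ContinuousOn A (Ioo α β)) (hB : ContinuousOn B (Ioo α β))
    (hu : ∀ x ∈ Ioo α β, HasDerivAt u (A x * v x) x)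
    (hv : ∀ x ∈ Ioo α β, HasDerivAt v (B x * u x) x)
    {x₀ : ℝ} (hx₀ : x₀ ∈ Ioo α β) (hu0 : u x₀ = 0) (hv0 : v x₀ = 0) :
    ∀ x ∈ Ioo α β, u x = 0 := by
  intro x hx
  obtain ⟨c, hc1, hc2⟩ := exists_between (lt_min hx₀.1 hx.1)
  obtain ⟨e, he1, he2⟩ := exists_between (max_lt hx₀.2 hx.2)
  have hsub : Icc c e ⊆ Ioo α β := Icc_subset_Ioo hc1 he2
  obtain ⟨C₁, hC₁⟩ := isCompact_Icc.exists_bound_of_continuousOn (hA.mono hsub)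
  obtain ⟨C₂, hC₂⟩ := isCompact_Icc.exists_bound_of_continuousOn (hB.mono hsub)
  have hsub' : Ioo c e ⊆ Icc c e := Ioo_subset_Icc_self
  have hxc : x ∈ Ioo c e := ⟨hc2.trans_le (min_le_right _ _), (le_max_right _ _).trans_lt he1⟩
  have hxc0 : x₀ ∈ Ioo c e := ⟨hc2.trans_le (min_le_left _ _), (le_max_left _ _).trans_lt he1⟩
  have key := ODE_solution_unique_of_mem_Ioo (E := ℂ × ℂ) (v := fun t p => (A t * p.2, B t * p.1))
    (s := fun _ => univ) (K := Real.toNNReal (max C₁ C₂)) (a := c) (b := e) (t₀ := x₀)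
    (f := fun t => (u t, v t)) (g := fun _ => (0, 0)) ?_ hxc0 ?_ ?_ ?_
  · have := key hxc
    exact congrArg Prod.fst this
  · intro t ht
    refine LipschitzOnWith.of_dist_le_mul fun p _ q _ => ?_
    rw [Real.coe_toNNReal _ ((norm_nonneg _).trans ((hC₁ t (hsub' ht)).trans (le_max_left _ _)))]
    rw [dist_eq_norm, dist_eq_norm, Prod.norm_def, Prod.norm_def]
    simp only [Prod.fst_sub, Prod.snd_sub, ← mul_sub, norm_mul]
    refine max_le ?_ ?_
    · exact mul_le_mul ((hC₁ t (hsub' ht)).trans (le_max_left _ _)) (le_max_right _ _)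
        (norm_nonneg _) ((norm_nonneg _).trans ((hC₁ t (hsub' ht)).trans (le_max_left _ _)))
    · exact mul_le_mul ((hC₂ t (hsub' ht)).trans (le_max_right _ _)) (le_max_left _ _)
        (norm_nonneg _) ((norm_nonneg _).trans ((hC₂ t (hsub' ht)).trans (le_max_right _ _)))
  · exact fun t ht => ⟨(hu t (hsub (hsub' ht))).prodMk (hv t (hsub (hsub' ht))), mem_univ _⟩
  · exact fun t ht => ⟨by
      simp only [mul_zero]; exact hasDerivAt_const t ((0 : ℂ), (0 : ℂ)), mem_univ _⟩
  · simp [hu0, hv0]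

/-- A function whose derivative is at least of the order of the inverse distance to the right end
point is unbounded. -/
theorem not_bounded_of_deriv_ge_right {F F' : ℝ → ℝ} {c β ε M : ℝ} (hcβ : c < β) (hε : 0 < ε)
    (hF : ∀ x ∈ Ioo c β, HasDerivAt F (F' x) x) (hF' : ∀ x ∈ Ioo c β, ε / (β - x) ≤ F' x)
    (hM : ∀ x ∈ Ioo c β, |F x| ≤ M) : False := by
  have hder : ∀ x ∈ Ioo c β, HasDerivAt (fun x => F x + ε * Real.log (β - x))
      (F' x + ε * (-1 / (β - x))) x := fun x hx =>
    (hF x hx).add ((((hasDerivAt_id x).const_sub β).log (sub_pos.2 hx.2).ne').const_mul ε)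
  -- With the logarithmic growth removed the function is still monotone, so a bounded `F` would
  -- contradict `log (β - x) → -∞`.
  have hmono : MonotoneOn (fun x => F x + ε * Real.log (β - x)) (Ioo c β) := by
    refine monotoneOn_of_deriv_nonneg (convex_Ioo _ _)
      (fun y hy => (hder y hy).continuousAt.continuousWithinAt)
      (fun y hy => (hder y (interior_subset hy)).differentiableAt.differentiableWithinAt)
      fun y hy => ?_
    rw [(hder y (interior_subset hy)).deriv]
    have := hF' y (interior_subset hy)
    have e : ε * (-1 / (β - y)) = -(ε / (β - y)) := by ring
    linarith
  obtain ⟨z, hz⟩ := exists_between hcβ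
  have hlog : Tendsto (fun x => ε * Real.log (β - x)) (𝓝[<] β) atBot := by
    refine Tendsto.const_mul_atBot hε ((Real.tendsto_log_nhdsGT_zero).comp ?_)
    refine tendsto_nhdsWithin_iff.2 ⟨?_, by
      filter_upwards [self_mem_nhdsWithin] with x hx using mem_Ioi.2 (sub_pos.2 hx)⟩
    have : Tendsto (fun x => β - x) (𝓝 β) (𝓝 (β - β)) := Continuous.tendsto (by fun_prop) _
    rw [sub_self] at this
    exact this.mono_left nhdsWithin_le_nhds
  obtain ⟨x, hx1, hx2⟩ := ((hlog.eventually_lt_atBot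
    (F z + ε * Real.log (β - z) - M)).and (Ioo_mem_nhdsLT hz.2)).exists
  have h1 := hmono hz ⟨hz.1.trans hx2.1, hx2.2⟩ hx2.1.le
  have h2 := (le_abs_self _).trans (hM x ⟨hz.1.trans hx2.1, hx2.2⟩)
  simp only at h1
  linarith

theorem not_bounded_of_deriv_le_left {F F' : ℝ → ℝ} {α c ε M : ℝ} (hαc : α < c) (hε : 0 < ε)
    (hF : ∀ x ∈ Ioo α c, HasDerivAt F (F' x) x) (hF' : ∀ x ∈ Ioo α c, F' x ≤ -(ε / (x - α)))
    (hM : ∀ x ∈ Ioo α c, |F x| ≤ M) : False := by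
  refine not_bounded_of_deriv_ge_right (F := fun x => F (-x)) (F' := fun x => F' (-x) * -1)
    (c := -c) (β := -α) (ε := ε) (M := M) (by linarith) hε (fun x hx => ?_) (fun x hx => ?_)
    fun x hx => hM _ ⟨by linarith [hx.2], by linarith [hx.1]⟩
  · exact (hF (-x) ⟨by linarith [hx.2], by linarith [hx.1]⟩).comp x (hasDerivAt_neg x)
  · have := hF' (-x) ⟨by linarith [hx.2], by linarith [hx.1]⟩
    rw [show -α - x = -x - α by ring]
    linarith

namespace SLData

variable {d : SLData} {φ χ : ℝ → ℂ} {x : ℝ}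

theorem hasDerivAt_mI (hφ : MemLp φ 2 (volume.restrict d.I)) (hc : ContinuousOn φ d.I)
    (hx : x ∈ d.I) : HasDerivAt (d.mI φ) ((d.E x : ℂ) * φ x) x :=
  (locAC_mI hφ).hasDerivAt_of_ae
    ((Complex.continuous_ofReal.comp_continuousOn continuousOn_E).mul hc)
    (ae_hasDerivAt_mI hφ) hx

/-- Here `quo = sol / E` with `sol` bounded. The factor `(x - lo)^nl` in the bound for `mI` cancels
the one in `1 / E`, leaving `√(x - lo)`. -/
theorem tendsto_mI_mul_quo_left (hφ : MemLp φ 2 (volume.restrict d.I))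
    (hχ : MemLp χ 2 (volume.restrict d.I)) :
    Tendsto (fun x => d.mI φ x * d.quo χ x) (𝓝[>] d.lo) (𝓝 0) := by
  obtain ⟨C, hC, hI⟩ := d.exists_mI_le
  obtain ⟨C', hC', hs⟩ := d.exists_sol_le
  have hD := d.len_pos
  have hp := d.phi_pos hD le_rfl
  have hN := N2_nonneg (d := d) (φ := φ)
  have hN' := N2_nonneg (d := d) (φ := χ)
  have h1 : ContinuousAt (fun x => C * ((d.hi - x) ^ (-d.nr) * √(x - d.lo)) * d.N2 φ *
      (d.phi (d.hi - d.lo))⁻¹ * (C' * d.N2 χ)) d.lo := by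
    have g2 : ContinuousAt (fun x => (d.hi - x) ^ (-d.nr)) d.lo :=
      (by fun_prop : ContinuousAt (fun x => d.hi - x) d.lo).rpow_const (Or.inl hD.ne')
    fun_prop
  have h2 := tendsto_left_of_continuousAt h1
  simp only [sub_self, Real.sqrt_zero, mul_zero, zero_mul] at h2
  refine squeeze_zero_norm' ?_ h2
  filter_upwards [d.eventually_left] with x hx
  have hl := left_pos hx
  have hr := right_pos hx
  have hE := E_pos hx
  have hxl := Real.rpow_pos_of_pos hl d.nl
  have hpx : d.phi (d.hi - d.lo) ≤ d.phi (d.hi - x) := d.phi_anti hr (right_le hx)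
  have hEc := Complex.ofReal_ne_zero.2 hE.ne'
  have e1 : d.mI φ x * d.quo χ x = d.mI φ x * ((d.E x)⁻¹ : ℝ) * d.sol χ x := by
    rw [sol]; push_cast; field_simp
  have hEinv : (d.E x)⁻¹ ≤ ((x - d.lo) ^ d.nl)⁻¹ * (d.phi (d.hi - d.lo))⁻¹ := by
    rw [← mul_inv, E]
    gcongr
  rw [e1, norm_mul, norm_mul, Complex.norm_real, Real.norm_of_nonneg (by positivity)]
  calc _ ≤ C * ((x - d.lo) ^ d.nl * (d.hi - x) ^ (-d.nr) * √(x - d.lo)) * d.N2 φ *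
      (((x - d.lo) ^ d.nl)⁻¹ * (d.phi (d.hi - d.lo))⁻¹) * (C' * d.N2 χ) :=
        mul_le_mul (mul_le_mul (hI φ hφ x hx) hEinv (by positivity) (by positivity))
          (hs χ hχ x hx) (norm_nonneg _) (by positivity)
    _ = _ := by field_simp

/-- Eigenvalues are simple. -/
theorem exists_eq_const_mul_sol (hφ : MemLp φ 2 (volume.restrict d.I))
    (hχ : MemLp χ 2 (volume.restrict d.I)) {β : ℝ → ℝ} (hβ : ContinuousOn β d.I)
    (h1 : ∀ x ∈ d.I, φ x = (β x : ℂ) * d.sol φ x) (h2 : ∀ x ∈ d.I, χ x = (β x : ℂ) * d.sol χ x)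
    {x₀ : ℝ} (hx₀ : x₀ ∈ d.I) (h0 : d.sol φ x₀ ≠ 0) :
    ∃ c : ℂ, ∀ x ∈ d.I, d.sol χ x = c * d.sol φ x := by
  have hβc : ContinuousOn (fun x => (β x : ℂ)) d.I :=
    Complex.continuous_ofReal.comp_continuousOn hβ
  have hcφ : ContinuousOn φ d.I := (hβc.mul (continuousOn_sol hφ)).congr h1
  have hcχ : ContinuousOn χ d.I := (hβc.mul (continuousOn_sol hχ)).congr h2
  -- Since `mI = -P E² quo'`, this is the weighted Wronskian of the two eigenfunctions.
  have hW : ∀ x ∈ d.I, HasDerivAt (fun x => d.mI φ x * d.quo χ x - d.mI χ x * d.quo φ x) 0 x := by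
    intro x hx
    refine (((hasDerivAt_mI hφ hcφ hx).mul (hasDerivAt_quo hχ hx)).sub
      ((hasDerivAt_mI hχ hcχ hx).mul (hasDerivAt_quo hφ hx))).congr_deriv ?_
    rw [h1 x hx, h2 x hx, sol, sol]
    ring
  obtain ⟨w, hw⟩ := (LocAC.of_hasDerivAt hW continuousOn_const).eq_const (by
    filter_upwards [ae_restrict_mem measurableSet_Ioo] with x hx using hW x hx)
  have hw0 : w = 0 := by
    have t1 := (tendsto_mI_mul_quo_left hφ hχ).sub (tendsto_mI_mul_quo_left hχ hφ)
    rw [sub_zero] at t1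
    refine tendsto_nhds_unique (tendsto_const_nhds.congr' ?_) t1
    filter_upwards [d.eventually_left] with x hx using (hw x hx).symm
  have hq0 : d.quo φ x₀ ≠ 0 := fun h => h0 (by rw [sol, h, mul_zero])
  set p := d.quo φ x₀ with hp
  set q := d.quo χ x₀ with hq
  -- The combination vanishes at `x₀` by the choice of `p` and `q`, and its companion moment
  -- vanishes there because the Wronskian is zero. Uniqueness for the first-order system in `quo`
  -- and `mI` then gives proportionality.
  have hz := eq_zero_of_linear_system (α := d.lo) (β := d.hi)
    (u := fun x => p * d.quo χ x - q * d.quo φ x) (v := fun x => p * d.mI χ x - q * d.mI φ x)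
    (A := fun x => -(d.K x : ℂ)) (B := fun x => (d.E x : ℂ) * β x * d.E x)
    (Complex.continuous_ofReal.comp_continuousOn continuousOn_K).neg
    (((Complex.continuous_ofReal.comp_continuousOn continuousOn_E).mul hβc).mul
      (Complex.continuous_ofReal.comp_continuousOn continuousOn_E))
    (fun x hx => (((hasDerivAt_quo hχ hx).const_mul p).sub
      ((hasDerivAt_quo hφ hx).const_mul q)).congr_deriv (by ring))
    (fun x hx => (((hasDerivAt_mI hχ hcχ hx).const_mul p).sub
      ((hasDerivAt_mI hφ hcφ hx).const_mul q)).congr_deriv (by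
        rw [h1 x hx, h2 x hx, sol, sol]; ring)) hx₀
    (by simp only [← hp, ← hq]; ring)
    (by have := hw x₀ hx₀; rw [hw0, ← hp, ← hq] at this; linear_combination -this)
  refine ⟨q / p, fun x hx => ?_⟩
  have := hz x hx
  rw [sol, sol]
  field_simp
  linear_combination (d.E x : ℂ) * this

theorem exists_div_P_le (d : SLData) : ∃ C, 0 < C ∧ ∀ y ∈ d.I,
    C / (d.hi - y) ≤ 1 / d.P y ∧ C / (y - d.lo) ≤ 1 / d.P y := by
  have hD := d.len_pos
  have hy3 : 0 < d.y3 - d.lo := by linarith [d.hi_lt_y3, d.lo_lt_hi]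
  refine ⟨1 / (2 / 9 * ((d.hi - d.lo) * (d.y3 - d.lo))), by positivity, fun y hy => ?_⟩
  have hl := left_pos hy
  have hr := right_pos hy
  have h3 : d.y3 - y ≤ d.y3 - d.lo := by linarith
  have h4 : 0 < d.y3 - y := by linarith [d.hi_lt_y3, hy.2]
  have h1 := left_le hy
  have h2 := right_le hy
  rw [div_div, div_div]
  constructor <;> refine one_div_le_one_div_of_le (P_pos hy) ?_ <;> rw [P]
  · calc 2 / 9 * ((y - d.lo) * (d.hi - y) * (d.y3 - y)) ≤
        2 / 9 * ((d.hi - d.lo) * (d.hi - y) * (d.y3 - d.lo)) := by gcongr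
      _ = _ := by ring
  · calc 2 / 9 * ((y - d.lo) * (d.hi - y) * (d.y3 - y)) ≤
        2 / 9 * ((y - d.lo) * (d.hi - d.lo) * (d.y3 - d.lo)) := by gcongr
      _ = _ := by ring

/-- The quadratic form of an operator with nonnegative potential is nonnegative on bounded
functions. -/
theorem integral_re_nonneg {f ψ : ℝ → ℂ} {q : ℝ → ℝ} {M : ℝ} (hf : IsAC d.lo d.hi f)
    (hfb : ∀ x ∈ d.I, ‖f x‖ ≤ M) (hψ : MemLp ψ 2 (volume.restrict d.I)) (hq : ∀ x ∈ d.I, 0 ≤ q x)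
    (h : ∀ᵐ x ∂(volume.restrict d.I), HasDerivAt (fun x => (d.P x : ℂ) * deriv f x)
      ((q x : ℂ) * f x - ψ x) x) :
    0 ≤ ∫ x in d.lo..d.hi, (ψ x * (starRingEnd ℂ) (f x)).re := by
  have hD := d.len_pos
  have hfc : ContinuousOn f d.I := hf.locAC.continuousOn
  have hfm : MemLp f 2 (volume.restrict d.I) := by
    refine MemLp.of_bound (hfc.aestronglyMeasurable measurableSet_Ioo) M ?_
    filter_upwards [ae_restrict_mem measurableSet_Ioo] with x hx using hfb x hx
  have hint : IntervalIntegrable (fun x => (ψ x * (starRingEnd ℂ) (f x)).re) volume d.lo d.hi := by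
    have h1 := intervalIntegrable_mul hψ (MemLp.star hfm)
    exact ⟨h1.1.re, h1.2.re⟩
  set g : ℝ → ℝ := fun x => (ψ x * (starRingEnd ℂ) (f x)).re with hg
  set G : ℝ → ℝ := fun x => ((d.P x : ℂ) * deriv f x * (starRingEnd ℂ) (f x)).re with hG
  have hGac : LocAC d.lo d.hi fun x => (d.P x : ℂ) * deriv f x * (starRingEnd ℂ) (f x) :=
    ((LocAC.ofReal contDiff_P.contDiffOn).mul hf.locAC_deriv).mul hf.locAC.conj
  have hint' : ∀ c e, c ∈ d.I → e ∈ Icc d.lo d.hi → IntervalIntegrable g volume c e := by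
    intro c e hc he
    refine hint.mono_set (uIcc_subset_uIcc ?_ ?_) <;> rw [uIcc_of_le d.lo_lt_hi.le]
    · exact Ioo_subset_Icc_self hc
    · exact he
  -- Almost everywhere `G' = q ‖f‖² + P ‖f'‖² - g`, and the first two terms are nonnegative.
  have hGle : ∀ c e, c ≤ e → c ∈ d.I → e ∈ d.I → -∫ x in c..e, g x ≤ G e - G c := by
    intro c e hce hc he
    have hsub : Icc c e ⊆ Ioo d.lo d.hi := Icc_subset_Ioo hc.1 he.2
    have hre : AbsolutelyContinuousOnInterval G c e :=
      AbsolutelyContinuousOnInterval.of_dist_le (hGac c e hce hsub) fun x y => by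
        rw [Real.dist_eq, Complex.dist_eq, ← Complex.sub_re]; exact Complex.abs_re_le_norm _
    rw [← hre.integral_deriv_eq_sub, ← intervalIntegral.integral_neg]
    refine intervalIntegral.integral_mono_ae_restrict hce
      (hint' c e hc (Ioo_subset_Icc_self he)).neg hre.intervalIntegrable_deriv ?_
    have h' := ae_restrict_of_ae_restrict_of_subset hsub h
    filter_upwards [h', ae_restrict_mem measurableSet_Icc] with x hx hxI
    have hxd := hf.hasDerivAt (hsub hxI)
    have hconj : HasDerivAt (fun x => (starRingEnd ℂ) (f x)) ((starRingEnd ℂ) (deriv f x)) x :=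
      hxd.star
    have hd : HasDerivAt G ((((q x : ℂ) * f x - ψ x) * (starRingEnd ℂ) (f x) +
        (d.P x : ℂ) * deriv f x * (starRingEnd ℂ) (deriv f x)).re) x := by
      have := Complex.reCLM.hasFDerivAt.comp_hasDerivAt x (hx.mul hconj)
      exact this
    rw [hd.deriv]
    have hP := (P_pos (hsub hxI)).le
    have hq' := hq x (hsub hxI)
    have e1 : ((((q x : ℂ) * f x - ψ x) * (starRingEnd ℂ) (f x) +
        (d.P x : ℂ) * deriv f x * (starRingEnd ℂ) (deriv f x)).re) =
        q x * ‖f x‖ ^ 2 + d.P x * ‖deriv f x‖ ^ 2 - g x := by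
      rw [hg, sub_mul, mul_assoc, mul_assoc, Complex.mul_conj, Complex.mul_conj,
        Complex.normSq_eq_norm_sq, Complex.normSq_eq_norm_sq, ← Complex.ofReal_mul,
        ← Complex.ofReal_mul, Complex.add_re, Complex.sub_re, Complex.ofReal_re, Complex.ofReal_re]
      ring
    rw [e1]
    have : 0 ≤ q x * ‖f x‖ ^ 2 := by positivity
    have : 0 ≤ d.P x * ‖deriv f x‖ ^ 2 := by positivity
    linarith
  have hsq : ∀ x ∈ d.I, HasDerivAt (fun x => ‖f x‖ ^ 2) (2 * (G x * (1 / d.P x))) x := by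
    intro x hx
    have hP := (P_pos hx).ne'
    have h1 := hf.hasDerivAt hx
    have h2 := Complex.reCLM.hasFDerivAt.comp_hasDerivAt x (h1.mul h1.star)
    have e2 : (fun x => ‖f x‖ ^ 2) = Complex.reCLM ∘ (f * fun x => star (f x)) := by
      funext y
      have : f y * star (f y) = ((‖f y‖ ^ 2 : ℝ) : ℂ) := by
        rw [← Complex.normSq_eq_norm_sq, ← Complex.mul_conj]; rfl
      simp only [Function.comp_apply, Pi.mul_apply, this, Complex.reCLM_apply, Complex.ofReal_re]
    rw [e2]
    refine h2.congr_deriv ?_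
    simp only [hG, Complex.reCLM_apply, Complex.add_re, Complex.mul_re, Complex.star_def,
      Complex.conj_re, Complex.conj_im, Complex.ofReal_re, Complex.ofReal_im, Complex.mul_im]
    field_simp
    ring
  have hsqb : ∀ x ∈ d.I, |‖f x‖ ^ 2| ≤ M ^ 2 := by
    intro x hx
    rw [abs_of_nonneg (by positivity)]
    exact pow_le_pow_left₀ (norm_nonneg _) (hfb x hx) 2
  -- No boundary condition is needed. A negative integral `T` keeps `G` away from zero near one end
  -- point, so `(‖f‖²)' = 2 G / P` is there at least of the order of the inverse distance, and
  -- `‖f‖²` would grow logarithmically.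
  by_contra! hneg
  set T := ∫ x in d.lo..d.hi, g x with hT
  obtain ⟨C, hC, hCP⟩ := d.exists_div_P_le
  have hprim := intervalIntegral.continuousOn_primitive_interval' hint left_mem_uIcc
  rw [uIcc_of_le d.lo_lt_hi.le] at hprim
  set Φ : ℝ → ℝ := fun x => ∫ t in d.lo..x, g t with hΦ
  have t1 : Tendsto Φ (𝓝[>] d.lo) (𝓝 0) := by
    have h1 := (hprim d.lo (left_mem_Icc.2 d.lo_lt_hi.le)).tendsto
    rw [show Φ d.lo = 0 from intervalIntegral.integral_same] at h1
    refine h1.mono_left (nhdsWithin_le_of_mem ?_)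
    exact mem_of_superset d.eventually_left Ioo_subset_Icc_self
  have t2 : Tendsto Φ (𝓝[<] d.hi) (𝓝 T) := by
    have h1 := (hprim d.hi (right_mem_Icc.2 d.lo_lt_hi.le)).tendsto
    refine h1.mono_left (nhdsWithin_le_of_mem ?_)
    exact mem_of_superset d.eventually_right Ioo_subset_Icc_self
  obtain ⟨u, hu, hsu⟩ := mem_nhdsGT_iff_exists_Ioo_subset.1
    ((t1.eventually (eventually_gt_nhds (by linarith : T / 8 < 0))).and
      (Ioo_mem_nhdsGT (by linarith : d.lo < (d.lo + d.hi) / 2)))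
  obtain ⟨v, hv, hsv⟩ := mem_nhdsLT_iff_exists_Ioo_subset.1
    ((t2.eventually (eventually_lt_nhds (by linarith : T < T / 2))).and
      (Ioo_mem_nhdsLT (by linarith : (d.lo + d.hi) / 2 < d.hi)))
  have hu' : d.lo < u := hu
  have hv' : v < d.hi := hv
  have hdiff : ∀ c ∈ Ioo d.lo u, ∀ e ∈ Ioo v d.hi, -(T / 4) ≤ G e - G c := by
    intro c hc e he
    obtain ⟨h1, h2⟩ := hsu hc
    obtain ⟨h3, h4⟩ := hsv he
    have hcI : c ∈ d.I := ⟨h2.1, by linarith [h2.2]⟩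
    have heI : e ∈ d.I := ⟨by linarith [h4.1], h4.2⟩
    have h5 := hGle c e (by linarith [h2.2, h4.1]) hcI heI
    have h6 : ∫ x in c..e, g x = Φ e - Φ c := by
      have i1 := hint' c d.lo hcI (left_mem_Icc.2 d.lo_lt_hi.le)
      have i2 := hint' e d.lo heI (left_mem_Icc.2 d.lo_lt_hi.le)
      rw [hΦ, intervalIntegral.integral_interval_sub_left i2.symm i1.symm]
    rw [h6] at h5
    have h1' : T / 8 < Φ c := h1
    have h3' : Φ e < T / 2 := h3
    linarith
  have hscale : ∀ {x s X : ℝ}, 0 ≤ s → C / X ≤ 1 / d.P x → s * C / X ≤ s * (1 / d.P x) := by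
    intro x s X hs hle
    rw [mul_div_assoc]
    exact mul_le_mul_of_nonneg_left hle hs
  -- The increase of `G`, at least `-T/4`, must show on one side: either `G ≥ -T/8` throughout near
  -- `hi`, or a single smaller value near `hi` forces `G < T/8` everywhere near `lo`.
  by_cases hcase : ∀ e ∈ Ioo v d.hi, -(T / 8) ≤ G e
  · refine not_bounded_of_deriv_ge_right (F := fun x => ‖f x‖ ^ 2) (ε := -(T / 4) * C) hv'
      (by have : 0 < -(T / 4) := by linarith
          positivity) (fun x hx => hsq x ?_) (fun x hx => ?_) (fun x hx => hsqb x ?_)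
    · exact ⟨by linarith [(hsv hx).2.1], hx.2⟩
    · have hxI : x ∈ d.I := ⟨by linarith [(hsv hx).2.1], hx.2⟩
      refine (hscale (by linarith) (hCP x hxI).1).trans ?_
      have hPi : 0 < 1 / d.P x := by have := P_pos hxI; positivity
      nlinarith [hcase x hx]
    · exact ⟨by linarith [(hsv hx).2.1], hx.2⟩
  · push Not at hcase
    obtain ⟨e, he, hGe⟩ := hcase
    refine not_bounded_of_deriv_le_left (F := fun x => ‖f x‖ ^ 2) (ε := -(T / 4) * C) hu'
      (by have : 0 < -(T / 4) := by linarith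
          positivity) (fun x hx => hsq x ?_) (fun x hx => ?_) (fun x hx => hsqb x ?_)
    · exact ⟨hx.1, by linarith [(hsu hx).2.2]⟩
    · have hxI : x ∈ d.I := ⟨hx.1, by linarith [(hsu hx).2.2]⟩
      have h1 := hscale (s := -(T / 4)) (by linarith) (hCP x hxI).2
      have hPi : 0 < 1 / d.P x := by have := P_pos hxI; positivity
      have h2 := hdiff x hx e he
      nlinarith
    · exact ⟨hx.1, by linarith [(hsu hx).2.2]⟩

end SLData

/-! ### The weighted Hilbert space and the operators acting on it. -/

namespace SLData

variable {d : SLData} {φ χ : ℝ → ℂ} {x : ℝ}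

theorem rho_pos (hx : x ∈ d.I) : 0 < rho x := by
  have := hx.2.trans d.hi_lt_one
  rw [rho]; linarith

theorem exists_rho_bounds (d : SLData) :
    ∃ c C, 0 < c ∧ 0 < C ∧ ∀ x ∈ d.I, c ≤ rho x ∧ rho x ≤ C := by
  have h1 := d.hi_lt_one
  have h2 := d.lo_lt_hi
  refine ⟨(1 - d.hi) / 18, (1 - d.lo) / 18, by linarith, by linarith, fun x hx => ?_⟩
  rw [rho]
  constructor <;> linarith [hx.1, hx.2]

variable (d) in
/-- The weighted measure on the interval. -/
abbrev μ : Measure ℝ := rhoMeasure d.lo d.hi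

theorem measurable_rho : Measurable fun y => ENNReal.ofReal (rho y) := by
  unfold rho; fun_prop

theorem ae_mu : ae d.μ = ae (volume.restrict d.I) := by
  refine le_antisymm ?_ ?_
  · exact (withDensity_absolutelyContinuous _ _).ae_le
  · refine (withDensity_absolutelyContinuous' measurable_rho.aemeasurable ?_).ae_le
    filter_upwards [ae_restrict_mem measurableSet_Ioo] with x hx
    exact (ENNReal.ofReal_pos.2 (rho_pos hx)).ne'

/-- Because `hi < 1`, the density lies between two positive constants. -/
theorem memLp_mu {f : ℝ → ℂ} : MemLp f 2 d.μ ↔ MemLp f 2 (volume.restrict d.I) := by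
  obtain ⟨c, C, hc, hC, hb⟩ := d.exists_rho_bounds
  constructor
  · refine fun h => h.of_measure_le_smul (c := (ENNReal.ofReal c)⁻¹)
      (ENNReal.inv_ne_top.2 (ENNReal.ofReal_pos.2 hc).ne') ?_
    have h1 : ENNReal.ofReal c • volume.restrict d.I ≤ d.μ := by
      rw [← withDensity_const]
      refine withDensity_mono ?_
      filter_upwards [ae_restrict_mem measurableSet_Ioo] with x hx
      exact ENNReal.ofReal_le_ofReal (hb x hx).1
    have h2 : (ENNReal.ofReal c)⁻¹ • ENNReal.ofReal c • volume.restrict d.I ≤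
        (ENNReal.ofReal c)⁻¹ • d.μ := fun s => by
      rw [Measure.smul_apply, Measure.smul_apply _ d.μ]
      exact mul_le_mul_right (h1 s) _
    refine le_trans (le_of_eq ?_) h2
    rw [smul_smul, ENNReal.inv_mul_cancel (ENNReal.ofReal_pos.2 hc).ne' ENNReal.ofReal_ne_top,
      one_smul]
  · refine fun h => h.of_measure_le_smul (c := ENNReal.ofReal C) ENNReal.ofReal_ne_top ?_
    rw [← withDensity_const]
    refine withDensity_mono ?_
    filter_upwards [ae_restrict_mem measurableSet_Ioo] with x hx
    exact ENNReal.ofReal_le_ofReal (hb x hx).2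

theorem integral_mu {F : Type*} [NormedAddCommGroup F] [NormedSpace ℝ F] (g : ℝ → F) :
    ∫ x, g x ∂d.μ = ∫ x in d.lo..d.hi, rho x • g x := by
  rw [show d.μ = (volume.restrict d.I).withDensity (fun y => ENNReal.ofReal (rho y)) from rfl,
    integral_withDensity_eq_integral_toReal_smul measurable_rho
    (ae_of_all _ fun _ => ENNReal.ofReal_lt_top),
    intervalIntegral.integral_of_le d.lo_lt_hi.le, integral_Ioc_eq_integral_Ioo]
  refine setIntegral_congr_fun measurableSet_Ioo fun x hx => ?_
  simp only [ENNReal.toReal_ofReal (rho_pos hx).le]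

instance : IsFiniteMeasure d.μ := by
  obtain ⟨c, C, hc, hC, hb⟩ := d.exists_rho_bounds
  have h : d.μ ≤ ENNReal.ofReal C • volume.restrict d.I := by
    rw [← withDensity_const]
    refine withDensity_mono ?_
    filter_upwards [ae_restrict_mem measurableSet_Ioo] with x hx
    exact ENNReal.ofReal_le_ofReal (hb x hx).2
  refine ⟨(h univ).trans_lt ?_⟩
  simp only [Measure.smul_apply, smul_eq_mul]
  exact ENNReal.mul_lt_top ENNReal.ofReal_lt_top (measure_lt_top _ _)

/-- Multiplication by the weight. -/
def wt (g : ℝ → ℂ) (y : ℝ) : ℂ := (rho y : ℂ) * g y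

theorem memLp_mul {β : ℝ → ℝ} (hβ : ContinuousOn β d.I) {C : ℝ} (hC : ∀ x ∈ d.I, |β x| ≤ C)
    {g : ℝ → ℂ} (hg : MemLp g 2 (volume.restrict d.I)) :
    MemLp (fun x => (β x : ℂ) * g x) 2 (volume.restrict d.I) := by
  refine hg.of_le_mul (c := C) (((Complex.continuous_ofReal.comp_continuousOn
    hβ).aestronglyMeasurable measurableSet_Ioo).mul hg.1) ?_
  filter_upwards [ae_restrict_mem measurableSet_Ioo] with x hx
  rw [norm_mul, Complex.norm_real]
  exact mul_le_mul_of_nonneg_right (hC x hx) (norm_nonneg _)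

theorem continuous_rho : Continuous rho := by unfold rho; fun_prop

theorem memLp_wt {g : ℝ → ℂ} (hg : MemLp g 2 (volume.restrict d.I)) :
    MemLp (wt g) 2 (volume.restrict d.I) := by
  obtain ⟨c, C, hc, hC, hb⟩ := d.exists_rho_bounds
  exact memLp_mul continuous_rho.continuousOn
    (fun x hx => by rw [abs_of_pos (rho_pos hx)]; exact (hb x hx).2) hg

theorem memLp_wt_coe (g : Lp ℂ 2 d.μ) : MemLp (wt g) 2 (volume.restrict d.I) :=
  memLp_wt (memLp_mu.1 (Lp.memLp g))

theorem exists_N2_wt_le (d : SLData) : ∃ C, 0 < C ∧ ∀ g : Lp ℂ 2 d.μ, d.N2 (wt g) ≤ C * ‖g‖ := by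
  obtain ⟨c, C, hc, hC, hb⟩ := d.exists_rho_bounds
  refine ⟨√C, by positivity, fun g => ?_⟩
  rw [N2, ← Real.sqrt_sq (norm_nonneg g), ← Real.sqrt_mul hC.le]
  refine Real.sqrt_le_sqrt ?_
  rw [norm_sq_eq_integral, integral_mu, intervalIntegral.integral_of_le d.lo_lt_hi.le,
    integral_Ioc_eq_integral_Ioo, ← integral_const_mul]
  refine setIntegral_mono_on ?_ ?_ measurableSet_Ioo fun x hx => ?_
  · exact (memLp_wt_coe g).integrable_norm_pow two_ne_zero
  · have h1 : Integrable (fun x => ‖g x‖ ^ 2) (volume.restrict d.I) :=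
      (memLp_mu.1 (Lp.memLp g)).integrable_norm_pow two_ne_zero
    refine ((h1.const_mul C).mono' ((continuous_rho.aestronglyMeasurable).smul h1.1) ?_).const_mul C
    filter_upwards [ae_restrict_mem measurableSet_Ioo] with x hx
    rw [Pi.smul_apply', norm_smul, Real.norm_of_nonneg (rho_pos hx).le, Real.norm_of_nonneg (by positivity)]
    exact mul_le_mul_of_nonneg_right (hb x hx).2 (by positivity)
  · have h1 := rho_pos hx
    have h2 := (hb x hx).2
    rw [wt, norm_mul, Complex.norm_real, Real.norm_of_nonneg h1.le, smul_eq_mul]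
    calc (rho x * ‖g x‖) ^ 2 = rho x * (rho x * ‖g x‖ ^ 2) := by ring
      _ ≤ _ := by gcongr

theorem sol_congr (h : φ =ᵐ[volume.restrict d.I] χ) (hx : x ∈ d.I) : d.sol φ x = d.sol χ x := by
  have h' := ae_imp_of_ae_restrict h
  have hne : ∀ᵐ y : ℝ, y ≠ d.hi := by simp [ae_iff, measure_singleton]
  have h1 : d.mI φ x = d.mI χ x := by
    refine intervalIntegral.integral_congr_ae ?_
    filter_upwards [h'] with y hy hyI
    rw [uIoc_of_le hx.1.le] at hyI
    rw [hy ⟨hyI.1, hyI.2.trans_lt hx.2⟩]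
  have h2 : d.mJ φ x = d.mJ χ x := by
    refine intervalIntegral.integral_congr_ae ?_
    filter_upwards [h', hne] with y hy hy2 hyI
    rw [uIoc_of_le hx.2.le] at hyI
    rw [hy ⟨hx.1.trans hyI.1, lt_of_le_of_ne hyI.2 hy2⟩]
  rw [sol, sol, quo, quo, h1, h2]

theorem sol_add (hφ : MemLp φ 2 (volume.restrict d.I)) (hχ : MemLp χ 2 (volume.restrict d.I))
    (hx : x ∈ d.I) : d.sol (fun y => φ y + χ y) x = d.sol φ x + d.sol χ x := by
  simp only [sol, quo, mI, mJ, mul_add]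
  rw [intervalIntegral.integral_add (intervalIntegrable_mI hφ hx) (intervalIntegrable_mI hχ hx),
    intervalIntegral.integral_add (intervalIntegrable_mJ hφ hx) (intervalIntegrable_mJ hχ hx)]
  ring

theorem sol_const_mul (c : ℂ) : d.sol (fun y => c * φ y) x = c * d.sol φ x := by
  simp only [sol, quo, mI, mJ]
  simp_rw [mul_left_comm _ c]
  rw [intervalIntegral.integral_const_mul, intervalIntegral.integral_const_mul]
  ring

theorem sol_conj : d.sol (fun y => (starRingEnd ℂ) (φ y)) x = (starRingEnd ℂ) (d.sol φ x) := by
  have key : ∀ (k : ℝ → ℝ) (a b : ℝ), ∫ t in a..b, (k t : ℂ) * (starRingEnd ℂ) (φ t) =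
      (starRingEnd ℂ) (∫ t in a..b, (k t : ℂ) * φ t) := by
    intro k a b
    rw [intervalIntegral, intervalIntegral, map_sub, ← integral_conj, ← integral_conj]
    simp only [map_mul, Complex.conj_ofReal]
  simp only [sol, quo, mI, mJ, key, map_mul, map_add, Complex.conj_ofReal]

/-- The linear functional `g ↦ sol (ρ g) x`. -/
def evalSol (d : SLData) (x : ℝ) (hx : x ∈ d.I) : Lp ℂ 2 d.μ →ₗ[ℂ] ℂ where
  toFun g := d.sol (wt g) x
  map_add' g₁ g₂ := by
    rw [← sol_add (memLp_wt_coe g₁) (memLp_wt_coe g₂) hx]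
    refine sol_congr ?_ hx
    have := Lp.coeFn_add g₁ g₂
    rw [EventuallyEq, ae_mu] at this
    filter_upwards [this] with y hy
    rw [wt, hy, Pi.add_apply, mul_add]; rfl
  map_smul' c g := by
    rw [RingHom.id_apply, smul_eq_mul, ← sol_const_mul]
    refine sol_congr ?_ hx
    have := Lp.coeFn_smul c g
    rw [EventuallyEq, ae_mu] at this
    filter_upwards [this] with y hy
    rw [wt, hy, Pi.smul_apply, smul_eq_mul, mul_left_comm]; rfl

theorem inner_mu (u v : Lp ℂ 2 d.μ) :
    inner ℂ u v = ∫ x in d.lo..d.hi, (starRingEnd ℂ) (u x) * wt v x := by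
  rw [L2.inner_def, integral_mu]
  refine intervalIntegral.integral_congr fun x _ => ?_
  simp only [RCLike.inner_apply, wt, Complex.real_smul]
  ring

theorem integral_congr_mu {f g : ℝ → ℂ} (h : f =ᵐ[d.μ] g) :
    ∫ x in d.lo..d.hi, f x = ∫ x in d.lo..d.hi, g x := by
  rw [EventuallyEq, ae_mu] at h
  rw [intervalIntegral.integral_of_le d.lo_lt_hi.le, integral_Ioc_eq_integral_Ioo,
    intervalIntegral.integral_of_le d.lo_lt_hi.le, integral_Ioc_eq_integral_Ioo]
  exact integral_congr_ae h

instance : TopologicalSpace.SeparableSpace (Lp ℂ 2 d.μ) := by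
  have : Fact ((2 : ENNReal) ≠ ⊤) := ⟨ENNReal.ofNat_ne_top⟩
  have : SecondCountableTopology (Lp ℂ 2 d.μ) := Lp.SecondCountableTopology
  infer_instance

/-- The solution operator in the weighted Hilbert space. -/
theorem exists_solution_operator (d : SLData) : ∃ R₀ : Lp ℂ 2 d.μ →L[ℂ] Lp ℂ 2 d.μ,
    IsCompactOperator R₀ ∧ R₀.toLinearMap.IsSymmetric ∧ Function.Injective R₀ ∧
    ∀ g, (R₀ g : ℝ → ℂ) =ᵐ[d.μ] d.sol (wt g) := by
  classical
  obtain ⟨C₁, hC₁, hs⟩ := d.exists_sol_le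
  obtain ⟨C₂, hC₂, hN⟩ := d.exists_N2_wt_le
  -- Point evaluations of the solution are bounded uniformly in `x`, so their Riesz representatives
  -- form a kernel of bounded norm, square integrable for the finite measure.
  have hbd : ∀ x (hx : x ∈ d.I) g, ‖d.evalSol x hx g‖ ≤ C₁ * C₂ * ‖g‖ := fun x hx g =>
    (hs _ (memLp_wt_coe g) x hx).trans (by
      rw [mul_assoc]; exact mul_le_mul_of_nonneg_left (hN g) hC₁.le)
  let k : ℝ → Lp ℂ 2 d.μ := fun x => if hx : x ∈ d.I then
    (InnerProductSpace.toDual ℂ _).symm ((d.evalSol x hx).mkContinuous _ (hbd x hx)) else 0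
  have hk : ∀ x ∈ d.I, ∀ g, inner ℂ (k x) g = d.sol (wt g) x := by
    intro x hx g
    simp only [k, dif_pos hx, InnerProductSpace.toDual_symm_apply, LinearMap.mkContinuous_apply]
    rfl
  have hI : ∀ᵐ x ∂d.μ, x ∈ d.I := by
    rw [ae_mu]; exact ae_restrict_mem measurableSet_Ioo
  obtain ⟨R₀, hc, hR⟩ := exists_compact_of_inner_kernel (μ := d.μ) k (Γ := fun _ => C₁ * C₂)
    (fun g => by
      have h1 : AEStronglyMeasurable (d.sol (wt g)) (volume.restrict d.I) :=
        (continuousOn_sol (memLp_wt_coe g)).aestronglyMeasurable measurableSet_Ioo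
      refine (h1.mono_ac (withDensity_absolutelyContinuous _ _)).congr ?_
      filter_upwards [hI] with x hx using (hk x hx g).symm)
    (memLp_const _) (by
      filter_upwards [hI] with x hx
      simp only [k, dif_pos hx, LinearIsometryEquiv.norm_map]
      exact LinearMap.mkContinuous_norm_le _ (by positivity) _)
  have hR' : ∀ g, (R₀ g : ℝ → ℂ) =ᵐ[d.μ] d.sol (wt g) := fun g => by
    filter_upwards [hR g, hI] with x h1 hx
    rw [h1, hk x hx]
  refine ⟨R₀, hc, fun u v => ?_, ?_, hR'⟩
  · have hu := memLp_wt_coe u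
    have hv := memLp_wt_coe v
    have e1 : inner ℂ (R₀ u) v = ∫ x in d.lo..d.hi,
        d.sol (fun y => (starRingEnd ℂ) (wt u y)) x * wt v x := by
      rw [inner_mu]
      refine integral_congr_mu ?_
      filter_upwards [hR' u] with x hx
      rw [hx, sol_conj]
    have e2 : inner ℂ u (R₀ v) = ∫ x in d.lo..d.hi,
        (starRingEnd ℂ) (wt u x) * d.sol (wt v) x := by
      rw [inner_mu]
      refine integral_congr_mu ?_
      filter_upwards [hR' v] with x hx
      rw [wt, hx, wt, map_mul, Complex.conj_ofReal]
      ring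
    change inner ℂ (R₀ u) v = inner ℂ u (R₀ v)
    rw [e1, e2]
    exact integral_sol_mul (MemLp.star hu) hv
  -- A vanishing solution has vanishing flux, and the differential equation then recovers a zero
  -- source.
  · refine (injective_iff_map_eq_zero R₀).2 fun g hg => ?_
    have hφ := memLp_wt_coe g
    have h0 : ∀ x ∈ d.I, d.sol (wt g) x = 0 := by
      have h1 := hR' g
      rw [hg] at h1
      have h2 : d.sol (wt g) =ᵐ[volume.restrict d.I] fun _ => 0 := by
        rw [EventuallyEq, ← ae_mu]
        filter_upwards [h1, Lp.coeFn_zero ℂ 2 d.μ] with x h3 h4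
        rw [← h3, h4]; rfl
      exact Measure.eqOn_open_of_ae_eq h2 isOpen_Ioo (continuousOn_sol hφ) continuousOn_const
    have hd0 : ∀ x ∈ d.I, deriv (d.sol (wt g)) x = 0 := fun x hx => by
      have : d.sol (wt g) =ᶠ[𝓝 x] fun _ => 0 := by
        filter_upwards [isOpen_Ioo.mem_nhds hx] with y hy using h0 y hy
      rw [this.deriv_eq, deriv_const]
    refine (Lp.eq_zero_iff_ae_eq_zero).2 ?_
    rw [EventuallyEq, ae_mu]
    filter_upwards [ae_hasDerivAt_flux_sol hφ, ae_restrict_mem measurableSet_Ioo] with x h1 hx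
    have h2 : (fun x => (d.P x : ℂ) * deriv (d.sol (wt g)) x) =ᶠ[𝓝 x] fun _ => 0 := by
      filter_upwards [isOpen_Ioo.mem_nhds hx] with y hy
      rw [hd0 y hy, mul_zero]
    have h3 := h1.unique ((hasDerivAt_const x (0 : ℂ)).congr_of_eventuallyEq h2)
    rw [h0 x hx, mul_zero, zero_sub, neg_eq_zero, wt] at h3
    exact (mul_eq_zero.1 h3).resolve_left (Complex.ofReal_ne_zero.2 (rho_pos hx).ne')

/-- Multiplication by a bounded continuous real function. -/
theorem exists_multiplication_operator (d : SLData) {b : ℝ → ℝ} (hb : ContinuousOn b d.I) {C : ℝ}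
    (hC : ∀ x ∈ d.I, |b x| ≤ C) : ∃ B : Lp ℂ 2 d.μ →L[ℂ] Lp ℂ 2 d.μ,
    B.toLinearMap.IsSymmetric ∧ ∀ g, (B g : ℝ → ℂ) =ᵐ[d.μ] fun x => (b x : ℂ) * g x := by
  have hm : ∀ g : Lp ℂ 2 d.μ, MemLp (fun x => (b x : ℂ) * g x) 2 d.μ := fun g =>
    memLp_mu.2 (memLp_mul hb hC (memLp_mu.1 (Lp.memLp g)))
  let B₀ : Lp ℂ 2 d.μ →ₗ[ℂ] Lp ℂ 2 d.μ :=
    { toFun := fun g => (hm g).toLp _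
      map_add' := fun g₁ g₂ => by
        rw [← MemLp.toLp_add, MemLp.toLp_eq_toLp_iff]
        filter_upwards [Lp.coeFn_add g₁ g₂] with x hx
        simp only [hx, Pi.add_apply, mul_add]
      map_smul' := fun c g => by
        rw [RingHom.id_apply, ← MemLp.toLp_const_smul, MemLp.toLp_eq_toLp_iff]
        filter_upwards [Lp.coeFn_smul c g] with x hx
        simp only [hx, Pi.smul_apply, smul_eq_mul, mul_left_comm] }
  have hB₀ : ∀ g, (B₀ g : ℝ → ℂ) =ᵐ[d.μ] fun x => (b x : ℂ) * g x := fun g =>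
    MemLp.coeFn_toLp (hm g)
  refine ⟨B₀.mkContinuous C fun g => Lp.norm_le_mul_norm_of_ae_le_mul ?_, fun u v => ?_, hB₀⟩
  · have hI : ∀ᵐ x ∂d.μ, x ∈ d.I := by
      rw [ae_mu]; exact ae_restrict_mem measurableSet_Ioo
    filter_upwards [hB₀ g, hI] with x h1 hx
    rw [h1, norm_mul, Complex.norm_real]
    exact mul_le_mul_of_nonneg_right (hC x hx) (norm_nonneg _)
  · change inner ℂ (B₀ u) v = inner ℂ u (B₀ v)
    rw [inner_mu, inner_mu]
    refine integral_congr_mu ?_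
    filter_upwards [hB₀ u, hB₀ v] with x h1 h2
    rw [wt, wt, h1, h2, map_mul, Complex.conj_ofReal]
    ring

/-- Polynomials embed: one that vanishes almost everywhere on the interval has infinitely many
roots. -/
theorem not_finiteDimensional (d : SLData) : ¬ FiniteDimensional ℂ (Lp ℂ 2 d.μ) := by
  intro hfin
  have hb : ∀ p : Polynomial ℂ, MemLp (fun x : ℝ => p.eval (x : ℂ)) 2 d.μ := by
    intro p
    have hc : Continuous fun x : ℝ => p.eval (x : ℂ) := by fun_prop
    obtain ⟨C, hC⟩ := isCompact_Icc.exists_bound_of_continuousOn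
      (hc.continuousOn (s := Icc d.lo d.hi))
    refine MemLp.of_bound hc.aestronglyMeasurable C ?_
    rw [ae_mu]
    filter_upwards [ae_restrict_mem measurableSet_Ioo] with x hx
    exact hC x (Ioo_subset_Icc_self hx)
  let L : Polynomial ℂ →ₗ[ℂ] Lp ℂ 2 d.μ :=
    { toFun := fun p => (hb p).toLp _
      map_add' := fun p q => by
        rw [← MemLp.toLp_add, MemLp.toLp_eq_toLp_iff]
        exact ae_of_all _ fun x => by simp
      map_smul' := fun c p => by
        rw [RingHom.id_apply, ← MemLp.toLp_const_smul, MemLp.toLp_eq_toLp_iff]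
        exact ae_of_all _ fun x => by simp }
  have hL : Function.Injective L := by
    refine (injective_iff_map_eq_zero L).2 fun p hp => ?_
    have h1 : (fun x : ℝ => p.eval (x : ℂ)) =ᵐ[volume.restrict d.I] fun _ => 0 := by
      have h2 : (L p : ℝ → ℂ) =ᵐ[d.μ] fun x : ℝ => p.eval (x : ℂ) := MemLp.coeFn_toLp (hb p)
      rw [EventuallyEq, ← ae_mu]
      filter_upwards [h2, (Lp.eq_zero_iff_ae_eq_zero).1 hp] with x h3 h4
      rw [← h3, h4]; rfl
    have h3 := Measure.eqOn_open_of_ae_eq h1 isOpen_Ioo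
      (by fun_prop : Continuous fun x : ℝ => p.eval (x : ℂ)).continuousOn continuousOn_const
    refine Polynomial.eq_zero_of_infinite_isRoot p ?_
    refine ((Ioo_infinite d.lo_lt_hi).image Complex.ofReal_injective.injOn).mono ?_
    rintro _ ⟨x, hx, rfl⟩
    exact h3 hx
  exact Polynomial.not_finite (R := ℂ) (FiniteDimensional.of_injective L hL)

end SLData

/-! ### Realization of an expression with nonnegative potential. -/

namespace SLData

variable {d : SLData} {q : ℝ → ℝ} {f φ χ : ℝ → ℂ} {x : ℝ} {u v : Lp ℂ 2 d.μ}

variable (d) in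
/-- The Sturm–Liouville expression `((P f')' - q f) / ρ`. -/
def expr (q : ℝ → ℝ) (f : ℝ → ℂ) (y : ℝ) : ℂ :=
  ((1 / rho y : ℝ) : ℂ) * (deriv (fun x => (d.P x : ℂ) * deriv f x) y - (q y : ℂ) * f y)

variable (d) in
/-- The boundary conditions at end points with vanishing exponent. -/
def BC (f : ℝ → ℂ) : Prop :=
  (d.nl = 0 → Tendsto (fun x => ((x - d.lo : ℝ) : ℂ) * deriv f x) (𝓝[>] d.lo) (𝓝 0)) ∧
    (d.nr = 0 → Tendsto (fun x => ((x - d.hi : ℝ) : ℂ) * deriv f x) (𝓝[<] d.hi) (𝓝 0))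

variable (d) in
/-- The graph of the realization of the Sturm–Liouville expression. -/
def Graph (q : ℝ → ℝ) (u v : Lp ℂ 2 d.μ) : Prop :=
  ∃ f : ℝ → ℂ, IsAC d.lo d.hi f ∧ d.BC f ∧ (u : ℝ → ℂ) =ᵐ[d.μ] f ∧
    (v : ℝ → ℂ) =ᵐ[d.μ] d.expr q f

variable (d) in
/-- The difference of the potential and the comparison potential. -/
def rem (q : ℝ → ℝ) (y : ℝ) : ℝ := q y - d.dQ y / d.E y

theorem continuousOn_rem (hq : ContinuousOn q d.I) : ContinuousOn (d.rem q) d.I :=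
  hq.sub (continuousOn_dQ.div continuousOn_E fun _ hx => (E_pos hx).ne')

/-- `expr` contains a `deriv`, which takes the default value zero where the flux is not
differentiable. Local absolute continuity confines such points to a null set. -/
theorem hasDerivAt_flux_of_ae_eq (hf : IsAC d.lo d.hi f)
    (hv : (v : ℝ → ℂ) =ᵐ[d.μ] d.expr q f) :
    ∀ᵐ x ∂(volume.restrict d.I), HasDerivAt (fun x => (d.P x : ℂ) * deriv f x)
      ((q x : ℂ) * f x - -wt v x) x := by
  have hac : LocAC d.lo d.hi fun x => (d.P x : ℂ) * deriv f x :=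
    (LocAC.ofReal contDiff_P.contDiffOn).mul hf.locAC_deriv
  rw [EventuallyEq, ae_mu] at hv
  filter_upwards [hac.ae_differentiableAt, hv, ae_restrict_mem measurableSet_Ioo] with x h1 h2 hx
  refine h1.hasDerivAt.congr_deriv ?_
  have := Complex.ofReal_ne_zero.2 (rho_pos hx).ne'
  rw [wt, h2, expr]
  push_cast
  field_simp
  ring

theorem ae_eq_expr_of_flux
    (h : ∀ᵐ x ∂(volume.restrict d.I), HasDerivAt (fun x => (d.P x : ℂ) * deriv f x)
      ((q x : ℂ) * f x + wt v x) x) : (v : ℝ → ℂ) =ᵐ[d.μ] d.expr q f := by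
  rw [EventuallyEq, ae_mu]
  filter_upwards [h, ae_restrict_mem measurableSet_Ioo] with x h1 hx
  have := Complex.ofReal_ne_zero.2 (rho_pos hx).ne'
  rw [expr, h1.deriv, wt]
  push_cast
  field_simp
  ring

theorem memLp_of_ae_eq (hu : (u : ℝ → ℂ) =ᵐ[d.μ] f) : MemLp f 2 (volume.restrict d.I) :=
  memLp_mu.1 ((memLp_congr_ae hu).1 (Lp.memLp u))

/-- Moving the difference of the potentials into the source turns the equation into the comparison
equation, where uniqueness is known. -/
theorem eq_sol_of_graph (hf : IsAC d.lo d.hi f) (hbc : d.BC f) (hu : (u : ℝ → ℂ) =ᵐ[d.μ] f)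
    (hv : (v : ℝ → ℂ) =ᵐ[d.μ] d.expr q f) (hφ : MemLp φ 2 (volume.restrict d.I))
    (h : ∀ᵐ x ∂(volume.restrict d.I), φ x = -wt v x - (d.rem q x : ℂ) * f x) :
    ∀ x ∈ d.I, f x = d.sol φ x := by
  refine eq_sol hf (memLp_of_ae_eq hu) hφ ?_ hbc.1 hbc.2
  filter_upwards [hasDerivAt_flux_of_ae_eq hf hv, h] with x h1 h2
  refine h1.congr_deriv ?_
  rw [h2, rem]
  push_cast
  ring

theorem bc_sol (hφ : MemLp φ 2 (volume.restrict d.I)) : d.BC (d.sol φ) :=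
  ⟨fun h => tendsto_sub_lo_mul_deriv_sol h hφ, fun h => tendsto_sub_hi_mul_deriv_sol h hφ⟩

variable (d) in
/-- The coefficient of the eigenvalue equation. -/
def eigenCoeff (q : ℝ → ℝ) (ℓ : ℝ) (x : ℝ) : ℝ := rho x * ℓ - d.rem q x

theorem continuousOn_eigenCoeff (hq : ContinuousOn q d.I) (ℓ : ℝ) :
    ContinuousOn (d.eigenCoeff q ℓ) d.I :=
  (continuous_rho.continuousOn.mul continuousOn_const).sub (continuousOn_rem hq)

theorem exists_eigenCoeff_le {C : ℝ} (hC : ∀ x ∈ d.I, |d.rem q x| ≤ C) (ℓ : ℝ) :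
    ∃ M, ∀ x ∈ d.I, |d.eigenCoeff q ℓ x| ≤ M := by
  obtain ⟨c, C', hc, hC', hb⟩ := d.exists_rho_bounds
  refine ⟨C' * |ℓ| + C, fun x hx => (abs_sub _ _).trans (add_le_add ?_ (hC x hx))⟩
  rw [abs_mul, abs_of_pos (rho_pos hx)]
  exact mul_le_mul_of_nonneg_right (hb x hx).2 (abs_nonneg _)

/-- Eigenfunctions are fixed points of the solution operator. -/
theorem exists_sol_of_eigen (hq : ContinuousOn q d.I) {C : ℝ} (hC : ∀ x ∈ d.I, |d.rem q x| ≤ C)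
    {ℓ : ℝ} (h : d.Graph q u (((-ℓ : ℝ) : ℂ) • u)) :
    ∃ φ, MemLp φ 2 (volume.restrict d.I) ∧ (u : ℝ → ℂ) =ᵐ[volume.restrict d.I] d.sol φ ∧
      ∀ x ∈ d.I, φ x = (d.eigenCoeff q ℓ x : ℂ) * d.sol φ x := by
  obtain ⟨f, hf, hbc, hu, hv⟩ := h
  obtain ⟨M, hM⟩ := exists_eigenCoeff_le hC ℓ
  have hφ : MemLp (fun x => (d.eigenCoeff q ℓ x : ℂ) * f x) 2 (volume.restrict d.I) :=
    memLp_mul (continuousOn_eigenCoeff hq ℓ) hM (memLp_of_ae_eq hu)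
  have hu' := hu
  have hs := Lp.coeFn_smul (((-ℓ : ℝ) : ℂ)) u
  rw [EventuallyEq, ae_mu] at hu' hs
  have heq := eq_sol_of_graph hf hbc hu hv hφ (by
    filter_upwards [hu', hs] with x h1 h2
    rw [wt, h2, Pi.smul_apply, h1, eigenCoeff, smul_eq_mul]
    push_cast
    ring)
  refine ⟨_, hφ, ?_, fun x hx => by rw [← heq x hx]⟩
  filter_upwards [hu', ae_restrict_mem measurableSet_Ioo] with x h1 hx
  rw [h1, heq x hx]

/-- The realization of a Sturm–Liouville expression with nonnegative potential is self-adjoint,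
with simple discrete spectrum and with eigenfunctions decaying like the regular solutions. -/
theorem exists_realization (d : SLData) {q : ℝ → ℝ} (hq : ContinuousOn q d.I)
    (hq0 : ∀ x ∈ d.I, 0 ≤ q x) {C : ℝ} (hC : ∀ x ∈ d.I, |d.rem q x| ≤ C) :
    ∃ A : Lp ℂ 2 d.μ →ₗ.[ℂ] Lp ℂ 2 d.μ, (∀ u v, (u, v) ∈ A.graph ↔ d.Graph q u v) ∧
      Dense (A.domain : Set (Lp ℂ 2 d.μ)) ∧ IsSelfAdjoint A ∧
      (∀ u : A.domain, 0 ≤ (inner ℂ (u : Lp ℂ 2 d.μ) (-(A u))).re) ∧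
      ∃ ℓ : ℕ → ℝ, StrictMono ℓ ∧ Tendsto ℓ atTop atTop ∧
        spectrum A = range (fun k : ℕ => ((-(ℓ k) : ℝ) : ℂ)) ∧
        ∀ k : ℕ, Module.finrank ℂ (eigenspace A ((-(ℓ k) : ℝ) : ℂ)) = 1 ∧
          ∀ u ∈ eigenspace A ((-(ℓ k) : ℝ) : ℂ), ∀ f : ℝ → ℂ, IsAC d.lo d.hi f →
            (u : ℝ → ℂ) =ᵐ[d.μ] f →
            f =O[𝓝[<] d.hi] (fun y : ℝ => (d.hi - y) ^ d.nr) ∧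
            f =O[𝓝[>] d.lo] (fun y : ℝ => (y - d.lo) ^ d.nl) := by
  obtain ⟨R₀, hRc, hRs, hRi, hR⟩ := d.exists_solution_operator
  obtain ⟨c, C', hc, hC', hrb⟩ := d.exists_rho_bounds
  have hbc : ContinuousOn (fun x => d.rem q x / rho x) d.I :=
    (continuousOn_rem hq).div continuous_rho.continuousOn fun x hx => (rho_pos hx).ne'
  -- `B` is the correction in `-A = R₀⁻¹ + B`; the division by `ρ` undoes the weight that `R₀` puts
  -- on its source.
  obtain ⟨B, hBs, hB⟩ := d.exists_multiplication_operator hbc (C := C / c) (fun x hx => by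
    rw [abs_div, abs_of_pos (rho_pos hx)]
    exact div_le_div₀ ((abs_nonneg _).trans (hC x hx)) (hC x hx) hc (hrb x hx).1)
  have hwt : ∀ u v : Lp ℂ 2 d.μ, ∀ᵐ x ∂(volume.restrict d.I),
      wt (-v - B u : Lp ℂ 2 d.μ) x = -wt v x - (d.rem q x : ℂ) * u x := by
    intro u v
    have h1 := Lp.coeFn_sub (-v) (B u)
    have h2 := Lp.coeFn_neg v
    have h3 := hB u
    rw [EventuallyEq, ae_mu] at h1 h2 h3
    filter_upwards [h1, h2, h3, ae_restrict_mem measurableSet_Ioo] with x g1 g2 g3 hx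
    have := Complex.ofReal_ne_zero.2 (rho_pos hx).ne'
    rw [wt, g1, Pi.sub_apply, g2, Pi.neg_apply, g3, wt]
    push_cast
    field_simp
  have hΓ : ∀ u v, d.Graph q u v ↔ u = R₀ (-v - B u) := by
    intro u v
    have hφ := memLp_wt_coe (-v - B u : Lp ℂ 2 d.μ)
    constructor
    · rintro ⟨f, hf, hb, hu, hv⟩
      have hu' := hu
      rw [EventuallyEq, ae_mu] at hu'
      have heq := eq_sol_of_graph hf hb hu hv hφ (by
        filter_upwards [hwt u v, hu'] with x h1 h2
        rw [h1, h2])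
      refine Lp.ext ?_
      have hI : ∀ᵐ x ∂d.μ, x ∈ d.I := by
        rw [ae_mu]; exact ae_restrict_mem measurableSet_Ioo
      filter_upwards [hu, hR (-v - B u), hI] with x h1 h2 hx
      rw [h1, h2, heq x hx]
    · intro h
      have hu : (u : ℝ → ℂ) =ᵐ[d.μ] d.sol (wt (-v - B u : Lp ℂ 2 d.μ)) := by
        have := hR (-v - B u)
        rwa [← h] at this
      refine ⟨_, isAC_sol hφ, bc_sol hφ, hu, ae_eq_expr_of_flux ?_⟩
      rw [EventuallyEq, ae_mu] at hu
      filter_upwards [ae_hasDerivAt_flux_sol hφ, hwt u v, hu] with x h1 h2 h3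
      refine h1.congr_deriv ?_
      rw [h2, h3, rem]
      push_cast
      ring
  have hnn : ∀ u v, d.Graph q u v → 0 ≤ (inner ℂ u (-v)).re := by
    rintro u v hg
    have hφ := memLp_wt_coe (-v - B u : Lp ℂ 2 d.μ)
    obtain ⟨f, hf, hb, hu, hv⟩ := hg
    have hu' := hu
    rw [EventuallyEq, ae_mu] at hu'
    have heq := eq_sol_of_graph hf hb hu hv hφ (by
      filter_upwards [hwt u v, hu'] with x h1 h2
      rw [h1, h2])
    obtain ⟨M, hM, hsol⟩ := d.exists_sol_le
    have hψ := (memLp_wt_coe v).neg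
    -- Every element of the domain is a Green solution, which supplies the boundedness required by
    -- the form estimate.
    have key := integral_re_nonneg hf (fun x hx => by rw [heq x hx]; exact hsol _ hφ x hx) hψ hq0
      (hasDerivAt_flux_of_ae_eq hf hv)
    have e1 : inner ℂ u (-v) = ∫ x in d.lo..d.hi, (-wt v) x * (starRingEnd ℂ) (f x) := by
      rw [inner_mu]
      refine integral_congr_mu ?_
      filter_upwards [hu, Lp.coeFn_neg v] with x h1 h2
      rw [wt, h2, h1, Pi.neg_apply, Pi.neg_apply, wt]
      ring
    rw [e1]
    have hint : IntervalIntegrable (fun x => (-wt v) x * (starRingEnd ℂ) (f x)) volume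
        d.lo d.hi := intervalIntegrable_mul hψ (MemLp.star (memLp_of_ae_eq hu))
    rw [intervalIntegral.integral_of_le d.lo_lt_hi.le] at key ⊢
    exact key.trans_eq (integral_re hint.1)
  have hsimple : ∀ ℓ : ℝ, ∀ u, d.Graph q u (((-ℓ : ℝ) : ℂ) • u) → u ≠ 0 →
      ∀ v, d.Graph q v (((-ℓ : ℝ) : ℂ) • v) → ∃ c : ℂ, c • u = v := by
    intro ℓ u hu hu0 v hv
    obtain ⟨φ, hφ, huφ, hφs⟩ := exists_sol_of_eigen hq hC hu
    obtain ⟨χ, hχ, hvχ, hχs⟩ := exists_sol_of_eigen hq hC hv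
    have hne : ∃ x₀ ∈ d.I, d.sol φ x₀ ≠ 0 := by
      by_contra! hall
      refine hu0 ((Lp.eq_zero_iff_ae_eq_zero).2 ?_)
      rw [EventuallyEq, ae_mu]
      filter_upwards [huφ, ae_restrict_mem measurableSet_Ioo] with x h1 hx
      rw [h1, hall x hx]; rfl
    obtain ⟨x₀, hx₀, hx₀'⟩ := hne
    obtain ⟨c, hcs⟩ := exists_eq_const_mul_sol hφ hχ (continuousOn_eigenCoeff hq ℓ) hφs hχs hx₀ hx₀'
    refine ⟨c, Lp.ext ?_⟩
    have hs := Lp.coeFn_smul c u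
    rw [EventuallyEq, ae_mu] at hs ⊢
    filter_upwards [hs, huφ, hvχ, ae_restrict_mem measurableSet_Ioo] with x h1 h2 h3 hx
    rw [h1, Pi.smul_apply, h2, h3, hcs x hx, smul_eq_mul]
  obtain ⟨A, hA, hdense, hsa, hpos, ℓ, hmono, htend, hspec, hrank⟩ :=
    isSelfAdjoint_discrete_of_perturbation hRc hRs hBs hRi hΓ hnn d.not_finiteDimensional hsimple
  refine ⟨A, hA, hdense, hsa, hpos, ℓ, hmono, htend, hspec, fun k => ⟨hrank k, ?_⟩⟩
  intro u hu f hf huf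
  have hg : d.Graph q u (((-(ℓ k) : ℝ) : ℂ) • u) := (hA _ _).1 hu
  obtain ⟨φ, hφ, huφ, hφs⟩ := exists_sol_of_eigen hq hC hg
  obtain ⟨M, hM⟩ := exists_eigenCoeff_le hC (ℓ k)
  have hO := isBigO_sol hφ (M := M) fun x hx => by
    rw [hφs x hx, norm_mul, Complex.norm_real]
    exact mul_le_mul_of_nonneg_right (hM x hx) (norm_nonneg _)
  -- Two continuous representatives of one class agree everywhere, so the decay of the Green
  -- solution passes to any `f` of class `AC`.
  have hfs : EqOn f (d.sol φ) d.I := by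
    have huf' : (u : ℝ → ℂ) =ᵐ[volume.restrict d.I] f := by rwa [EventuallyEq, ← ae_mu]
    refine Measure.eqOn_open_of_ae_eq (huf'.symm.trans huφ) isOpen_Ioo hf.locAC.continuousOn
      (continuousOn_sol hφ)
  refine ⟨hO.1.congr' ?_ EventuallyEq.rfl, hO.2.congr' ?_ EventuallyEq.rfl⟩
  · filter_upwards [d.eventually_right] with x hx using (hfs hx).symm
  · filter_upwards [d.eventually_left] with x hx using (hfs hx).symm

end SLData

/-! ### Bounded difference between the potential and the comparison potential. -/

/-- A `C¹` function is Lipschitz, hence at most a multiple of the distance to the nearer zero; the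
farther end point is at least half the length away, whence the factor `2 / (β - α)`. -/
theorem exists_le_mul_of_contDiffOn {α β : ℝ} {N : ℝ → ℝ} (hαβ : α < β)
    (hN : ContDiffOn ℝ 1 N (Icc α β)) (hα : N α = 0) (hβ : N β = 0) :
    ∃ C, 0 ≤ C ∧ ∀ y ∈ Ioo α β, |N y| ≤ C * ((y - α) * (β - y)) := by
  obtain ⟨L, hL⟩ := isCompact_Icc.exists_bound_of_continuousOn
    (hN.continuousOn_derivWithin (uniqueDiffOn_Icc hαβ) le_rfl)
  have hD : 0 < β - α := sub_pos.2 hαβ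
  have hL0 : 0 ≤ L := (norm_nonneg _).trans (hL α (left_mem_Icc.2 hαβ.le))
  have key : ∀ x ∈ Icc α β, ∀ y ∈ Icc α β, ‖N y - N x‖ ≤ L * ‖y - x‖ := fun x hx y hy =>
    (convex_Icc α β).norm_image_sub_le_of_norm_derivWithin_le
      (hN.differentiableOn one_ne_zero) hL hx hy
  refine ⟨L * (2 / (β - α)), by positivity, fun y hy => ?_⟩
  have hl : 0 < y - α := sub_pos.2 hy.1
  have hr : 0 < β - y := sub_pos.2 hy.2
  have h1 := key α (left_mem_Icc.2 hαβ.le) y (Ioo_subset_Icc_self hy)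
  have h2 := key β (right_mem_Icc.2 hαβ.le) y (Ioo_subset_Icc_self hy)
  rw [hα, sub_zero, Real.norm_eq_abs, Real.norm_of_nonneg hl.le] at h1
  rw [hβ, sub_zero, Real.norm_eq_abs, norm_sub_rev, Real.norm_of_nonneg hr.le] at h2
  have e : L * (2 / (β - α)) * ((y - α) * (β - y)) = L * (2 * ((y - α) * (β - y)) / (β - α)) := by
    ring
  rw [e]
  rcases le_total (y - α) (β - y) with h | h
  · refine h1.trans (mul_le_mul_of_nonneg_left ((le_div_iff₀ hD).2 ?_) hL0)
    nlinarith
  · refine h2.trans (mul_le_mul_of_nonneg_left ((le_div_iff₀ hD).2 ?_) hL0)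
    nlinarith

namespace SLData

variable {d : SLData} {q : ℝ → ℝ} {x y : ℝ}

/-- Isolates the poles of the comparison potential, whose coefficients involve only the squares of
the exponents. In the remainder `E` enters only through the bounded quotient `E1 / E`. -/
theorem dQ_div_E (hy : y ∈ d.I) : d.dQ y / d.E y =
    2 / 9 * (d.y3 - y) * (d.nl ^ 2 * (d.hi - y) ^ 2 + d.nr ^ 2 * (y - d.lo) ^ 2) /
      ((y - d.lo) * (d.hi - y)) +
    (2 / 9 * (d.y3 - y) * (-d.nl + (1 + 2 * d.nl) * (d.E1 y / d.E y)) -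
      2 / 9 * (d.nl * (d.hi - y) + (y - d.lo) * (d.E1 y / d.E y))) := by
  have h1 := (left_pos hy).ne'
  have h2 := (right_pos hy).ne'
  have h3 := (E_pos hy).ne'
  rw [dQ, dE]
  field_simp
  ring

/-- If the singular part of the potential has the right coefficients at the end points, then the
potential differs from the comparison potential by a bounded function. -/
theorem exists_rem_le (d : SLData) {G M : ℝ → ℝ} (hG : ContinuousOn G (Icc d.lo d.hi))
    (hM : ContDiffOn ℝ 1 M (Icc d.lo d.hi))
    (hlo : M d.lo = 2 / 9 * (d.y3 - d.lo) * (d.nl ^ 2 * (d.hi - d.lo) ^ 2))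
    (hhi : M d.hi = 2 / 9 * (d.y3 - d.hi) * (d.nr ^ 2 * (d.hi - d.lo) ^ 2))
    (hq : ∀ y ∈ d.I, q y = G y + M y / ((y - d.lo) * (d.hi - y))) :
    ∃ C, ∀ y ∈ d.I, |d.rem q y| ≤ C := by
  obtain ⟨C₁, hC₁⟩ := isCompact_Icc.exists_bound_of_continuousOn hG
  -- By `hlo` and `hhi` the difference of the two numerators vanishes at both end points, so
  -- dividing by the poles leaves a bounded function.
  obtain ⟨C₂, hC₂, hN⟩ := exists_le_mul_of_contDiffOn (N := fun y => M y - 2 / 9 * (d.y3 - y) *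
    (d.nl ^ 2 * (d.hi - y) ^ 2 + d.nr ^ 2 * (y - d.lo) ^ 2)) d.lo_lt_hi
    (hM.sub (by fun_prop)) (by simp only [hlo]; ring) (by simp only [hhi]; ring)
  have hnl := d.nl_nonneg
  have hnr := d.nr_nonneg
  have hD := d.len_pos
  set A := d.nr + 1 with hA
  set D := d.hi - d.lo with hDdef
  refine ⟨C₁ + C₂ + (2 / 9 * (d.y3 - d.lo) * (d.nl + (1 + 2 * d.nl) * A) +
    2 / 9 * (d.nl * D + D * A)), fun y hy => ?_⟩
  have hl := left_pos hy
  have hr := right_pos hy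
  have hE := E_pos hy
  have he0 : 0 ≤ d.E1 y / d.E y := div_nonneg (E1_nonneg hy) hE.le
  have he1 : d.E1 y / d.E y ≤ A := (div_le_iff₀ hE).2 (E1_le hy)
  set e := d.E1 y / d.E y with hedef
  have hk0 : 0 ≤ d.y3 - y := by linarith [d.hi_lt_y3]
  have hk1 : d.y3 - y ≤ d.y3 - d.lo := by linarith
  have hsplit : d.rem q y = G y + (M y - 2 / 9 * (d.y3 - y) *
      (d.nl ^ 2 * (d.hi - y) ^ 2 + d.nr ^ 2 * (y - d.lo) ^ 2)) / ((y - d.lo) * (d.hi - y)) -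
      (2 / 9 * (d.y3 - y) * (-d.nl + (1 + 2 * d.nl) * e) -
      2 / 9 * (d.nl * (d.hi - y) + (y - d.lo) * e)) := by
    rw [rem, dQ_div_E hy, hq y hy, sub_div]
    ring
  rw [hsplit]
  refine (abs_sub _ _).trans (add_le_add ((abs_add_le _ _).trans (add_le_add ?_ ?_))
    ((abs_sub _ _).trans (add_le_add ?_ ?_)))
  · exact hC₁ y (Ioo_subset_Icc_self hy)
  · rw [abs_div, abs_of_pos (mul_pos hl hr)]
    exact (div_le_iff₀ (mul_pos hl hr)).2 (hN y hy)
  · rw [abs_mul, abs_of_nonneg (by positivity)]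
    have h1 : |-d.nl + (1 + 2 * d.nl) * e| ≤ d.nl + (1 + 2 * d.nl) * A := by
      refine (abs_add_le _ _).trans (add_le_add ?_ ?_)
      · rw [abs_neg, abs_of_nonneg hnl]
      · rw [abs_of_nonneg (by positivity)]
        gcongr
    have hk2 : 0 ≤ d.y3 - d.lo := hk0.trans hk1
    gcongr
  · rw [abs_of_nonneg (by positivity)]
    have h1 := left_le hy
    have h2 := right_le hy
    gcongr

end SLData

/-! ### The coefficients of the operator -/

section Coefficients

variable {a ym yp : ℝ}

theorem exists_cubic_root_lt_one (ha0 : 0 < a) (ha1 : a < 1) : ∃ y, 0 < y ∧ y < 1 ∧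
    cubic a y = 0 := by
  have hc : ContinuousOn (cubic a) (Icc 0 1) := by unfold cubic; fun_prop
  have h0 : (0 : ℝ) ∈ Ioo (cubic a 1) (cubic a 0) := by
    constructor <;> simp only [cubic] <;> linarith
  obtain ⟨y, hy, h⟩ := intermediate_value_Ioo' zero_le_one hc h0
  exact ⟨y, hy.1, hy.2, h⟩

/-- Vieta's relation for the two roots. -/
theorem roots_relation (hne : ym ≠ yp) (hm : cubic a ym = 0) (hp : cubic a yp = 0) :
    3 * (ym + yp) = 2 * (ym ^ 2 + ym * yp + yp ^ 2) := by
  have h : (ym - yp) * (3 * (ym + yp) - 2 * (ym ^ 2 + ym * yp + yp ^ 2)) = 0 := by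
    rw [cubic] at hm hp
    linear_combination hp - hm
  rcases mul_eq_zero.1 h with h | h
  · exact absurd (sub_eq_zero.1 h) hne
  · linarith

/-- The three roots sum to `3/2`, which determines the third factor. -/
theorem cubic_eq_mul (hne : ym ≠ yp) (hm : cubic a ym = 0) (hp : cubic a yp = 0) (y : ℝ) :
    cubic a y = 2 * ((y - ym) * (yp - y) * (3 / 2 - ym - yp - y)) := by
  have hv := roots_relation hne hm hp
  rw [cubic] at hm hp ⊢
  linear_combination hm - (y - ym) * hv

/-- At a root `a - y² = 2 y² (1 - y)`, which is positive; between the roots concavity of `a - y²`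
applies. -/
theorem sub_sq_pos_of_mem (hym : ym < 0) (hyp : 0 < yp) (hyp1 : yp < 1) (hm : cubic a ym = 0)
    (hp : cubic a yp = 0) {y : ℝ} (hy : y ∈ Icc ym yp) : 0 < a - y ^ 2 := by
  rw [cubic] at hm hp
  have h1 : 0 < a - ym ^ 2 := by nlinarith [mul_pos (sq_pos_of_neg hym) (by linarith : 0 < 1 - ym)]
  have h2 : 0 < a - yp ^ 2 := by nlinarith [mul_pos (pow_pos hyp 2) (by linarith : 0 < 1 - yp)]
  have h3 : (yp - ym) * (a - y ^ 2) = (yp - y) * (a - ym ^ 2) + (y - ym) * (a - yp ^ 2) +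
      (yp - ym) * ((y - ym) * (yp - y)) := by ring
  have h4 : 0 ≤ y - ym := by linarith [hy.1]
  have h5 : 0 ≤ yp - y := by linarith [hy.2]
  have h6 : 0 < yp - ym := by linarith
  have h7 : 0 < (yp - ym) * (a - y ^ 2) := by
    rw [h3]
    rcases h4.eq_or_lt with h | h
    · have : 0 < yp - y := by linarith
      positivity
    · positivity
  exact pos_of_mul_pos_right h7 h6.le

/-- Substituting `a = 3 y² - 2 y³` eliminates `a`. The formula shows `h a yp ≠ 0`, without which
`tau` would vanish and `freq` would be a division by zero. -/
theorem h_of_root {y : ℝ} (hy : cubic a y = 0) (hy0 : y ≠ 0) (hy1 : y ≠ 1) :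
    h a y = -(1 - y) / (6 * y) := by
  have ha : a = 3 * y ^ 2 - 2 * y ^ 3 := by rw [cubic] at hy; linarith
  have h1 : 1 - y ≠ 0 := sub_ne_zero.2 hy1.symm
  have e1 : a - y ^ 2 = 2 * y ^ 2 * (1 - y) := by rw [ha]; ring
  have e2 : a - 2 * y + y ^ 2 = -2 * y * (1 - y) ^ 2 := by rw [ha]; ring
  rw [h, e1, e2]
  field_simp

variable {p q : ℕ} {m l : ℤ}

theorem h_mul_freq_right (hq : 0 < q) (hh : h a yp ≠ 0) :
    h a yp * freq a yp p q l = -((q : ℝ) * sigma p q * l / 2) := by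
  have hq' : (q : ℝ) ≠ 0 := by positivity
  rw [freq, tau]
  field_simp

/-- The quotient condition says `q h(y₋) = (q - 2p) h(y₊)`, so the value at the left root follows
from the one at the right root. -/
theorem h_mul_freq_left (hq : 0 < q) (hh : h a yp ≠ 0)
    (hapq : (h a yp - h a ym) / (2 * h a yp) = (p : ℝ) / q) :
    h a ym * freq a yp p q l = (2 * (p : ℝ) - q) * sigma p q * l / 2 := by
  have hq' : (q : ℝ) ≠ 0 := by positivity
  have h1 := h_mul_freq_right (p := p) (l := l) hq hh
  rw [div_eq_div_iff (mul_ne_zero two_ne_zero hh) hq'] at hapq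
  have h2 : (q : ℝ) * (h a ym * freq a yp p q l) =
      (q - 2 * p) * (h a yp * freq a yp p q l) := by
    linear_combination -(freq a yp p q l) * hapq
  rw [h1] at h2
  exact mul_left_cancel₀ hq' (by rw [h2]; ring)

theorem nuPlus_sq (hq : 0 < q) (hh : h a yp ≠ 0) :
    (2 * (m : ℝ) - h a yp * freq a yp p q l) ^ 2 = 4 * nuPlus p q m l ^ 2 := by
  rw [h_mul_freq_right hq hh, nuPlus, sq_abs]
  ring

theorem nuMinus_sq (hq : 0 < q) (hh : h a yp ≠ 0)
    (hapq : (h a yp - h a ym) / (2 * h a yp) = (p : ℝ) / q) :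
    (2 * (m : ℝ) - h a ym * freq a yp p q l) ^ 2 = 4 * nuMinus p q m l ^ 2 := by
  rw [h_mul_freq_left hq hh hapq, nuMinus, sq_abs]
  ring

theorem abs_half_int (n : ℤ) : |(n : ℝ) / 2| = 0 ∨ 1 / 2 ≤ |(n : ℝ) / 2| := by
  rcases eq_or_ne n 0 with rfl | hn
  · left; simp
  · right
    have : (1 : ℝ) ≤ |(n : ℝ)| := by exact_mod_cast Int.one_le_abs hn
    rw [abs_div, abs_two]
    linarith

/-- Evenness of `sigma` makes the exponent half an integer in absolute value. The gap up to `1/2` is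
exactly what excludes square integrable power-type singular solutions. -/
theorem nuPlus_dichotomy : nuPlus p q m l = 0 ∨ 1 / 2 ≤ nuPlus p q m l := by
  obtain ⟨s, hs⟩ : 2 ∣ sigma p q := Nat.dvd_lcm_left _ _
  have : (m : ℝ) + (q : ℝ) * (sigma p q : ℝ) * (l : ℝ) / 4 = ((2 * m + q * s * l : ℤ) : ℝ) / 2 := by
    rw [hs]; push_cast; ring
  rw [nuPlus, this]
  exact abs_half_int _

theorem nuMinus_dichotomy : nuMinus p q m l = 0 ∨ 1 / 2 ≤ nuMinus p q m l := by
  obtain ⟨s, hs⟩ : 2 ∣ sigma p q := Nat.dvd_lcm_left _ _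
  have : (m : ℝ) + ((q : ℝ) - 2 * (p : ℝ)) * (sigma p q : ℝ) * (l : ℝ) / 4 =
      ((2 * m + (q - 2 * p) * s * l : ℤ) : ℝ) / 2 := by
    rw [hs]; push_cast; ring
  rw [nuMinus, this]
  exact abs_half_int _

end Coefficients

/-! ### The singular part of the potential and the characteristic exponents. -/

section Potential

variable {a ym yp : ℝ}

/-- The potential of the operator, multiplied by the weight. -/
def potential (a yp : ℝ) (p q : ℕ) (m l : ℤ) (Λ y : ℝ) : ℝ :=
  rho y * (1 / w a y * freq a yp p q l ^ 2 +
    9 / r a y * (2 * (m : ℝ) - h a y * freq a yp p q l) ^ 2 + 6 * Λ / (1 - y))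

/-- The regular part of the potential. -/
def regularPart (a yp : ℝ) (p q : ℕ) (l : ℤ) (Λ y : ℝ) : ℝ :=
  (1 - y) ^ 2 * freq a yp p q l ^ 2 / (36 * (a - y ^ 2)) + Λ / 3

/-- The coefficient of the singular part of the potential. -/
def singularCoeff (a ym yp : ℝ) (p q : ℕ) (m l : ℤ) (y : ℝ) : ℝ :=
  (1 - y) * (a - y ^ 2) * (2 * (m : ℝ) - h a y * freq a yp p q l) ^ 2 /
    (4 * (3 / 2 - ym - yp - y))

/-- Only `1 / r` has poles at the end points. The third root of the cubic lies outside the interval,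
so its factor is absorbed in `singularCoeff`; `ρ / w` and the `Λ` term are regular. -/
theorem potential_eq {p q : ℕ} {m l : ℤ} {Λ y : ℝ} (hne : ym ≠ yp) (hm : cubic a ym = 0)
    (hp : cubic a yp = 0) (h1 : y ≠ 1) (h2 : a - y ^ 2 ≠ 0) (hl : y - ym ≠ 0)
    (hr : yp - y ≠ 0) : potential a yp p q m l Λ y =
      regularPart a yp p q l Λ y + singularCoeff a ym yp p q m l y / ((y - ym) * (yp - y)) := by
  have h1' : 1 - y ≠ 0 := sub_ne_zero.2 h1.symm
  have hc := cubic_eq_mul hne hm hp y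
  rw [cubic] at hc
  rw [potential, regularPart, singularCoeff, rho, w, r, hc]
  generalize 2 * (m : ℝ) - h a y * freq a yp p q l = g
  field_simp
  ring

theorem contDiffOn_singularCoeff {p q : ℕ} {m l : ℤ} (h2 : ∀ y ∈ Icc ym yp, a - y ^ 2 ≠ 0)
    (h3 : ∀ y ∈ Icc ym yp, 3 / 2 - ym - yp - y ≠ 0) :
    ContDiffOn ℝ 1 (singularCoeff a ym yp p q m l) (Icc ym yp) := by
  have hh : ContDiffOn ℝ 1 (h a) (Icc ym yp) := by
    unfold h
    exact ContDiffOn.div (by fun_prop) (by fun_prop) fun y hy =>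
      mul_ne_zero (by norm_num) (h2 y hy)
  unfold singularCoeff
  refine ContDiffOn.div ?_ (by fun_prop) fun y hy => mul_ne_zero (by norm_num) (h3 y hy)
  fun_prop

theorem continuousOn_regularPart {p q : ℕ} {l : ℤ} {Λ : ℝ}
    (h2 : ∀ y ∈ Icc ym yp, a - y ^ 2 ≠ 0) :
    ContinuousOn (regularPart a yp p q l Λ) (Icc ym yp) := by
  unfold regularPart
  refine ContinuousOn.add (ContinuousOn.div (by fun_prop) (by fun_prop) fun y hy =>
    mul_ne_zero (by norm_num) (h2 y hy)) continuousOn_const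

/-- This is the indicial equation at `ym`. Half the derivative of the cubic there is `-3 ym (1 -
ym)`, which equals the product of the differences to the other two roots; combined with `a - ym² = 2
ym² (1 - ym)` it makes `nuMinus` the exponent. -/
theorem singularCoeff_left {p q : ℕ} {m l : ℤ} (hlt : ym < yp)
    (hm : cubic a ym = 0) (hp : cubic a yp = 0) (h3 : 0 < 3 / 2 - ym - yp - ym)
    (hnu : (2 * (m : ℝ) - h a ym * freq a yp p q l) ^ 2 = 4 * nuMinus p q m l ^ 2) :
    singularCoeff a ym yp p q m l ym =
      2 / 9 * (3 / 2 - ym - yp - ym) * (nuMinus p q m l ^ 2 * (yp - ym) ^ 2) := by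
  have hv := roots_relation hlt.ne hm hp
  have ha : a - ym ^ 2 = 2 * ym ^ 2 * (1 - ym) := by rw [cubic] at hm; linear_combination hm
  have hk : (yp - ym) * (3 / 2 - ym - yp - ym) = -3 * ym * (1 - ym) := by
    linear_combination hv / 2
  have hk2 : (yp - ym) ^ 2 * (3 / 2 - ym - yp - ym) ^ 2 = 9 * ym ^ 2 * (1 - ym) ^ 2 := by
    rw [← mul_pow, hk]; ring
  rw [singularCoeff, hnu, ha, div_eq_iff (by positivity)]
  linear_combination -(8 / 9) * nuMinus p q m l ^ 2 * hk2

theorem singularCoeff_right {p q : ℕ} {m l : ℤ} (hlt : ym < yp)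
    (hm : cubic a ym = 0) (hp : cubic a yp = 0) (h3 : 0 < 3 / 2 - ym - yp - yp)
    (hnu : (2 * (m : ℝ) - h a yp * freq a yp p q l) ^ 2 = 4 * nuPlus p q m l ^ 2) :
    singularCoeff a ym yp p q m l yp =
      2 / 9 * (3 / 2 - ym - yp - yp) * (nuPlus p q m l ^ 2 * (yp - ym) ^ 2) := by
  have hv := roots_relation hlt.ne hm hp
  have ha : a - yp ^ 2 = 2 * yp ^ 2 * (1 - yp) := by rw [cubic] at hp; linear_combination hp
  have hk : (yp - ym) * (3 / 2 - ym - yp - yp) = 3 * yp * (1 - yp) := by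
    linear_combination -hv / 2
  have hk2 : (yp - ym) ^ 2 * (3 / 2 - ym - yp - yp) ^ 2 = 9 * yp ^ 2 * (1 - yp) ^ 2 := by
    rw [← mul_pow, hk]; ring
  rw [singularCoeff, hnu, ha, div_eq_iff (by positivity)]
  linear_combination -(8 / 9) * nuPlus p q m l ^ 2 * hk2

theorem nuMinus_eq_zero_iff {p q : ℕ} {m l : ℤ} : nuMinus p q m l = 0 ↔
    (m : ℝ) = (2 * (p : ℝ) - (q : ℝ)) * (sigma p q : ℝ) * (l : ℝ) / 4 := by
  rw [nuMinus, abs_eq_zero]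
  constructor <;> intro h <;> linear_combination h

theorem nuPlus_eq_zero_iff {p q : ℕ} {m l : ℤ} : nuPlus p q m l = 0 ↔
    (m : ℝ) = -((q : ℝ) * (sigma p q : ℝ) * (l : ℝ) / 4) := by
  rw [nuPlus, abs_eq_zero]
  constructor <;> intro h <;> linear_combination h

end Potential

end Ypq

end

/-! ### Application to the operator `S`. -/

theorem lemma3p2
    (a ym yp : ℝ) (ha0 : 0 < a) (ha1 : a < 1)
    (hym : ym < 0 ∧ Ypq.cubic a ym = 0)
    (hyp : IsLeast {y : ℝ | 0 < y ∧ Ypq.cubic a y = 0} yp)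
    (p q : ℕ) (hp : 0 < p) (hq : 0 < q) (hq2p : q < 2 * p) (hpq : Nat.Coprime p q)
    (hapq : (Ypq.h a yp - Ypq.h a ym) / (2 * Ypq.h a yp) = (p : ℝ) / (q : ℝ))
    (m l : ℤ) (Λ : ℝ) (hΛ : 0 ≤ Λ) :
    ∃ A : Ypq.H ym yp →ₗ.[ℂ] Ypq.H ym yp,
      Ypq.IsRealization a ym yp p q m l Λ A ∧
      Dense (A.domain : Set (Ypq.H ym yp)) ∧
      IsSelfAdjoint A ∧
      (∀ u : A.domain, 0 ≤ (inner ℂ (u : Ypq.H ym yp) (-(A u))).re) ∧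
      ∃ ℓ : ℕ → ℝ, StrictMono ℓ ∧ Tendsto ℓ atTop atTop ∧
        Ypq.spectrum A = Set.range (fun k : ℕ => ((-(ℓ k) : ℝ) : ℂ)) ∧
        ∀ k : ℕ,
          Module.finrank ℂ (Ypq.eigenspace A ((-(ℓ k) : ℝ) : ℂ)) = 1 ∧
          ∀ u ∈ Ypq.eigenspace A ((-(ℓ k) : ℝ) : ℂ), ∀ f : ℝ → ℂ, Ypq.IsAC ym yp f →
            (u : ℝ → ℂ) =ᵐ[Ypq.rhoMeasure ym yp] f →
            f =O[𝓝[<] yp] (fun y : ℝ => (yp - y) ^ Ypq.nuPlus p q m l) ∧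
            f =O[𝓝[>] ym] (fun y : ℝ => (y - ym) ^ Ypq.nuMinus p q m l) := by
  obtain ⟨hym0, hm⟩ := hym
  obtain ⟨⟨hyp0, hpr⟩, hleast⟩ := hyp
  have hlt : ym < yp := hym0.trans hyp0
  have hyp1 : yp < 1 := by
    obtain ⟨y, hy0, hy1, hy⟩ := Ypq.exists_cubic_root_lt_one ha0 ha1
    exact (hleast ⟨hy0, hy⟩).trans_lt hy1
  -- The cubic is `a - 1 < 0` at `1`, while `1 - ym > 0 > yp - 1` there, so the third root must
  -- exceed `1`.
  have hy3 : 1 < 3 / 2 - ym - yp := by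
    have h1 := Ypq.cubic_eq_mul hlt.ne hm hpr 1
    have h2 : Ypq.cubic a 1 < 0 := by rw [Ypq.cubic]; linarith
    by_contra! hcon
    have : 0 ≤ (1 - ym) * (1 - yp) * (1 - (3 / 2 - ym - yp)) :=
      mul_nonneg (mul_nonneg (by linarith) (by linarith)) (by linarith)
    nlinarith
  have hasq : ∀ y ∈ Icc ym yp, 0 < a - y ^ 2 := fun y hy =>
    Ypq.sub_sq_pos_of_mem hym0 hyp0 hyp1 hm hpr hy
  have h3 : ∀ y ∈ Icc ym yp, 0 < 3 / 2 - ym - yp - y := fun y hy => by linarith [hy.2]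
  have hh : Ypq.h a yp ≠ 0 := by
    rw [Ypq.h_of_root hpr hyp0.ne' hyp1.ne]
    exact div_ne_zero (by linarith) (by linarith)
  -- The factor `y3` is the third root of the cubic, so that `P` coincides with `ρ w r` on the
  -- interval.
  let d : Ypq.SLData :=
    { lo := ym
      hi := yp
      y3 := 3 / 2 - ym - yp
      nl := Ypq.nuMinus p q m l
      nr := Ypq.nuPlus p q m l
      lo_lt_hi := hlt
      hi_lt_one := hyp1
      hi_lt_y3 := hyp1.trans hy3
      hnl := Ypq.nuMinus_dichotomy
      hnr := Ypq.nuPlus_dichotomy }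
  have hpot : ∀ y ∈ d.I, Ypq.potential a yp p q m l Λ y = Ypq.regularPart a yp p q l Λ y +
      Ypq.singularCoeff a ym yp p q m l y / ((y - ym) * (yp - y)) := fun y hy =>
    Ypq.potential_eq hlt.ne hm hpr (hy.2.trans hyp1).ne (hasq y (Ioo_subset_Icc_self hy)).ne'
      (sub_pos.2 hy.1).ne' (sub_pos.2 hy.2).ne'
  have hG : ContinuousOn (Ypq.regularPart a yp p q l Λ) (Icc ym yp) :=
    Ypq.continuousOn_regularPart fun y hy => (hasq y hy).ne'
  have hM : ContDiffOn ℝ 1 (Ypq.singularCoeff a ym yp p q m l) (Icc ym yp) :=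
    Ypq.contDiffOn_singularCoeff (fun y hy => (hasq y hy).ne') fun y hy => (h3 y hy).ne'
  have hcont : ContinuousOn (Ypq.potential a yp p q m l Λ) d.I := by
    refine ContinuousOn.congr ?_ hpot
    refine (hG.mono Ioo_subset_Icc_self).add ((hM.continuousOn.mono Ioo_subset_Icc_self).div
      (by fun_prop) fun y hy => (mul_pos (sub_pos.2 hy.1) (sub_pos.2 hy.2)).ne')
  -- In the decomposed form every term is a square times positive factors, or `Λ / 3`.
  have hnonneg : ∀ y ∈ d.I, 0 ≤ Ypq.potential a yp p q m l Λ y := by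
    intro y hy
    have g1 := hasq y (Ioo_subset_Icc_self hy)
    have g2 := h3 y (Ioo_subset_Icc_self hy)
    have g3 : 0 < y - ym := sub_pos.2 hy.1
    have g4 : 0 < yp - y := sub_pos.2 hy.2
    have g5 : 0 < 1 - y := by linarith
    rw [hpot y hy, Ypq.regularPart, Ypq.singularCoeff]
    positivity
  obtain ⟨C, hC⟩ := d.exists_rem_le (q := Ypq.potential a yp p q m l Λ) hG hM
    (Ypq.singularCoeff_left hlt hm hpr (h3 ym (left_mem_Icc.2 hlt.le))
      (Ypq.nuMinus_sq hq hh hapq))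
    (Ypq.singularCoeff_right hlt hm hpr (h3 yp (right_mem_Icc.2 hlt.le)) (Ypq.nuPlus_sq hq hh))
    hpot
  have hS : ∀ f, ∀ y ∈ d.I, Ypq.S a yp p q m l Λ f y =
      d.expr (Ypq.potential a yp p q m l Λ) f y := by
    intro f y hy
    have hflux : (fun x : ℝ => ((Ypq.rho x * Ypq.w a x * Ypq.r a x : ℝ) : ℂ) * deriv f x) =ᶠ[𝓝 y]
        fun x => (d.P x : ℂ) * deriv f x := by
      filter_upwards [isOpen_Ioo.mem_nhds hy] with x hx
      have g1 := (hasq x (Ioo_subset_Icc_self hx)).ne'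
      have g5 : 1 - x ≠ 0 := by linarith [hx.2.trans hyp1]
      have e : Ypq.rho x * Ypq.w a x * Ypq.r a x = d.P x := by
        have hc := Ypq.cubic_eq_mul hlt.ne hm hpr x
        rw [Ypq.cubic] at hc
        rw [Ypq.rho, Ypq.w, Ypq.r, hc]
        change _ = 2 / 9 * ((x - ym) * (yp - x) * (3 / 2 - ym - yp - x))
        field_simp
        ring
      rw [e]
    have hρ := Complex.ofReal_ne_zero.2 (Ypq.SLData.rho_pos (d := d) hy).ne'
    rw [Ypq.S, Ypq.SLData.expr, hflux.deriv_eq, Ypq.potential]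
    generalize deriv (fun x => (d.P x : ℂ) * deriv f x) y = D
    generalize 1 / Ypq.w a y * Ypq.freq a yp p q l ^ 2 = c₁
    generalize 9 / Ypq.r a y * (2 * (m : ℝ) - Ypq.h a y * Ypq.freq a yp p q l) ^ 2 = c₂
    generalize 6 * Λ / (1 - y) = c₃
    push_cast
    field_simp
    ring
  obtain ⟨A, hA, hdense, hsa, hpos, hspec⟩ := d.exists_realization hcont hnonneg hC
  refine ⟨A, fun u v => (hA u v).trans ?_, hdense, hsa, hpos, hspec⟩
  have hI : ∀ᵐ y ∂d.μ, y ∈ d.I := by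
    rw [Ypq.SLData.ae_mu]; exact ae_restrict_mem measurableSet_Ioo
  refine exists_congr fun f => and_congr Iff.rfl (and_congr ?_ (and_congr Iff.rfl ?_))
  · exact and_congr (imp_congr Ypq.nuMinus_eq_zero_iff Iff.rfl)
      (imp_congr Ypq.nuPlus_eq_zero_iff Iff.rfl)
  · have hSf : d.expr (Ypq.potential a yp p q m l Λ) f =ᵐ[d.μ] Ypq.S a yp p q m l Λ f := by
      filter_upwards [hI] with y hy using (hS f y hy).symm
    exact ⟨fun hv => hv.trans hSf, fun hv => hv.trans hSf.symm⟩
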